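/- **Setting.** Let $E$ be a Banach space, $M$ a Hausdorff smooth manifold modelled on $E$, $\mathbb U$ a complete separable metric space, $T>0$, $S\subset M\times M$ closed, and $f:[0,T]\times M\times\mathbb U\to TM$ with $f(t,q,u)\in T_qM$. Let $\mathcal U$ be the set of measurable $u:[0,T]\to\mathbb U$. For $q\in M$, $u\in\mathcal U$ let $q(t;q,u)$ be the absolutely continuous solution (in charts: a primitive of a Bochner integrable function) of $\dot q(t)=f(t,q(t),u(t))$, $q(0)=q$. A relaxed control is $\nu(t)=\sum_{i=1}^n\lambda_i\delta_{u_i(t)}$ with $u_i\in\mathcal U$, $\lambda_i\ge0$, $\sum_i\lambda_i=1$; its trajectories are those of $\hat f(t,q,\nu(t))=\sum_i\lambda_i f(t,q,u_i(t))$. Fix $(q_0,u_*)\in M\times\mathcal U$ whose trajectory $q_*(t)=q(t;q_0,u_*)$ exists on $[0,T]$, and assume (D): there are finitely many charts $(\mathcal O_i,\varphi_i)$ covering $q_*([0,T])$ and $m,k\in L^1[0,T]$ such that, for each $i$ and almost all $t$ with $q_*(t)\in\mathcal O_i$, for all $u\in\mathbb U$, the coordinate expression $F=(\varphi_{i*}f)(t,\cdot,u)$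 is differentiable on $\varphi_i(\mathcal O_i)$, $\|F\|\le m(t)$, $\|F'\|\le m(t)$, and $F,F'$ are Lipschitz there with constant $k(t)$; moreover $t\mapsto(\varphi_{i*}f)(t,x,u(t))$ is strongly measurable on $\{t: q_*(t)\in\mathcal O_i\}$ for every $x\in\varphi_i(\mathcal O_i)$ and $u\in\mathcal U$. **Lagrangian chart.** Let $V_t$ be a time-dependent vector field on $M$ which, near each point of $M$ and in a suitable chart, is measurable in $t$, is $C^2$ in $x$ for a.a. $t$, and has its derivatives of order $\le2$ bounded by, and its second derivative Lipschitz with constant, some integrable function of $t$; suppose $V_t(q_*(t))=\dot q_*(t)$ for a.a. $t$. Let $(\mathcal O,\varphi)$ be a chart with $q_0\in\mathcal O$ on which the flow $P_{0,t}$ of $V$ is defined for all $t\in[0,T]$. Put $\psi_t=\varphi\circ P_{0,t}^{-1}:P_{0,t}(\mathcal O)\to\varphi(\mathcal O)$ and $g(t,x,u)=(\psi_{t*}f)(t,x,u)-(\psi_{t*}V_t)(x)$. Let $\mathcal O_0$ be a neighbourhood of $q_0$ with $\overline{\mathcal O_0}\subset\mathcal O$, and let $\mathcal X$ be the set of pairs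 $(q,u)\in M\times\mathcal U$ with $q(t;q,u)\in P_{0,t}(\overline{\mathcal O_0})$ for all $t\in[0,T]$. For $(q_i,u_i)\in\mathcal X$ write $x_i(t)=\psi_t(q(t;q_i,u_i))$ and $$\rho(q_1,u_1;q_2,u_2)=\|\varphi(q_1)-\varphi(q_2)\|+\int_0^T\|g(t,x_1(t),u_1(t))-g(t,x_2(t),u_2(t))\|\,dt+\int_0^T\|g_x(t,x_1(t),u_1(t))-g_x(t,x_2(t),u_2(t))\|\,dt .$$ Let $\Phi(q,q')$ be the distance in $E\times E$ (maximum norm) from $(\psi_0(q),\psi_T(q'))$ to $(\psi_0\times\psi_T)\bigl(S\cap(\mathcal O\times P_{0,T}(\mathcal O))\bigr)$. Let $\mathcal A$ be the set of $(q,u)\in\mathcal X$ with $(q,q(T;q,u))\in S$, and $\rho_{\mathcal A}(q,u)=\inf\{\rho(q,u;q',w):(q',w)\in\mathcal A\}$. **Weak controllability.** For $(q,u)\in\mathcal X$ let $V(q,u)$ be the set of $(v_0,v_1)=\frac{d}{d\lambda}\big|_{\lambda=0^+}(q^\lambda(0),q^\lambda(T))$, where $q^\lambda(t)=q\bigl(t;\varphi^{-1}(\varphi(q)+\lambda\varphi_*v_0),(1-\lambda)\delta_u+\lambda\nu\bigr)$,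 $\nu$ is a relaxed control and $\|\varphi_*v_0\|\le1$. For a set $V$ and $v\in V$ let $D^w_V\ell(x;v)=\inf\lim_{n}\frac{\ell(x+\lambda_nv_n)-\ell(x)}{\lambda_n}$, the infimum over sequences $v_n\in V$ converging weakly to $v$ and $\lambda_n\downarrow0$ for which the limit exists; for $\Phi$ it is taken in the coordinates $\psi_0\times\psi_T$. The pair $(q_0,u_*)$ is *weakly controllable in the direction of $S$* if there are $\varepsilon_0,\Delta>0$ such that for every $(q_1,u)\in\mathcal X\setminus\mathcal A$ with $\rho(q_0,u_*;q_1,u)<\varepsilon_0$ there is $(v_0,v_1)\in V(q_1,u)$ with $$D^w_{\overline{V(q_1,u)}}\Phi(q_1,q(T;q_1,u);v_0,v_1)<-\Delta .$$ **Proposition.** Suppose that $(q_0,u_*)\in\mathcal A$ is weakly controllable in the direction of $S$. Then there exist $\varepsilon_1>0$ and $\kappa>0$ such that for every $(q,u)\in\mathcal X$ with $\rho(q_0,u_*;q,u)<\varepsilon_1$, $$\rho_{\mathcal A}(q,u)\le\kappa\,\Phi(q,q(T;q,u)).$$ -/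

import Mathlib

open Set Filter Topology MeasureTheory
open scoped Manifold ContDiff ENNReal

noncomputable section

namespace ControlOnManifold

variable {E : Type*} [NormedAddCommGroup E] [NormedSpace ℝ E]
  {M : Type*} [TopologicalSpace M] [ChartedSpace E M]
  {U : Type*}

/-! ### Vector fields and absolutely continuous solutions -/

variable (E M) in
/-- Nonautonomous vector fields `X_t` on `M`. -/
abbrev TimeField := ℝ → (q : M) → TangentSpace 𝓘(ℝ, E) q

variable (E M U) in
/-- Control systems `f(t, q, u) ∈ T_q M`. -/
abbrev ControlSystem := ℝ → (q : M) → U → TangentSpace 𝓘(ℝ, E) q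

/-- The push-forward `ψ_*(q) v ∈ E` of a tangent vector `v ∈ T_q M`. -/
def push (ψ : M → E) (q : M) (v : TangentSpace 𝓘(ℝ, E) q) : E :=
  mfderiv 𝓘(ℝ, E) 𝓘(ℝ, E) ψ q v

/-- The local coordinate expression `(φ_* X)(x) = φ_*(φ⁻¹(x)) X(φ⁻¹(x))`. -/
def localExpr (φ : OpenPartialHomeomorph M E) (X : (q : M) → TangentSpace 𝓘(ℝ, E) q) (x : E) : E :=
  push φ (φ.symm x) (X (φ.symm x))

/-- `(O, φ)` (with `O = φ.source`) is a smooth coordinate chart of `M`. -/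
def IsChart (φ : OpenPartialHomeomorph M E) : Prop :=
  φ ∈ IsManifold.maximalAtlas 𝓘(ℝ, E) ∞ M

/-- `c : [0,T] → M` is an absolutely continuous solution of `ċ(t) = X_t(c(t))`, `c(0) = q`:
in every chart `c` is a primitive of the Bochner integrable coordinate expression of `X_t(c(t))`. -/
structure IsACSolution (X : TimeField E M) (T : ℝ) (q : M) (c : ℝ → M) : Prop where
  initial : c 0 = q
  continuousOn : ContinuousOn c (Icc 0 T)
  integral_eq : ∀ φ : OpenPartialHomeomorph M E, IsChart φ → ∀ a b : ℝ, 0 ≤ a → a ≤ b → b ≤ T →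
    (∀ s ∈ Icc a b, c s ∈ φ.source) →
      IntervalIntegrable (fun s => push φ (c s) (X s (c s))) volume a b ∧
      φ (c b) - φ (c a) = ∫ s in a..b, push φ (c s) (X s (c s))

open Classical in
/-- The solution on `[0,T]` of `ċ(t) = X_t(c(t))`, `c(0) = q` (constant if there is none). -/
def solution (X : TimeField E M) (T : ℝ) (q : M) : ℝ → M :=
  if h : ∃ c, IsACSolution X T q c then h.choose else fun _ => q

/-- `X_t` is of class `C²` with locally Lipschitz second derivative; as usual for nonautonomous
fields, measurable in `t` and with locally uniform bounds that are integrable in `t`. -/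
def IsRegularField (X : TimeField E M) (T : ℝ) : Prop :=
  ∀ p : M, ∃ φ : OpenPartialHomeomorph M E, IsChart φ ∧ p ∈ φ.source ∧
    ∃ m : ℝ → ℝ, IntegrableOn m (Icc 0 T) ∧
      (∀ x ∈ φ.target,
        AEStronglyMeasurable (fun t => localExpr φ (X t) x) (volume.restrict (Icc 0 T))) ∧
      ∀ᵐ t ∂(volume.restrict (Icc 0 T)),
        ContDiffOn ℝ 2 (localExpr φ (X t)) φ.target ∧
        (∀ j : ℕ, j ≤ 2 → ∀ x ∈ φ.target, ‖iteratedFDeriv ℝ j (localExpr φ (X t)) x‖ ≤ m t) ∧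
        ∀ x ∈ φ.target, ∀ y ∈ φ.target,
          ‖iteratedFDeriv ℝ 2 (localExpr φ (X t)) x - iteratedFDeriv ℝ 2 (localExpr φ (X t)) y‖
            ≤ m t * ‖x - y‖

/-! ### Controls, relaxed controls, trajectories -/

/-- The set `𝒰` of measurable controls on `[0,T]`. -/
def IsControl [MeasurableSpace U] (T : ℝ) (u : ℝ → U) : Prop :=
  AEMeasurable u (volume.restrict (Icc 0 T))

/-- A relaxed control `ν(t) = ∑ᵢ λᵢ δ_{uᵢ(t)}`. -/
structure RelaxedControl (U : Type*) [MeasurableSpace U] (T : ℝ) where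
  n : ℕ
  weight : Fin n → ℝ
  weight_nonneg : ∀ i, 0 ≤ weight i
  weight_sum : ∑ i, weight i = 1
  control : Fin n → ℝ → U
  isControl : ∀ i, IsControl T (control i)

/-- The vector field `(t, q) ↦ f(t, q, u(t))`. -/
def controlField (f : ControlSystem E M U) (u : ℝ → U) : TimeField E M :=
  fun t q => f t q (u t)

/-- The vector field `(t, q) ↦ f̂(t, q, ν(t)) = ∑ᵢ λᵢ f(t, q, uᵢ(t))`. -/
def relaxedField [MeasurableSpace U] {T : ℝ} (f : ControlSystem E M U) (ν : RelaxedControl U T) :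
    TimeField E M :=
  fun t q => ∑ i, ν.weight i • f t q (ν.control i t)

/-- The trajectory `q(t; q, u)`. -/
def traj (f : ControlSystem E M U) (T : ℝ) (q : M) (u : ℝ → U) : ℝ → M :=
  solution (controlField f u) T q

/-- The trajectory `q(t; q, (1 - r) δ_u + r ν)`. -/
def relaxedTraj [MeasurableSpace U] {T : ℝ} (f : ControlSystem E M U) (q : M) (u : ℝ → U)
    (ν : RelaxedControl U T) (r : ℝ) : ℝ → M :=
  solution (fun t p => (1 - r) • controlField f u t p + r • relaxedField f ν t p) T q

/-- Assumption (D) on `f` along a curve `qs : [0,T] → M`; `measurable` makes explicit that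
`t ↦ f(t, q, u(t))` is measurable for measurable controls `u`. -/
structure AssumptionD [MeasurableSpace U] (f : ControlSystem E M U) (T : ℝ) (qs : ℝ → M) :
    Prop where
  exists_charts : ∃ (N : ℕ) (φ : Fin N → OpenPartialHomeomorph M E) (m k : ℝ → ℝ),
    (∀ i, IsChart (φ i)) ∧
    (∀ t ∈ Icc 0 T, ∃ i, qs t ∈ (φ i).source) ∧
    IntegrableOn m (Icc 0 T) ∧ IntegrableOn k (Icc 0 T) ∧
    (∀ i, ∀ x ∈ (φ i).target, ∀ u : ℝ → U, IsControl T u →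
      AEStronglyMeasurable (fun t => localExpr (φ i) (controlField f u t) x)
        (volume.restrict {t ∈ Icc 0 T | qs t ∈ (φ i).source})) ∧
    ∀ i, ∀ᵐ t ∂(volume.restrict (Icc 0 T)), qs t ∈ (φ i).source → ∀ u : U,
      let F : E → E := localExpr (φ i) (fun q => f t q u)
      (∀ x ∈ (φ i).target, DifferentiableAt ℝ F x ∧ ‖F x‖ ≤ m t ∧ ‖fderiv ℝ F x‖ ≤ m t) ∧
      ∀ x ∈ (φ i).target, ∀ y ∈ (φ i).target,
        ‖F x - F y‖ ≤ k t * ‖x - y‖ ∧ ‖fderiv ℝ F x - fderiv ℝ F y‖ ≤ k t * ‖x - y‖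

/-! ### Lagrangian charts -/

/-- A Lagrangian chart along `qs`: a regular nonautonomous field `V_t` with
`V_t(qs(t)) = (d/dt) qs(t)` for a.a. `t`, and a chart `(O, φ)` at `qs(0)` such that the flow of
`V` is defined on `O` for all times in `[0,T]`. -/
structure LagrangianChart (E : Type*) [NormedAddCommGroup E] [NormedSpace ℝ E]
    {M : Type*} [TopologicalSpace M] [ChartedSpace E M] (T : ℝ) (qs : ℝ → M) where
  V : TimeField E M
  regular : IsRegularField V T
  V_extends : IsACSolution V T (qs 0) qs
  φ : OpenPartialHomeomorph M E
  isChart : IsChart φ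
  base_mem : qs 0 ∈ φ.source
  flow_exists : ∀ q ∈ φ.source, ∃ c, IsACSolution V T q c

namespace LagrangianChart

variable {T : ℝ} {qs : ℝ → M} (L : LagrangianChart E T qs)

/-- The flow map `P_{0,t}`. -/
def P (t : ℝ) (q : M) : M := solution L.V T q t

open Classical in
/-- `ψ_t = φ ∘ P_{t,0}` on `P_{0,t}(O)` (and `0` elsewhere). -/
def ψ (t : ℝ) (p : M) : E :=
  if h : ∃ q ∈ L.φ.source, L.P t q = p then L.φ h.choose else 0

/-- `ψ_t⁻¹ = P_{0,t} ∘ φ⁻¹ : φ(O) → P_{0,t}(O)`. -/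
def ψinv (t : ℝ) (x : E) : M := L.P t (L.φ.symm x)

/-- The control system `g(t, x, u) = (ψ_{t*} f)(t, x, u) - (ψ_{t*} V_t)(x)`. -/
def g (f : ControlSystem E M U) (t : ℝ) (x : E) (u : U) : E :=
  push (L.ψ t) (L.ψinv t x) (f t (L.ψinv t x) u) - push (L.ψ t) (L.ψinv t x) (L.V t (L.ψinv t x))

/-- The derivative `g_x(t, x, u) ∈ L(E, E)`. -/
def gx (f : ControlSystem E M U) (t : ℝ) (x : E) (u : U) : E →L[ℝ] E :=
  fderiv ℝ (fun y => L.g f t y u) x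

/-- The trajectory in Lagrangian coordinates, `x(t) = ψ_t(q(t; q, u))`. -/
def x (f : ControlSystem E M U) (q : M) (u : ℝ → U) (t : ℝ) : E := L.ψ t (traj f T q u t)

/-- The set `𝒳` of pairs `(q, u)` with `q(t; q, u) ∈ P_{0,t}(closure O₀)` for all `t`. -/
def X [MeasurableSpace U] (f : ControlSystem E M U) (O₀ : Set M) : Set (M × (ℝ → U)) :=
  {p | IsControl T p.2 ∧ (∃ c, IsACSolution (controlField f p.2) T p.1 c) ∧
    ∀ t ∈ Icc 0 T, traj f T p.1 p.2 t ∈ L.P t '' closure O₀}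

/-- The pseudometric `ρ(q₁, u₁; q₂, u₂)`. -/
def rho (f : ControlSystem E M U) (p₁ p₂ : M × (ℝ → U)) : ℝ≥0∞ :=
  ‖L.φ p₁.1 - L.φ p₂.1‖ₑ
    + (∫⁻ t in Icc 0 T, ‖L.g f t (L.x f p₁.1 p₁.2 t) (p₁.2 t)
        - L.g f t (L.x f p₂.1 p₂.2 t) (p₂.2 t)‖ₑ)
    + ∫⁻ t in Icc 0 T, ‖L.gx f t (L.x f p₁.1 p₁.2 t) (p₁.2 t)
        - L.gx f t (L.x f p₂.1 p₂.2 t) (p₂.2 t)‖ₑ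

/-- The set `(ψ₀ × ψ_T)(S)`, i.e. the image of `S ∩ (O × P_{0,T}(O))`. -/
def imageS (S : Set (M × M)) : Set (E × E) :=
  (fun p : M × M => (L.ψ 0 p.1, L.ψ T p.2)) '' (S ∩ L.φ.source ×ˢ (L.P T '' L.φ.source))

/-- `Φ` in the coordinates `ψ₀ × ψ_T`: the distance to `(ψ₀ × ψ_T)(S)`. -/
def PhiCoord (S : Set (M × M)) (z : E × E) : ℝ := Metric.infDist z (L.imageS S)

/-- `Φ(q, q') = d_{(ψ₀ × ψ_T)(S)}(ψ₀(q), ψ_T(q'))`. -/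
def Phi (S : Set (M × M)) (q q' : M) : ℝ := L.PhiCoord S (L.ψ 0 q, L.ψ T q')

/-- The set `𝒜` of pairs `(q, u) ∈ 𝒳` with `(q, q(T; q, u)) ∈ S`. -/
def admissible [MeasurableSpace U] (f : ControlSystem E M U) (O₀ : Set M) (S : Set (M × M)) :
    Set (M × (ℝ → U)) :=
  {p | p ∈ L.X f O₀ ∧ (p.1, traj f T p.1 p.2 T) ∈ S}

/-- `ρ_𝒜(q, u)`. -/
def rhoA [MeasurableSpace U] (f : ControlSystem E M U) (O₀ : Set M) (S : Set (M × M))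
    (p : M × (ℝ → U)) : ℝ≥0∞ :=
  ⨅ p' ∈ L.admissible f O₀ S, L.rho f p p'

/-- The set `V(q, u)` of infinitesimal variations `(v₀, v₁) = d/dr|_{r=0+} (q^r(0), q^r(T))`,
`q^r(t) = q(t; φ⁻¹(φ(q) + r φ_* v₀), (1 - r) δ_u + r ν)`, where `‖φ_* v₀‖ ≤ 1` and `ν` is a
relaxed control. The vectors are given by their coordinates
`(w₀, w₁) = (ψ_{0*} v₀, ψ_{T*} v₁)`; note `ψ₀ = φ`. -/
def variations [MeasurableSpace U] (f : ControlSystem E M U) (p : M × (ℝ → U)) : Set (E × E) :=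
  {w | ‖w.1‖ ≤ 1 ∧ ∃ ν : RelaxedControl U T,
    HasDerivWithinAt
      (fun r : ℝ => L.ψ T (relaxedTraj f (L.φ.symm (L.φ p.1 + r • w.1)) p.2 ν r T))
      w.2 (Ici 0) 0}

end LagrangianChart

/-! ### Set-constrained weak lower Dini derivative and weak controllability -/

/-- Weak convergence of sequences in a normed space. -/
def WeaklyTendsto {F : Type*} [NormedAddCommGroup F] [NormedSpace ℝ F] (v : ℕ → F) (w : F) : Prop :=
  ∀ ℓ : F →L[ℝ] ℝ, Tendsto (fun n => ℓ (v n)) atTop (𝓝 (ℓ w))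

/-- `D^w_V ℓ(x; v)`: the infimum of the limits of `(ℓ(x + rₙ vₙ) - ℓ(x)) / rₙ` over sequences
`vₙ ∈ V` converging weakly to `v` and `rₙ ↓ 0` for which the limit exists. -/
def weakLowerDini {F : Type*} [NormedAddCommGroup F] [NormedSpace ℝ F]
    (V : Set F) (ℓ : F → ℝ) (x v : F) : EReal :=
  sInf {d : EReal | ∃ (w : ℕ → F) (r : ℕ → ℝ), (∀ n, w n ∈ V) ∧ WeaklyTendsto w v ∧
    Tendsto r atTop (𝓝[>] 0) ∧ (∀ n, 0 < r n) ∧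
    Tendsto (fun n => (((ℓ (x + r n • w n) - ℓ x) / r n : ℝ) : EReal)) atTop (𝓝 d)}

/-- Weak controllability of `p₀ = (q₀, u_*)` in the direction of `S`: with constants
`ε₀, Δ > 0`, at every non-admissible pair `p` with `ρ(p₀, p) < ε₀` some infinitesimal
variation decreases `Φ` at a rate better than `-Δ`. (At an admissible pair `Φ` has its minimal value
`0`, so that such a decrease is impossible there.) -/
def WeaklyControllable [MeasurableSpace U] {T : ℝ} {qs : ℝ → M} (L : LagrangianChart E T qs)
    (f : ControlSystem E M U) (O₀ : Set M) (S : Set (M × M)) (p₀ : M × (ℝ → U)) : Prop :=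
  ∃ ε₀ Δ : ℝ, 0 < ε₀ ∧ 0 < Δ ∧
    ∀ p ∈ L.X f O₀, p ∉ L.admissible f O₀ S → L.rho f p₀ p < ENNReal.ofReal ε₀ →
      ∃ v ∈ L.variations f p,
        weakLowerDini (closure (L.variations f p)) (L.PhiCoord S)
          (L.ψ 0 p.1, L.ψ T (traj f T p.1 p.2 T)) v < ((-Δ : ℝ) : EReal)

end ControlOnManifold

end

/-! In the Lagrangian coordinates x(t) = ψ_t(q(t)) the reference trajectory is the constant x₀ =
φ(q₀), and nearby trajectories solve ẋ = g(t, x, u). The claim becomes metric regularity of the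
endpoint map (z, w) ↦ (z, x(T; z, w)) relative to (ψ₀ × ψ_T)(S). It follows from Ekeland's
principle: at an Ekeland point that is not admissible, weak controllability would produce a descent
of Φ steeper than Ekeland's slope.

Reduction to a ball in E (`exists_tubeOn`). On a ball about x₀ the field g is of class C^{1,1} in x
with bounds h(t) ∈ L¹ uniform in u, and curves solving the g-equation there correspond to
trajectories of f on M. With ξ_t = χ ∘ ψ_t⁻¹ in a chart χ one has g = (Dξ_t)⁻¹(f − V) ∘ ξ_t; hence
Dξ_t must itself be C^{1,1} with bounded inverse, which is why V is required to be C² with Lipschitz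
second derivative. This is proved on short time intervals (`flow_C21`, `RegularAt.exists_flowOn`)
and glued. Replacing x by its radial retraction onto a smaller ball makes all trajectories exist on
[0, T].

The complete space. Pairs (z, w) carry the distance ‖z − z'‖ + μ{w ≠ w'}, where μ has density h ≥ 1.
This space of pairs is complete (`exists_tendsto_controlDist`), trajectories are Lipschitz in the
pair (`exists_traj_lipschitz`), hence so is Φ at the endpoints. Ekeland's principle with slope κ
(`exists_ekeland`) gives, from any starting pair, a pair at distance at most Φ/κ from which no other
pair lowers Φ faster than κ times the distance.

The contradiction (`TubeOn.exists_decrease`). If the Ekeland pair were not admissible, weak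
controllability would give elements of the closure of the variations along which Φ decreases at a
rate better than Δ. Approximate one of them by a genuine variation, given by a relaxed control with
parameter r. The endpoint expansion is uniform up to O(r²) (`exists_traj_expansion`), and fast
switching (`exists_chattering`) replaces the relaxed control by an ordinary one at distance about
r∫h from w. Thus Φ drops by nearly Δr at a cost of about r(1 + ∫h), contradicting the choice κ(1 +
∫h) < Δ.

So the Ekeland pair is admissible. Its distance to the given pair is at most Φ/κ, and ρ is bounded
by a multiple of that distance (`TubeOn.rho_le`). -/

namespace ControlOnManifold

/-! ### Primitives of integrable functions: Gronwall, measurability along curves, existence of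
solutions. -/

section Intervals

/-- A transitive relation between the endpoints of subintervals of `[a, b]` that holds on all short
subintervals holds on `[a, b]`. -/
theorem interval_glue {P : ℝ → ℝ → Prop} {a b : ℝ} (hab : a ≤ b)
    (htrans : ∀ r s t, a ≤ r → r ≤ s → s ≤ t → t ≤ b → P r s → P s t → P r t)
    (hloc : ∀ t₀ ∈ Icc a b, ∃ ε > 0, ∀ r s, a ≤ r → r ≤ s → s ≤ b → |r - t₀| < ε → |s - t₀| < ε →
      P r s) : P a b := by
  choose! ε hε hP using hloc
  let c : Icc a b → Set (Icc a b) := fun t₀ => {t | |(t : ℝ) - t₀| < ε t₀}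
  obtain ⟨t, ht0, hmono, ⟨m, hm⟩, hsub⟩ := exists_monotone_Icc_subset_open_cover_Icc (c := c) hab
    (fun i => isOpen_lt (by fun_prop) continuous_const)
    (fun t _ => mem_iUnion.2 ⟨t, by simpa [c] using hε t t.2⟩)
  have key : ∀ n, P (t n) (t (n + 1)) := by
    intro n
    obtain ⟨i, hi⟩ := hsub n
    have hle : t n ≤ t (n + 1) := hmono n.le_succ
    exact hP i i.2 _ _ (t n).2.1 hle (t (n + 1)).2.2
      (hi (left_mem_Icc.2 hle)) (hi (right_mem_Icc.2 hle))
  have all : ∀ n, P a (t n) := by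
    intro n
    induction n with
    | zero =>
      -- Reflexivity of `P` at `a` comes from the local hypothesis on the degenerate interval [a,
      -- a].
      obtain ⟨i, hi⟩ := hsub 0
      have hle : t 0 ≤ t 1 := hmono (Nat.zero_le 1)
      have := hP i i.2 (t 0) (t 0) (t 0).2.1 le_rfl (t 0).2.2
        (hi (left_mem_Icc.2 hle)) (hi (left_mem_Icc.2 hle))
      simpa [ht0] using this
    | succ n ih =>
      exact htrans _ _ _ le_rfl (t n).2.1 (hmono n.le_succ) (t (n + 1)).2.2 ih (key n)
  simpa [hm m le_rfl] using all m

variable {E : Type*} [NormedAddCommGroup E]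

theorem intervalIntegrable_of_integrableOn {f : ℝ → E} {a b s t : ℝ} (hf : IntegrableOn f (Icc a b))
    (has : a ≤ s) (hst : s ≤ t) (htb : t ≤ b) : IntervalIntegrable f volume s t :=
  (intervalIntegrable_iff_integrableOn_Icc_of_le hst).2 (hf.mono_set (Icc_subset_Icc has htb))

theorem continuousOn_primitive_of_integrableOn [NormedSpace ℝ E] {f : ℝ → E} {a b : ℝ}
    (hf : IntegrableOn f (Icc a b)) : ContinuousOn (fun x => ∫ t in a..x, f t) (Icc a b) := by
  rcases le_total a b with hab | hab
  · have := intervalIntegral.continuousOn_primitive_interval (μ := volume) (a := a) (b := b)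
      (f := f)
      (by rwa [uIcc_of_le hab])
    rwa [uIcc_of_le hab] at this
  · exact (subsingleton_Icc_of_ge hab).continuousOn _

/-- The integral of an integrable function is small on short intervals. -/
theorem exists_integral_le {k : ℝ → ℝ} {a b : ℝ} (hk : IntegrableOn k (Icc a b))
    {η : ℝ} (hη : 0 < η) (t₀ : ℝ) (ht₀ : t₀ ∈ Icc a b) :
    ∃ ε > 0, ∀ r s, a ≤ r → r ≤ s → s ≤ b → |r - t₀| < ε → |s - t₀| < ε →
      ∫ t in r..s, k t ≤ η := by
  have hc : ContinuousOn (fun x => ∫ t in a..x, k t) (Icc a b) :=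
    continuousOn_primitive_of_integrableOn hk
  obtain ⟨ε, hε, h⟩ := Metric.continuousOn_iff.1 hc t₀ ht₀ (η / 2) (by positivity)
  refine ⟨ε, hε, fun r s har hrs hsb hr hs => ?_⟩
  have h1 := h r ⟨har, hrs.trans hsb⟩ (by simpa [Real.dist_eq] using hr)
  have h2 := h s ⟨har.trans hrs, hsb⟩ (by simpa [Real.dist_eq] using hs)
  have h3 : (∫ t in a..r, k t) + ∫ t in r..s, k t = ∫ t in a..s, k t :=
    intervalIntegral.integral_add_adjacent_intervals
      (intervalIntegrable_of_integrableOn hk le_rfl har (hrs.trans hsb))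
      (intervalIntegrable_of_integrableOn hk har hrs hsb)
  rw [Real.dist_eq] at h1 h2
  rw [abs_lt] at h1 h2
  linarith [h1.1, h2.2]

variable [NormedSpace ℝ E]

/-- `x` is a primitive on `[a, b]` of the integrable function `γ`. -/
structure IsPrim (x γ : ℝ → E) (a b : ℝ) : Prop where
  integrable : IntegrableOn γ (Icc a b)
  sub : ∀ s t, a ≤ s → s ≤ t → t ≤ b → x t - x s = ∫ r in s..t, γ r

theorem IsPrim.mono {x γ : ℝ → E} {a b c d : ℝ} (h : IsPrim x γ a b) (hac : a ≤ c) (hdb : d ≤ b) :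
    IsPrim x γ c d :=
  ⟨h.integrable.mono_set (Icc_subset_Icc hac hdb),
    fun s t hs hst ht => h.sub s t (hac.trans hs) hst (ht.trans hdb)⟩

theorem IsPrim.of_eq {x γ : ℝ → E} {a b : ℝ} (hγ : IntegrableOn γ (Icc a b))
    (h : ∀ t ∈ Icc a b, x t = x a + ∫ r in a..t, γ r) : IsPrim x γ a b := by
  refine ⟨hγ, fun s t hs hst ht => ?_⟩
  rw [h t ⟨hs.trans hst, ht⟩, h s ⟨hs, hst.trans ht⟩, add_sub_add_left_eq_sub,
    intervalIntegral.integral_interval_sub_left]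
  · exact intervalIntegrable_of_integrableOn hγ le_rfl (hs.trans hst) ht
  · exact intervalIntegrable_of_integrableOn hγ le_rfl hs (hst.trans ht)

theorem IsPrim.eq {x γ : ℝ → E} {a b t : ℝ} (h : IsPrim x γ a b) (ht : t ∈ Icc a b) :
    x t = x a + ∫ r in a..t, γ r := by
  rw [← h.sub a t le_rfl ht.1 ht.2]; abel

theorem IsPrim.trans {x γ : ℝ → E} {a b c : ℝ} (hab : a ≤ b) (hbc : b ≤ c)
    (h₁ : IsPrim x γ a b) (h₂ : IsPrim x γ b c) : IsPrim x γ a c := by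
  have hγ : IntegrableOn γ (Icc a c) := by
    rw [← Icc_union_Icc_eq_Icc hab hbc]; exact h₁.integrable.union h₂.integrable
  refine IsPrim.of_eq hγ fun t ht => ?_
  rcases le_total t b with h | h
  · exact h₁.eq ⟨ht.1, h⟩
  · rw [h₂.eq ⟨h, ht.2⟩, h₁.eq ⟨hab, le_rfl⟩, add_assoc,
      intervalIntegral.integral_add_adjacent_intervals]
    · exact intervalIntegrable_of_integrableOn hγ le_rfl hab hbc
    · exact intervalIntegrable_of_integrableOn hγ hab h ht.2

theorem IsPrim.continuousOn {x γ : ℝ → E} {a b : ℝ} (h : IsPrim x γ a b) :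
    ContinuousOn x (Icc a b) :=
  (continuousOn_const.add (continuousOn_primitive_of_integrableOn h.integrable)).congr
    fun _ ht => h.eq ht

theorem IsPrim.congr {x y γ κ : ℝ → E} {a b : ℝ} (h : IsPrim x γ a b)
    (hxy : ∀ t ∈ Icc a b, y t = x t) (hγ : ∀ᵐ t ∂volume.restrict (Icc a b), κ t = γ t) :
    IsPrim y κ a b := by
  refine ⟨h.integrable.congr (hγ.mono fun t ht => ht.symm), fun s t hs hst ht => ?_⟩
  rw [hxy t ⟨hs.trans hst, ht⟩, hxy s ⟨hs, hst.trans ht⟩, h.sub s t hs hst ht]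
  refine intervalIntegral.integral_congr_ae ?_
  have := (ae_restrict_iff' measurableSet_Icc).1 hγ
  filter_upwards [this] with r hr hr'
  rw [uIoc_of_le hst] at hr'
  exact (hr ⟨hs.trans hr'.1.le, hr'.2.trans ht⟩).symm

theorem IsPrim.subFun {x y γ κ : ℝ → E} {a b : ℝ} (h : IsPrim x γ a b) (h' : IsPrim y κ a b) :
    IsPrim (fun t => x t - y t) (fun t => γ t - κ t) a b := by
  refine ⟨h.integrable.sub h'.integrable, fun s t hs hst ht => ?_⟩
  rw [intervalIntegral.integral_sub, ← h.sub s t hs hst ht, ← h'.sub s t hs hst ht]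
  · abel
  · exact intervalIntegrable_of_integrableOn h.integrable hs hst ht
  · exact intervalIntegrable_of_integrableOn h'.integrable hs hst ht

theorem IsPrim.addFun {x y γ κ : ℝ → E} {a b : ℝ} (h : IsPrim x γ a b) (h' : IsPrim y κ a b) :
    IsPrim (fun t => x t + y t) (fun t => γ t + κ t) a b := by
  refine ⟨h.integrable.add h'.integrable, fun s t hs hst ht => ?_⟩
  rw [intervalIntegral.integral_add, ← h.sub s t hs hst ht, ← h'.sub s t hs hst ht]
  · abel
  · exact intervalIntegrable_of_integrableOn h.integrable hs hst ht
  · exact intervalIntegrable_of_integrableOn h'.integrable hs hst ht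

theorem IsPrim.smulFun {x γ : ℝ → E} {a b : ℝ} (h : IsPrim x γ a b) (c : ℝ) :
    IsPrim (fun t => c • x t) (fun t => c • γ t) a b := by
  refine ⟨h.integrable.smul c, fun s t hs hst ht => ?_⟩
  rw [intervalIntegral.integral_smul, ← h.sub s t hs hst ht, smul_sub]

theorem norm_integral_le_of_ae_le {f : ℝ → E} {k : ℝ → ℝ} {a b s t : ℝ}
    (hk : IntegrableOn k (Icc a b)) (has : a ≤ s) (hst : s ≤ t) (htb : t ≤ b)
    (h : ∀ᵐ r ∂volume.restrict (Icc a b), ‖f r‖ ≤ k r) :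
    ‖∫ r in s..t, f r‖ ≤ ∫ r in s..t, k r := by
  refine intervalIntegral.norm_integral_le_of_norm_le hst ?_
    (intervalIntegrable_of_integrableOn hk has hst htb)
  filter_upwards [(ae_restrict_iff' measurableSet_Icc).1 h] with r hr hr'
  exact hr ⟨has.trans hr'.1.le, hr'.2.trans htb⟩

theorem IsPrim.norm_sub_le {x γ : ℝ → E} {k : ℝ → ℝ} {a b s t : ℝ} (hx : IsPrim x γ a b)
    (hk : IntegrableOn k (Icc a b)) (has : a ≤ s) (hst : s ≤ t) (htb : t ≤ b)
    (h : ∀ᵐ r ∂volume.restrict (Icc a b), ‖γ r‖ ≤ k r) :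
    ‖x t - x s‖ ≤ ∫ r in s..t, k r := by
  rw [hx.sub s t has hst htb]; exact norm_integral_le_of_ae_le hk has hst htb h

theorem integral_mono_interval {k : ℝ → ℝ} {a b s t : ℝ} (hk : IntegrableOn k (Icc a b))
    (h0 : ∀ r, 0 ≤ k r) (has : a ≤ s) (hst : s ≤ t) (htb : t ≤ b) :
    ∫ r in s..t, k r ≤ ∫ r in a..b, k r :=
  intervalIntegral.integral_mono_interval has hst htb (ae_of_all _ h0)
    (intervalIntegrable_of_integrableOn hk le_rfl (has.trans (hst.trans htb)) le_rfl)

theorem integrableOn_mul_continuousOn {k φ : ℝ → ℝ} {a b : ℝ} (hk : IntegrableOn k (Icc a b))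
    (hφ : ContinuousOn φ (Icc a b)) : IntegrableOn (fun t => k t * φ t) (Icc a b) :=
  hk.mul_continuousOn hφ isCompact_Icc

/-- Gronwall's inequality with an integrable coefficient. -/
theorem gronwall {k : ℝ → ℝ} {a b : ℝ} (hab : a ≤ b) (hk : IntegrableOn k (Icc a b))
    (hk0 : ∀ t, 0 ≤ k t) :
    ∃ C, 1 ≤ C ∧ ∀ (φ : ℝ → ℝ) (α : ℝ), ContinuousOn φ (Icc a b) →
      (∀ t ∈ Icc a b, φ t ≤ α + ∫ s in a..t, k s * φ s) → 0 ≤ α → (∀ t ∈ Icc a b, 0 ≤ φ t) →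
      ∀ t ∈ Icc a b, φ t ≤ C * α := by
  -- The glued property has one constant for all φ and α. On an interval with ∫k ≤ 1/2 the maximum
  -- of φ is absorbed by the left-hand side, which gives the constant 2.
  let P : ℝ → ℝ → Prop := fun r s => ∃ C, 1 ≤ C ∧ ∀ (φ : ℝ → ℝ) (α : ℝ),
    ContinuousOn φ (Icc r s) → (∀ t ∈ Icc r s, φ t ≤ α + ∫ τ in r..t, k τ * φ τ) → 0 ≤ α →
      (∀ t ∈ Icc r s, 0 ≤ φ t) → ∀ t ∈ Icc r s, φ t ≤ C * α
  refine interval_glue (P := P) hab ?_ ?_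
  · rintro r s t har hrs hst htb ⟨C₁, hC₁, h₁⟩ ⟨C₂, hC₂, h₂⟩
    have hkrt : IntegrableOn k (Icc r t) := hk.mono_set (Icc_subset_Icc har htb)
    set K := ∫ τ in r..t, k τ with hK
    have hK0 : 0 ≤ K := intervalIntegral.integral_nonneg (hrs.trans hst) fun τ _ => hk0 τ
    -- On [s, t] the inequality holds with α enlarged by the contribution K C₁ α of [r, s]; the
    -- summand C₁ serves [r, s] itself.
    refine ⟨C₁ + C₂ * (1 + K * C₁), by nlinarith [mul_nonneg hK0 (zero_le_one.trans hC₁)], ?_⟩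
    intro φ α hφ hle hα hφ0 τ hτ
    have hA : ∀ t ∈ Icc r s, φ t ≤ C₁ * α :=
      h₁ φ α (hφ.mono (Icc_subset_Icc le_rfl hst)) (fun t ht => hle t ⟨ht.1, ht.2.trans hst⟩) hα
        (fun t ht => hφ0 t ⟨ht.1, ht.2.trans hst⟩)
    have hCα : 0 ≤ C₁ * α := by positivity
    rcases le_total τ s with h | h
    · refine (hA τ ⟨hτ.1, h⟩).trans ?_
      have : 0 ≤ C₂ * (1 + K * C₁) := by positivity
      nlinarith
    · have hkφ : IntegrableOn (fun t => k t * φ t) (Icc r t) :=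
        integrableOn_mul_continuousOn hkrt hφ
      have hB := h₂ φ (α + K * (C₁ * α)) (hφ.mono (Icc_subset_Icc hrs le_rfl)) ?_ (by positivity)
        (fun t ht => hφ0 t ⟨hrs.trans ht.1, ht.2⟩) τ ⟨h, hτ.2⟩
      · nlinarith
      · intro t' ht'
        refine (hle t' ⟨hrs.trans ht'.1, ht'.2⟩).trans ?_
        rw [← intervalIntegral.integral_add_adjacent_intervals (b := s)
          (intervalIntegrable_of_integrableOn hkφ le_rfl hrs hst)
          (intervalIntegrable_of_integrableOn hkφ hrs ht'.1 ht'.2), ← add_assoc]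
        gcongr
        calc ∫ τ in r..s, k τ * φ τ ≤ ∫ τ in r..s, k τ * (C₁ * α) := by
              refine intervalIntegral.integral_mono_on hrs
                (intervalIntegrable_of_integrableOn hkφ le_rfl hrs hst) ?_ ?_
              · exact (intervalIntegrable_of_integrableOn hkrt le_rfl hrs hst).mul_const _
              · intro x hx
                exact mul_le_mul_of_nonneg_left (hA x hx) (hk0 x)
          _ = (∫ τ in r..s, k τ) * (C₁ * α) := intervalIntegral.integral_mul_const _ _
          _ ≤ K * (C₁ * α) := by
              gcongr
              exact integral_mono_interval hkrt hk0 le_rfl hrs hst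
  · intro t₀ ht₀
    obtain ⟨ε, hε, h⟩ := exists_integral_le hk (η := 1 / 2) (by norm_num) t₀ ht₀
    refine ⟨ε, hε, fun r s har hrs hsb hr hs => ⟨2, by norm_num, ?_⟩⟩
    intro φ α hφ hle hα hφ0
    have hkrs : IntegrableOn k (Icc r s) := hk.mono_set (Icc_subset_Icc har hsb)
    obtain ⟨τ, hτ, hmax⟩ := isCompact_Icc.exists_isMaxOn (nonempty_Icc.2 hrs) hφ
    have hkφ : IntegrableOn (fun t => k t * φ t) (Icc r s) := integrableOn_mul_continuousOn hkrs hφ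
    have h1 : ∫ x in r..τ, k x * φ x ≤ 1 / 2 * φ τ := by
      calc ∫ x in r..τ, k x * φ x ≤ ∫ x in r..τ, k x * φ τ := by
            refine intervalIntegral.integral_mono_on hτ.1
                (intervalIntegrable_of_integrableOn hkφ le_rfl hτ.1 hτ.2) ?_ ?_
            · exact (intervalIntegrable_of_integrableOn hkrs le_rfl hτ.1 hτ.2).mul_const _
            · intro x hx
              exact mul_le_mul_of_nonneg_left (hmax ⟨hx.1, hx.2.trans hτ.2⟩) (hk0 x)
        _ = (∫ x in r..τ, k x) * φ τ := intervalIntegral.integral_mul_const _ _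
        _ ≤ 1 / 2 * φ τ := by
            gcongr
            · exact hφ0 τ hτ
            · exact (integral_mono_interval hkrs hk0 le_rfl hτ.1 hτ.2).trans
                (h r s har hrs hsb hr hs)
    have h2 := hle τ hτ
    intro t ht
    have h3 : φ t ≤ φ τ := hmax ht
    linarith

/-- A function whose increments agree with those of a primitive up to second order is
that primitive. -/
theorem IsPrim.of_quadratic {y p : ℝ → E} {m : ℝ → ℝ} {a b C : ℝ} (hp : IntegrableOn p (Icc a b))
    (hm : IntegrableOn m (Icc a b)) (hm0 : ∀ t, 0 ≤ m t)
    (h : ∀ s t, a ≤ s → s ≤ t → t ≤ b →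
      ‖y t - y s - ∫ r in s..t, p r‖ ≤ C * (∫ r in s..t, m r) ^ 2) : IsPrim y p a b := by
  -- Cut [s, t] where the mass of m is halved: the two squared halves add up to half the square, so
  -- every bisection gains a factor 1/2.
  have key : ∀ n : ℕ, ∀ s t, a ≤ s → s ≤ t → t ≤ b →
      ‖y t - y s - ∫ r in s..t, p r‖ ≤ C * (∫ r in s..t, m r) ^ 2 * (1 / 2) ^ n := by
    intro n
    induction n with
    | zero => simpa using h
    | succ n ih =>
      intro s t has hst htb
      have hint : ∀ {s t}, a ≤ s → s ≤ t → t ≤ b → IntervalIntegrable m volume s t :=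
        fun h1 h2 h3 => intervalIntegrable_of_integrableOn hm h1 h2 h3
      have hcont : ContinuousOn (fun x => ∫ r in s..x, m r) (Icc s t) :=
        continuousOn_primitive_of_integrableOn (hm.mono_set (Icc_subset_Icc has htb))
      have hH : 0 ≤ ∫ r in s..t, m r := intervalIntegral.integral_nonneg hst fun r _ => hm0 r
      obtain ⟨r, hr, hr2⟩ := intermediate_value_Icc hst hcont
        (show (∫ r in s..t, m r) / 2 ∈ Icc _ _ by
          constructor
          · simp only [intervalIntegral.integral_same]; linarith
          · linarith)
      simp only at hr2
      have hadd := intervalIntegral.integral_add_adjacent_intervals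
        (hint has hr.1 (hr.2.trans htb)) (hint (has.trans hr.1) hr.2 htb)
      have hadd' := intervalIntegral.integral_add_adjacent_intervals
        (intervalIntegrable_of_integrableOn hp has hr.1 (hr.2.trans htb))
        (intervalIntegrable_of_integrableOn hp (has.trans hr.1) hr.2 htb)
      have hr3 : ∫ x in r..t, m x = (∫ x in s..t, m x) / 2 := by linarith
      have e1 := ih s r has hr.1 (hr.2.trans htb)
      have e2 := ih r t (has.trans hr.1) hr.2 htb
      rw [hr2] at e1
      rw [hr3] at e2
      calc ‖y t - y s - ∫ r in s..t, p r‖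
          = ‖(y r - y s - ∫ x in s..r, p x) + (y t - y r - ∫ x in r..t, p x)‖ := by
            rw [← hadd']; congr 1; abel
        _ ≤ _ := (norm_add_le _ _).trans (add_le_add e1 e2)
        _ = _ := by ring
  refine ⟨hp, fun s t has hst htb => ?_⟩
  have hlim : Tendsto (fun n : ℕ => C * (∫ r in s..t, m r) ^ 2 * (1 / 2 : ℝ) ^ n) atTop (𝓝 0) := by
    simpa using (tendsto_pow_atTop_nhds_zero_of_lt_one (r := (1 / 2 : ℝ)) (by norm_num)
      (by norm_num)).const_mul
      (C * (∫ r in s..t, m r) ^ 2)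
  have := ge_of_tendsto' hlim fun n => key n s t has hst htb
  exact sub_eq_zero.1 (norm_le_zero_iff.1 this)

/-- The curve is sampled at the times ⌊(n+1)t⌋/(n+1), projected back to [a, b]. On each of the
countably many pieces the field is then evaluated at a fixed point of D, and continuity in the space
variable gives the limit. -/
theorem aestronglyMeasurable_comp_continuousOn {F G : Type*} [TopologicalSpace F]
    [TopologicalSpace.PseudoMetrizableSpace F] [TopologicalSpace G]
    {h : ℝ → G → F} {D : Set G} {x : ℝ → G} {a b : ℝ} (hab : a ≤ b)
    (hm : ∀ z ∈ D, AEStronglyMeasurable (fun t => h t z) (volume.restrict (Icc a b)))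
    (hc : ∀ᵐ t ∂volume.restrict (Icc a b), ContinuousOn (h t) D)
    (hx : ContinuousOn x (Icc a b)) (hxD : ∀ t ∈ Icc a b, x t ∈ D) :
    AEStronglyMeasurable (fun t => h t (x t)) (volume.restrict (Icc a b)) := by
  let q : ℕ → ℤ → ℝ := fun n j => projIcc a b hab (j / (n + 1))
  have hq : ∀ n j, q n j ∈ Icc a b := fun n j => (projIcc a b hab _).2
  refine aestronglyMeasurable_of_tendsto_ae (u := atTop)
    (f := fun (n : ℕ) t => h t (x (q n ⌊(n + 1) * t⌋))) ?_ ?_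
  · intro n
    have hcov : Icc a b = ⋃ j : ℤ, Icc a b ∩ {t | ⌊((n : ℝ) + 1) * t⌋ = j} := by
      ext t; simp
    rw [hcov, aestronglyMeasurable_iUnion_iff]
    intro j
    have hms : MeasurableSet {t : ℝ | ⌊((n : ℝ) + 1) * t⌋ = j} :=
      (Int.measurable_floor.comp (measurable_const_mul _)) (measurableSet_singleton j)
    have := ((hm _ (hxD _ (hq n j))).mono_measure
      (Measure.restrict_mono (inter_subset_left (t := {t | ⌊((n : ℝ) + 1) * t⌋ = j})) le_rfl))
    refine this.congr ?_
    refine (ae_restrict_iff' (measurableSet_Icc.inter hms)).2 (ae_of_all _ fun t ht => ?_)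
    have : ⌊((n : ℝ) + 1) * t⌋ = j := ht.2
    simp [this]
  · filter_upwards [hc, ae_restrict_mem measurableSet_Icc] with t hct ht
    have h1 : Tendsto (fun n : ℕ => (⌊((n : ℝ) + 1) * t⌋ : ℝ) / (n + 1)) atTop (𝓝 t) := by
      have hN : Tendsto (fun n : ℕ => (1 : ℝ) / (n + 1)) atTop (𝓝 0) :=
        tendsto_one_div_add_atTop_nhds_zero_nat
      refine tendsto_of_tendsto_of_tendsto_of_le_of_le (g := fun n : ℕ => t - 1 / (n + 1))
        (h := fun _ => t) (by simpa using tendsto_const_nhds.sub hN) tendsto_const_nhds ?_ ?_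
      · intro n
        have : (0 : ℝ) < n + 1 := by positivity
        simp only
        rw [le_div_iff₀ this]
        have h4 : (t - 1 / ((n : ℝ) + 1)) * (n + 1) = (n + 1) * t - 1 := by field_simp
        rw [h4]
        linarith [(Int.lt_floor_add_one (((n : ℝ) + 1) * t)).le]
      · intro n
        have : (0 : ℝ) < n + 1 := by positivity
        simp only
        rw [div_le_iff₀ this]
        linarith [Int.floor_le (((n : ℝ) + 1) * t)]
    have h2 : Tendsto (fun n : ℕ => q n ⌊((n : ℝ) + 1) * t⌋) atTop (𝓝 t) := by
      have := ((continuous_subtype_val.comp (continuous_projIcc (h := hab))).tendsto t).comp h1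
      simpa [Function.comp_def, q, projIcc_of_mem hab ht] using this
    have h3 : Tendsto (fun n : ℕ => x (q n ⌊((n : ℝ) + 1) * t⌋)) atTop (𝓝[D] (x t)) := by
      refine tendsto_nhdsWithin_iff.2 ⟨?_, Eventually.of_forall fun n => hxD _ (hq _ _)⟩
      exact (hx t ht).tendsto.comp
        (tendsto_nhdsWithin_iff.2 ⟨h2, Eventually.of_forall fun n => hq _ _⟩)
    exact (hct _ (hxD t ht)).tendsto.comp h3

/-- Integrability of a Lipschitz Carathéodory field along a continuous curve. -/
theorem integrableOn_field {E : Type*} [NormedAddCommGroup E] {W : ℝ → E → E}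
    {k : ℝ → ℝ} {a b : ℝ} (hab : a ≤ b) (hk : IntegrableOn k (Icc a b))
    (hW : ∀ z, AEStronglyMeasurable (fun t => W t z) (volume.restrict (Icc a b)))
    (hlip : ∀ᵐ t ∂volume.restrict (Icc a b), ∀ z z', ‖W t z - W t z'‖ ≤ k t * ‖z - z'‖)
    (h0 : ∀ᵐ t ∂volume.restrict (Icc a b), ‖W t 0‖ ≤ k t) {x : ℝ → E}
    (hx : ContinuousOn x (Icc a b)) : IntegrableOn (fun t => W t (x t)) (Icc a b) := by
  have hint : IntegrableOn (fun t => k t * (1 + ‖x t‖)) (Icc a b) :=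
    integrableOn_mul_continuousOn hk (continuousOn_const.add hx.norm)
  refine Integrable.mono' hint ?_ ?_
  · refine aestronglyMeasurable_comp_continuousOn (D := univ) hab (fun z _ => hW z) ?_ hx
      (fun _ _ => mem_univ _)
    filter_upwards [hlip] with t ht
    refine (LipschitzWith.of_dist_le_mul (K := (k t).toNNReal)
      fun z z' => ?_).continuous.continuousOn
    rw [dist_eq_norm, dist_eq_norm]
    exact (ht z z').trans (mul_le_mul_of_nonneg_right (Real.le_coe_toNNReal _) (norm_nonneg _))
  · filter_upwards [hlip, h0] with t ht ht0
    have := ht (x t) 0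
    calc ‖W t (x t)‖ = ‖W t 0 + (W t (x t) - W t 0)‖ := by congr 1; abel
      _ ≤ k t + k t * ‖x t - 0‖ := (norm_add_le _ _).trans (add_le_add ht0 this)
      _ = k t * (1 + ‖x t‖) := by rw [sub_zero]; ring

/-- Existence of solutions of a Lipschitz Carathéodory equation. -/
theorem exists_isPrim [CompleteSpace E] {W : ℝ → E → E} {k : ℝ → ℝ} {a b : ℝ} (hab : a ≤ b)
    (hk : IntegrableOn k (Icc a b)) (hk0 : ∀ t, 0 ≤ k t)
    (hW : ∀ z, AEStronglyMeasurable (fun t => W t z) (volume.restrict (Icc a b)))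
    (hlip : ∀ᵐ t ∂volume.restrict (Icc a b), ∀ z z', ‖W t z - W t z'‖ ≤ k t * ‖z - z'‖)
    (h0 : ∀ᵐ t ∂volume.restrict (Icc a b), ‖W t 0‖ ≤ k t) (z₀ : E) :
    ∃ x : ℝ → E, x a = z₀ ∧ IsPrim x (fun t => W t (x t)) a b := by
  revert z₀
  -- The initial value is quantified inside the glued property, because the second piece starts
  -- where the first one ends. On short intervals the Picard operator is a contraction with factor
  -- 1/2.
  refine interval_glue (P := fun r s => ∀ z₀ : E, ∃ x : ℝ → E, x r = z₀ ∧
    IsPrim x (fun t => W t (x t)) r s) hab ?_ ?_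
  · intro r s t har hrs hst htb h₁ h₂ z₀
    obtain ⟨x, hx0, hx⟩ := h₁ z₀
    obtain ⟨y, hy0, hy⟩ := h₂ (x s)
    refine ⟨fun τ => if τ ≤ s then x τ else y τ, by simp [hrs, hx0], ?_⟩
    refine IsPrim.trans hrs hst
      (hx.congr (fun τ hτ => by simp [hτ.2]) ?_) (hy.congr (fun τ hτ => ?_) ?_)
    · filter_upwards [ae_restrict_mem measurableSet_Icc] with τ hτ
      simp [hτ.2]
    · rcases hτ.1.eq_or_lt with h | h
      · simp [← h, hy0]
      · simp [not_le.2 h]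
    · filter_upwards [ae_restrict_mem measurableSet_Icc] with τ hτ
      rcases hτ.1.eq_or_lt with h | h
      · simp [← h, hy0]
      · simp [not_le.2 h]
  · intro t₀ ht₀
    obtain ⟨ε, hε, h⟩ := exists_integral_le hk (η := 1 / 2) (by norm_num) t₀ ht₀
    refine ⟨ε, hε, fun r s har hrs hsb hr hs z₀ => ?_⟩
    have hsub : Icc r s ⊆ Icc a b := Icc_subset_Icc har hsb
    have hk' := hk.mono_set hsub
    have hlip' := ae_restrict_of_ae_restrict_of_subset hsub hlip
    have h0' := ae_restrict_of_ae_restrict_of_subset hsub h0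
    have hW' : ∀ z, AEStronglyMeasurable (fun t => W t z) (volume.restrict (Icc r s)) :=
      fun z => (hW z).mono_measure (Measure.restrict_mono hsub le_rfl)
    have hint : ∀ c : C(Icc r s, E), IntegrableOn (fun t => W t (IccExtend hrs c t)) (Icc r s) :=
      fun c => integrableOn_field hrs hk' hW' hlip' h0' c.continuous.Icc_extend'.continuousOn
    let N : C(Icc r s, E) → C(Icc r s, E) := fun c =>
      ⟨fun t => z₀ + ∫ τ in r..t, W τ (IccExtend hrs c τ), continuous_const.add
        (continuousOn_iff_continuous_domRestrict.1
          (continuousOn_primitive_of_integrableOn (hint c)))⟩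
    have hN : ContractingWith (1 / 2) N := by
      refine ⟨by rw [← NNReal.coe_lt_coe]; norm_num, LipschitzWith.of_dist_le_mul fun c c' => ?_⟩
      refine (ContinuousMap.dist_le (by positivity)).2 fun t => ?_
      have hI : ∀ c : C(Icc r s, E), IntervalIntegrable (fun t => W t (IccExtend hrs c t))
        volume r t := fun c => intervalIntegrable_of_integrableOn (hint c) le_rfl t.2.1 t.2.2
      have : ‖∫ τ in r..t, (W τ (IccExtend hrs c τ) - W τ (IccExtend hrs c' τ))‖
          ≤ ∫ τ in r..t, k τ * dist c c' := by
        refine norm_integral_le_of_ae_le (hk'.mul_const _) le_rfl t.2.1 t.2.2 ?_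
        filter_upwards [hlip'] with τ hτ
        refine (hτ _ _).trans (mul_le_mul_of_nonneg_left ?_ (hk0 τ))
        rw [← dist_eq_norm]
        exact ContinuousMap.dist_apply_le_dist _
      rw [intervalIntegral.integral_sub (hI c) (hI c'), intervalIntegral.integral_mul_const] at this
      simp only [N, ContinuousMap.coe_mk, dist_eq_norm, add_sub_add_left_eq_sub]
      rw [dist_eq_norm] at this
      refine this.trans (mul_le_mul_of_nonneg_right ?_ (norm_nonneg _))
      exact (integral_mono_interval hk' hk0 le_rfl t.2.1 t.2.2).trans
        (by simpa using h r s har hrs hsb hr hs)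
    let c := ContractingWith.fixedPoint N hN
    have hc : N c = c := hN.fixedPoint_isFixedPt
    have hval : ∀ t (ht : t ∈ Icc r s), IccExtend hrs c t = z₀ + ∫ τ in r..t,
        W τ (IccExtend hrs c τ) := by
      intro t ht
      have := congrArg (fun f : C(Icc r s, E) => f ⟨t, ht⟩) hc
      simp only [N, ContinuousMap.coe_mk] at this
      rw [IccExtend_of_mem hrs c ht, ← this]
    have hr0 : IccExtend hrs c r = z₀ := by simpa using hval r (left_mem_Icc.2 hrs)
    refine ⟨IccExtend hrs c, hr0, IsPrim.of_eq (hint c) fun t ht => ?_⟩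
    rw [hr0]; exact hval t ht

end Intervals

/-! ### Calculus of C^{1,1} maps with explicit constants. -/

section C11

variable {E F G H : Type*} [NormedAddCommGroup E] [NormedSpace ℝ E] [NormedAddCommGroup F]
  [NormedSpace ℝ F] [NormedAddCommGroup G] [NormedSpace ℝ G] [NormedAddCommGroup H]
  [NormedSpace ℝ H]

/-- At the points of `s` the function `f` is differentiable, `f` and its derivative are bounded by
`C`, and both are Lipschitz on `s` with constant `C`. -/
structure C11On (C : ℝ) (f : E → F) (s : Set E) : Prop where
  diff : ∀ x ∈ s, DifferentiableAt ℝ f x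
  bound : ∀ x ∈ s, ‖f x‖ ≤ C
  fderiv_bound : ∀ x ∈ s, ‖fderiv ℝ f x‖ ≤ C
  lip : ∀ x ∈ s, ∀ y ∈ s, ‖f x - f y‖ ≤ C * ‖x - y‖
  fderiv_lip : ∀ x ∈ s, ∀ y ∈ s, ‖fderiv ℝ f x - fderiv ℝ f y‖ ≤ C * ‖x - y‖

namespace C11On

theorem mono_set {C : ℝ} {f : E → F} {s t : Set E} (h : C11On C f s) (hts : t ⊆ s) : C11On C f t :=
  ⟨fun x hx => h.diff x (hts hx), fun x hx => h.bound x (hts hx),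
    fun x hx => h.fderiv_bound x (hts hx), fun x hx y hy => h.lip x (hts hx) y (hts hy),
    fun x hx y hy => h.fderiv_lip x (hts hx) y (hts hy)⟩

theorem mono_const {C C' : ℝ} {f : E → F} {s : Set E} (h : C11On C f s) (hC : C ≤ C') :
    C11On C' f s :=
  ⟨h.diff, fun x hx => (h.bound x hx).trans hC, fun x hx => (h.fderiv_bound x hx).trans hC,
    fun x hx y hy => (h.lip x hx y hy).trans (by gcongr),
    fun x hx y hy => (h.fderiv_lip x hx y hy).trans (by gcongr)⟩

theorem continuousOn {C : ℝ} {f : E → F} {s : Set E} (h : C11On C f s) : ContinuousOn f s :=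
  fun x hx => (h.diff x hx).continuousAt.continuousWithinAt

theorem congr {C : ℝ} {f g : E → F} {s : Set E} (h : C11On C f s) (hs : IsOpen s)
    (hfg : ∀ x ∈ s, g x = f x) : C11On C g s := by
  have hev : ∀ x ∈ s, g =ᶠ[𝓝 x] f := fun x hx =>
    Filter.eventually_of_mem (hs.mem_nhds hx) hfg
  have hd : ∀ x ∈ s, fderiv ℝ g x = fderiv ℝ f x := fun x hx => (hev x hx).fderiv_eq
  refine ⟨fun x hx => (h.diff x hx).congr_of_eventuallyEq (hev x hx), fun x hx => ?_,
    fun x hx => ?_, fun x hx y hy => ?_, fun x hx y hy => ?_⟩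
  · rw [hfg x hx]; exact h.bound x hx
  · rw [hd x hx]; exact h.fderiv_bound x hx
  · rw [hfg x hx, hfg y hy]; exact h.lip x hx y hy
  · rw [hd x hx, hd y hy]; exact h.fderiv_lip x hx y hy

/-- Mean value inequality on the segment, where the derivative differs from its value at x by at
most C‖y − x‖; this costs C instead of C/2. -/
theorem norm_taylor_le {C : ℝ} {f : E → F} {s : Set E} (h : C11On C f s) (hs : Convex ℝ s)
    {x y : E} (hx : x ∈ s) (hy : y ∈ s) :
    ‖f y - f x - fderiv ℝ f x (y - x)‖ ≤ C * ‖y - x‖ ^ 2 := by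
  have hC : 0 ≤ C := (norm_nonneg _).trans (h.bound x hx)
  have hseg : segment ℝ x y ⊆ s := hs.segment_subset hx hy
  have := (convex_segment x y).norm_image_sub_le_of_norm_fderiv_le' (𝕜 := ℝ) (f := f)
    (C := C * ‖y - x‖) (φ := fderiv ℝ f x) (fun z hz => h.diff z (hseg hz)) ?_
    (left_mem_segment ℝ x y) (right_mem_segment ℝ x y)
  · rw [pow_two, ← mul_assoc]; exact this
  · intro z hz
    refine (h.fderiv_lip z (hseg hz) x hx).trans (mul_le_mul_of_nonneg_left ?_ hC)
    have := norm_sub_le_of_mem_segment hz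
    simpa [norm_sub_rev] using this

theorem of_fderiv_bound {C : ℝ} {f : E → F} {s : Set E} (hs : Convex ℝ s)
    (hd : ∀ x ∈ s, DifferentiableAt ℝ f x) (hb : ∀ x ∈ s, ‖f x‖ ≤ C)
    (hfb : ∀ x ∈ s, ‖fderiv ℝ f x‖ ≤ C)
    (hfl : ∀ x ∈ s, ∀ y ∈ s, ‖fderiv ℝ f x - fderiv ℝ f y‖ ≤ C * ‖x - y‖) : C11On C f s :=
  ⟨hd, hb, hfb, fun _ hx _ hy => hs.norm_image_sub_le_of_norm_fderiv_le hd hfb hy hx, hfl⟩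

/-- The constant dominates at once C₂, C₂C₁ and the sum C₂C₁ + C₂C₁² arising from the variation of
the product of the derivatives. -/
theorem comp {C₁ C₂ : ℝ} {f : E → F} {g : F → G} {s : Set E} {t : Set F} (hg : C11On C₂ g t)
    (hf : C11On C₁ f s) (hst : MapsTo f s t) :
    C11On (C₂ * (1 + C₁) ^ 2) (fun x => g (f x)) s := by
  have hfd : ∀ x ∈ s, fderiv ℝ (fun x => g (f x)) x = (fderiv ℝ g (f x)).comp (fderiv ℝ f x) :=
    fun x hx => fderiv_comp x (hg.diff _ (hst hx)) (hf.diff x hx)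
  have nn : ∀ x ∈ s, 0 ≤ C₁ ∧ 0 ≤ C₂ := fun x hx =>
    ⟨(norm_nonneg _).trans (hf.bound x hx), (norm_nonneg _).trans (hg.bound _ (hst hx))⟩
  refine ⟨fun x hx => (hg.diff _ (hst hx)).comp x (hf.diff x hx), fun x hx => ?_, fun x hx => ?_,
    fun x hx y hy => ?_, fun x hx y hy => ?_⟩
  · obtain ⟨h1, h2⟩ := nn x hx
    refine (hg.bound _ (hst hx)).trans ?_
    nlinarith [mul_nonneg h2 h1, mul_nonneg h2 (mul_nonneg h1 h1)]
  · obtain ⟨h1, h2⟩ := nn x hx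
    rw [hfd x hx]
    refine (ContinuousLinearMap.opNorm_comp_le _ _).trans
      ((mul_le_mul (hg.fderiv_bound _ (hst hx)) (hf.fderiv_bound x hx) (norm_nonneg _) h2).trans ?_)
    nlinarith [mul_nonneg h2 h1, mul_nonneg h2 (mul_nonneg h1 h1)]
  · obtain ⟨h1, h2⟩ := nn x hx
    refine (hg.lip _ (hst hx) _ (hst hy)).trans ?_
    refine (mul_le_mul_of_nonneg_left (hf.lip x hx y hy) h2).trans ?_
    rw [← mul_assoc]
    refine mul_le_mul_of_nonneg_right ?_ (norm_nonneg _)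
    nlinarith [mul_nonneg h2 h1, mul_nonneg h2 (mul_nonneg h1 h1)]
  · obtain ⟨h1, h2⟩ := nn x hx
    rw [hfd x hx, hfd y hy]
    have e : (fderiv ℝ g (f x)).comp (fderiv ℝ f x) - (fderiv ℝ g (f y)).comp (fderiv ℝ f y)
        = (fderiv ℝ g (f x)).comp (fderiv ℝ f x - fderiv ℝ f y)
          + (fderiv ℝ g (f x) - fderiv ℝ g (f y)).comp (fderiv ℝ f y) := by
      ext v; simp
    rw [e]
    have e1 : ‖(fderiv ℝ g (f x)).comp (fderiv ℝ f x - fderiv ℝ f y)‖ ≤ C₂ * (C₁ * ‖x - y‖) :=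
      (ContinuousLinearMap.opNorm_comp_le _ _).trans
        (mul_le_mul (hg.fderiv_bound _ (hst hx)) (hf.fderiv_lip x hx y hy) (norm_nonneg _) h2)
    have e2 : ‖(fderiv ℝ g (f x) - fderiv ℝ g (f y)).comp (fderiv ℝ f y)‖
        ≤ C₂ * (C₁ * ‖x - y‖) * C₁ :=
      (ContinuousLinearMap.opNorm_comp_le _ _).trans
        (mul_le_mul ((hg.fderiv_lip _ (hst hx) _ (hst hy)).trans
          (mul_le_mul_of_nonneg_left (hf.lip x hx y hy) h2)) (hf.fderiv_bound y hy) (norm_nonneg _)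
          (by positivity))
    refine (norm_add_le _ _).trans ((add_le_add e1 e2).trans ?_)
    have : 0 ≤ C₂ * (1 + C₁) * ‖x - y‖ := by positivity
    nlinarith

theorem clm {C : ℝ} {f : E → F} {s : Set E} (hf : C11On C f s) (A : F →L[ℝ] G) (hA : ‖A‖ ≤ 1) :
    C11On C (fun x => A (f x)) s := by
  have hfd : ∀ x ∈ s, fderiv ℝ (fun x => A (f x)) x = A.comp (fderiv ℝ f x) := fun x hx =>
    (A.hasFDerivAt.comp x (hf.diff x hx).hasFDerivAt).fderiv
  have hle : ∀ v, ‖A v‖ ≤ ‖v‖ := fun v => by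
    simpa using A.le_of_opNorm_le hA v
  have hle' : ∀ B : E →L[ℝ] F, ‖A.comp B‖ ≤ ‖B‖ := fun B => by
    simpa using (A.opNorm_comp_le B).trans (mul_le_mul_of_nonneg_right hA (norm_nonneg _))
  refine ⟨fun x hx => A.differentiableAt.comp x (hf.diff x hx), fun x hx => ?_, fun x hx => ?_,
    fun x hx y hy => ?_, fun x hx y hy => ?_⟩
  · exact (hle _).trans (hf.bound x hx)
  · rw [hfd x hx]; exact (hle' _).trans (hf.fderiv_bound x hx)
  · rw [← map_sub]; exact (hle _).trans (hf.lip x hx y hy)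
  · rw [hfd x hx, hfd y hy, ← ContinuousLinearMap.comp_sub]
    exact (hle' _).trans (hf.fderiv_lip x hx y hy)

theorem prodMk {C : ℝ} {f : E → F} {g : E → G} {s : Set E} (hf : C11On C f s) (hg : C11On C g s) :
    C11On C (fun x => (f x, g x)) s := by
  have hfd : ∀ x ∈ s, fderiv ℝ (fun x => (f x, g x)) x = (fderiv ℝ f x).prod (fderiv ℝ g x) :=
    fun x hx => ((hf.diff x hx).hasFDerivAt.prodMk (hg.diff x hx).hasFDerivAt).fderiv
  refine ⟨fun x hx => (hf.diff x hx).prodMk (hg.diff x hx), fun x hx => ?_, fun x hx => ?_,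
    fun x hx y hy => ?_, fun x hx y hy => ?_⟩
  · exact max_le (hf.bound x hx) (hg.bound x hx)
  · rw [hfd x hx, ContinuousLinearMap.opNorm_prod]
    exact max_le (hf.fderiv_bound x hx) (hg.fderiv_bound x hx)
  · exact max_le (hf.lip x hx y hy) (hg.lip x hx y hy)
  · rw [hfd x hx, hfd y hy]
    have : (fderiv ℝ f x).prod (fderiv ℝ g x) - (fderiv ℝ f y).prod (fderiv ℝ g y)
        = (fderiv ℝ f x - fderiv ℝ f y).prod (fderiv ℝ g x - fderiv ℝ g y) := by ext v <;> simp
    rw [this, ContinuousLinearMap.opNorm_prod]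
    exact max_le (hf.fderiv_lip x hx y hy) (hg.fderiv_lip x hx y hy)

theorem sub {C₁ C₂ : ℝ} {f g : E → F} {s : Set E} (hf : C11On C₁ f s) (hg : C11On C₂ g s) :
    C11On (C₁ + C₂) (fun x => f x - g x) s := by
  have hfd : ∀ x ∈ s, fderiv ℝ (fun x => f x - g x) x = fderiv ℝ f x - fderiv ℝ g x :=
    fun x hx => fderiv_fun_sub (hf.diff x hx) (hg.diff x hx)
  refine ⟨fun x hx => (hf.diff x hx).sub (hg.diff x hx), fun x hx => ?_, fun x hx => ?_,
    fun x hx y hy => ?_, fun x hx y hy => ?_⟩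
  · exact (norm_sub_le _ _).trans (add_le_add (hf.bound x hx) (hg.bound x hx))
  · rw [hfd x hx]
    exact (norm_sub_le _ _).trans (add_le_add (hf.fderiv_bound x hx) (hg.fderiv_bound x hx))
  · rw [sub_sub_sub_comm, add_mul]
    exact (norm_sub_le _ _).trans (add_le_add (hf.lip x hx y hy) (hg.lip x hx y hy))
  · rw [hfd x hx, hfd y hy, sub_sub_sub_comm, add_mul]
    exact (norm_sub_le _ _).trans (add_le_add (hf.fderiv_lip x hx y hy) (hg.fderiv_lip x hx y hy))

/-- The factor 4 counts terms: the derivative has two, and the variation of each splits into two. -/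
theorem bilin {C₁ C₂ : ℝ} {f : E → F} {g : E → G} {s : Set E} (B : F →L[ℝ] G →L[ℝ] H)
    (hB : ∀ u v, ‖B u v‖ ≤ ‖u‖ * ‖v‖) (hf : C11On C₁ f s) (hg : C11On C₂ g s) :
    C11On (4 * C₁ * C₂) (fun x => B (f x) (g x)) s := by
  have hBn : ‖B‖ ≤ 1 := B.opNorm_le_bound₂ zero_le_one (by simpa using hB)
  have hfd : ∀ x ∈ s, ∀ v, fderiv ℝ (fun x => B (f x) (g x)) x v
      = B (f x) (fderiv ℝ g x v) + B (fderiv ℝ f x v) (g x) := by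
    intro x hx v
    rw [(B.hasFDerivAt_of_bilinear (hf.diff x hx).hasFDerivAt (hg.diff x hx).hasFDerivAt).fderiv]
    simp
  have nn : ∀ x ∈ s, 0 ≤ C₁ ∧ 0 ≤ C₂ := fun x hx =>
    ⟨(norm_nonneg _).trans (hf.bound x hx), (norm_nonneg _).trans (hg.bound _ hx)⟩
  refine ⟨fun x hx => (B.hasFDerivAt_of_bilinear (hf.diff x hx).hasFDerivAt
    (hg.diff x hx).hasFDerivAt).differentiableAt, fun x hx => ?_, fun x hx => ?_,
    fun x hx y hy => ?_, fun x hx y hy => ?_⟩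
  · obtain ⟨h1, h2⟩ := nn x hx
    have := mul_le_mul (hf.bound x hx) (hg.bound x hx) (norm_nonneg _) h1
    nlinarith [hB (f x) (g x), mul_nonneg h1 h2]
  · obtain ⟨h1, h2⟩ := nn x hx
    refine ContinuousLinearMap.opNorm_le_bound _ (by positivity) fun v => ?_
    rw [hfd x hx]
    have e1 := (hB (f x) (fderiv ℝ g x v)).trans (mul_le_mul (hf.bound x hx)
      ((fderiv ℝ g x).le_of_opNorm_le (hg.fderiv_bound x hx) v) (norm_nonneg _) h1)
    have e2 := (hB (fderiv ℝ f x v) (g x)).trans (mul_le_mul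
      ((fderiv ℝ f x).le_of_opNorm_le (hf.fderiv_bound x hx) v) (hg.bound x hx) (norm_nonneg _)
      (by positivity))
    refine (norm_add_le _ _).trans ((add_le_add e1 e2).trans ?_)
    have : 0 ≤ C₁ * C₂ * ‖v‖ := by positivity
    nlinarith
  · obtain ⟨h1, h2⟩ := nn x hx
    have e : B (f x) (g x) - B (f y) (g y) = B (f x) (g x - g y) + B (f x - f y) (g y) := by
      simp
    rw [e]
    have e1 := (hB (f x) (g x - g y)).trans (mul_le_mul (hf.bound x hx)
      (hg.lip x hx y hy) (norm_nonneg _) h1)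
    have e2 := (hB (f x - f y) (g y)).trans (mul_le_mul (hf.lip x hx y hy)
      (hg.bound y hy) (norm_nonneg _) (by positivity))
    refine (norm_add_le _ _).trans ((add_le_add e1 e2).trans ?_)
    have : 0 ≤ C₁ * C₂ * ‖x - y‖ := by positivity
    nlinarith
  · obtain ⟨h1, h2⟩ := nn x hx
    refine ContinuousLinearMap.opNorm_le_bound _ (by positivity) fun v => ?_
    rw [_root_.sub_apply, hfd x hx, hfd y hy]
    have e : B (f x) (fderiv ℝ g x v) + B (fderiv ℝ f x v) (g x)
        - (B (f y) (fderiv ℝ g y v) + B (fderiv ℝ f y v) (g y))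
        = (B (f x) ((fderiv ℝ g x - fderiv ℝ g y) v) + B (f x - f y) (fderiv ℝ g y v))
          + (B (fderiv ℝ f x v) (g x - g y) + B ((fderiv ℝ f x - fderiv ℝ f y) v) (g y)) := by
      simp only [map_sub, _root_.sub_apply]
      abel
    rw [e]
    have e1 := (hB (f x) ((fderiv ℝ g x - fderiv ℝ g y) v)).trans (mul_le_mul (hf.bound x hx)
      ((fderiv ℝ g x - fderiv ℝ g y).le_of_opNorm_le (hg.fderiv_lip x hx y hy) v)
      (norm_nonneg _) h1)
    have e2 := (hB (f x - f y) (fderiv ℝ g y v)).trans (mul_le_mul (hf.lip x hx y hy)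
      ((fderiv ℝ g y).le_of_opNorm_le (hg.fderiv_bound y hy) v) (norm_nonneg _) (by positivity))
    have e3 := (hB (fderiv ℝ f x v) (g x - g y)).trans (mul_le_mul
      ((fderiv ℝ f x).le_of_opNorm_le (hf.fderiv_bound x hx) v) (hg.lip x hx y hy) (norm_nonneg _)
      (by positivity))
    have e4 := (hB ((fderiv ℝ f x - fderiv ℝ f y) v) (g y)).trans (mul_le_mul
      ((fderiv ℝ f x - fderiv ℝ f y).le_of_opNorm_le (hf.fderiv_lip x hx y hy) v)
      (hg.bound y hy) (norm_nonneg _) (by positivity))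
    refine (norm_add_le _ _).trans ((add_le_add ((norm_add_le _ _).trans (add_le_add e1 e2))
      ((norm_add_le _ _).trans (add_le_add e3 e4))).trans (le_of_eq ?_))
    ring

theorem clm_apply {C₁ C₂ : ℝ} {f : E → F →L[ℝ] G} {g : E → F} {s : Set E}
    (hf : C11On C₁ f s) (hg : C11On C₂ g s) : C11On (4 * C₁ * C₂) (fun x => f x (g x)) s :=
  bilin (ContinuousLinearMap.id ℝ (F →L[ℝ] G)) (fun u v => u.le_opNorm v) hf hg

theorem clm_comp {C₁ C₂ : ℝ} {f : E → G →L[ℝ] H} {g : E → F →L[ℝ] G} {s : Set E}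
    (hf : C11On C₁ f s) (hg : C11On C₂ g s) :
    C11On (4 * C₁ * C₂) (fun x => (f x).comp (g x)) s :=
  bilin (ContinuousLinearMap.compL ℝ F G H) (fun u v => u.opNorm_comp_le v) hf hg

theorem id_ball {x₀ : E} {r : ℝ} : C11On (‖x₀‖ + r + 1) (fun x : E => x) (Metric.ball x₀ r) := by
  rcases le_or_gt r 0 with hr | hr
  · rw [Metric.ball_eq_empty.2 hr]
    exact ⟨by simp, by simp, by simp, by simp, by simp⟩
  have hx₀ := norm_nonneg x₀
  refine ⟨fun x _ => differentiableAt_id, fun x hx => ?_, fun x _ => ?_, fun x _ y _ => ?_,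
    fun x _ y _ => ?_⟩
  · have h1 : ‖x - x₀‖ < r := by simpa [dist_eq_norm] using hx
    have h2 : ‖x‖ ≤ ‖x₀‖ + ‖x - x₀‖ := by simpa using norm_add_le x₀ (x - x₀)
    linarith
  · rw [fderiv_fun_id]
    exact ContinuousLinearMap.norm_id_le.trans (by linarith)
  · nlinarith [norm_nonneg (x - y)]
  · simp only [fderiv_fun_id, sub_self, norm_zero]; positivity

/-- The inverse of operators is of class `C^{1,1}` where it is bounded. -/
theorem ringInverse [CompleteSpace E] {C : ℝ} (hC : 1 ≤ C) :
    C11On (2 * C ^ 3) (Ring.inverse : (E →L[ℝ] E) → (E →L[ℝ] E))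
      {A | IsUnit A ∧ ‖Ring.inverse A‖ ≤ C} := by
  have hC2 : C ≤ C ^ 3 := le_self_pow₀ hC (by norm_num)
  have hC3 : C ^ 2 ≤ C ^ 3 := pow_le_pow_right₀ hC (by norm_num)
  have hd : ∀ A : E →L[ℝ] E, IsUnit A → HasFDerivAt (𝕜 := ℝ) (Ring.inverse : (E →L[ℝ] E) → _)
      (-ContinuousLinearMap.mulLeftRight ℝ (E →L[ℝ] E) (Ring.inverse A) (Ring.inverse A)) A := by
    rintro _ ⟨A, rfl⟩
    simpa [Ring.inverse_unit] using hasFDerivAt_ringInverse (𝕜 := ℝ) A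
  have hlip : ∀ A ∈ {A : E →L[ℝ] E | IsUnit A ∧ ‖Ring.inverse A‖ ≤ C},
      ∀ B ∈ {A : E →L[ℝ] E | IsUnit A ∧ ‖Ring.inverse A‖ ≤ C},
      ‖Ring.inverse A - Ring.inverse B‖ ≤ C ^ 2 * ‖A - B‖ := by
    rintro A ⟨hA, hA'⟩ B ⟨hB, hB'⟩
    have e : Ring.inverse A - Ring.inverse B = Ring.inverse A * (B - A) * Ring.inverse B := by
      rw [mul_sub, sub_mul, Ring.inverse_mul_cancel A hA, mul_assoc, Ring.mul_inverse_cancel B hB,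
        one_mul, mul_one]
    rw [e]
    calc _ ≤ ‖Ring.inverse A‖ * ‖B - A‖ * ‖Ring.inverse B‖ :=
          (norm_mul_le _ _).trans (mul_le_mul_of_nonneg_right (norm_mul_le _ _) (norm_nonneg _))
      _ ≤ C * ‖B - A‖ * C := by gcongr
      _ = C ^ 2 * ‖A - B‖ := by rw [norm_sub_rev]; ring
  refine ⟨fun A hA => (hd A hA.1).differentiableAt, fun A hA => hA.2.trans (by linarith),
    fun A hA => ?_, fun A hA B hB => (hlip A hA B hB).trans ?_, fun A hA B hB => ?_⟩
  · rw [(hd A hA.1).fderiv, norm_neg]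
    refine (ContinuousLinearMap.opNorm_mulLeftRight_apply_apply_le _ _ _ _).trans ?_
    calc ‖Ring.inverse A‖ * ‖Ring.inverse A‖ ≤ C * C := by gcongr <;> exact hA.2
      _ ≤ 2 * C ^ 3 := by nlinarith
  · refine mul_le_mul_of_nonneg_right ?_ (norm_nonneg _)
    linarith [pow_nonneg (zero_le_one.trans hC) 3]
  · rw [(hd A hA.1).fderiv, (hd B hB.1).fderiv]
    refine ContinuousLinearMap.opNorm_le_bound _ (by positivity) fun v => ?_
    simp only [_root_.sub_apply, _root_.neg_apply,
      ContinuousLinearMap.mulLeftRight_apply]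
    set A' := Ring.inverse A
    set B' := Ring.inverse B
    have e : -(A' * v * A') - -(B' * v * B') = -((A' - B') * v * A' + B' * v * (A' - B')) := by
      noncomm_ring
    rw [e, norm_neg]
    have e1 : ‖(A' - B') * v * A'‖ ≤ C ^ 2 * ‖A - B‖ * ‖v‖ * C := by
      refine (norm_mul_le _ _).trans (mul_le_mul ((norm_mul_le _ _).trans
        (mul_le_mul_of_nonneg_right (hlip A hA B hB) (norm_nonneg _))) hA.2 (norm_nonneg _)
        (by positivity))
    have e2 : ‖B' * v * (A' - B')‖ ≤ C * ‖v‖ * (C ^ 2 * ‖A - B‖) := by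
      refine (norm_mul_le _ _).trans (mul_le_mul ((norm_mul_le _ _).trans
        (mul_le_mul_of_nonneg_right hB.2 (norm_nonneg _))) (hlip A hA B hB) (norm_nonneg _)
        (by positivity))
    refine (norm_add_le _ _).trans ((add_le_add e1 e2).trans (le_of_eq ?_))
    ring

/-- An operator-valued map is of class `C^{1,1}` if it is so pointwise, uniformly on the
unit ball. -/
theorem of_apply {C : ℝ} {Y : E → F →L[ℝ] G} {s : Set E} (hs : IsOpen s) (hc : Convex ℝ s)
    (h : ∀ v : F, ‖v‖ ≤ 1 → C11On C (fun x => Y x v) s) : C11On C Y s := by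
  have hdv : ∀ x ∈ s, ∀ v, DifferentiableAt ℝ (fun x => Y x v) x := by
    intro x hx v
    rcases eq_or_ne v 0 with rfl | hv
    · simp
    have := (h (‖v‖⁻¹ • v) (by rw [norm_smul, norm_inv, norm_norm,
      inv_mul_cancel₀ (norm_ne_zero_iff.2 hv)])).diff x hx
    have h2 := this.const_smul ‖v‖
    refine h2.congr_of_eventuallyEq (Eventually.of_forall fun y => ?_)
    simp [smul_smul, mul_inv_cancel₀ (norm_ne_zero_iff.2 hv)]
  have hC : ∀ x ∈ s, 0 ≤ C := fun x hx => (norm_nonneg _).trans ((h 0 (by simp)).bound x hx)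
  have scale : ∀ {N : F → ℝ} {c : ℝ}, 0 ≤ c → (∀ (r : ℝ) v, N (r • v) = |r| * N v) →
      (∀ v, ‖v‖ ≤ 1 → N v ≤ c) → ∀ v, N v ≤ c * ‖v‖ := by
    intro N c _ hN hb v
    rcases eq_or_ne v 0 with rfl | hv
    · have := hN 0 0
      simp at this
      simp [this]
    have hv' := norm_ne_zero_iff.2 hv
    have h1 := hb (‖v‖⁻¹ • v) (by rw [norm_smul, norm_inv, norm_norm, inv_mul_cancel₀ hv'])
    rw [hN, abs_of_nonneg (by positivity)] at h1
    rwa [inv_mul_le_iff₀ (by positivity), mul_comm] at h1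
  have hsmul : ∀ x ∈ s, ∀ (r : ℝ) v, fderiv ℝ (fun x => Y x (r • v)) x
      = r • fderiv ℝ (fun x => Y x v) x := by
    intro x hx r v
    simp only [map_smul]
    exact fderiv_fun_const_smul (hdv x hx v) r
  -- The candidate derivative with its arguments exchanged. The pointwise Taylor remainders are
  -- uniform on the unit ball of F, so its flip is the derivative in operator norm.
  let Q : ∀ x ∈ s, F →L[ℝ] E →L[ℝ] G := fun x hx =>
    LinearMap.mkContinuous
      { toFun := fun v => fderiv ℝ (fun x => Y x v) x
        map_add' := fun v w => by
          simp only [map_add]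
          exact fderiv_fun_add (hdv x hx v) (hdv x hx w)
        map_smul' := fun r v => hsmul x hx r v } C
      (scale (N := fun v => ‖fderiv ℝ (fun x => Y x v) x‖) (hC x hx)
        (fun r v => by rw [hsmul x hx, norm_smul, Real.norm_eq_abs])
        fun v hv => (h v hv).fderiv_bound x hx)
  have hQ : ∀ x hx v, Q x hx v = fderiv ℝ (fun x => Y x v) x := fun x hx v => rfl
  have hder : ∀ x hx, HasFDerivAt Y (Q x hx).flip x := by
    intro x hx
    rw [hasFDerivAt_iff_isLittleO_nhds_zero]
    have hO : (fun k => Y (x + k) - Y x - (Q x hx).flip k) =O[𝓝 0] fun k => ‖k‖ ^ 2 := by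
      refine Asymptotics.IsBigO.of_bound C ?_
      have : ∀ᶠ k in 𝓝 (0 : E), x + k ∈ s := by
        have : Tendsto (fun k => x + k) (𝓝 0) (𝓝 (x + 0)) := tendsto_const_nhds.add tendsto_id
        rw [add_zero] at this
        exact this (hs.mem_nhds hx)
      filter_upwards [this] with k hk
      rw [norm_pow, norm_norm]
      refine ContinuousLinearMap.opNorm_le_bound _
        (mul_nonneg (hC x hx) (by positivity)) ?_
      refine scale (N := fun v => ‖(Y (x + k) - Y x - (Q x hx).flip k) v‖)
        (mul_nonneg (hC x hx) (by positivity))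
        (fun r v => by rw [map_smul, norm_smul, Real.norm_eq_abs]) fun v hv => ?_
      have := (h v hv).norm_taylor_le hc hx hk
      simpa [hQ] using this
    exact hO.trans_isLittleO (Asymptotics.isLittleO_norm_pow_id one_lt_two)
  refine ⟨fun x hx => (hder x hx).differentiableAt, fun x hx => ?_, fun x hx => ?_,
    fun x hx y hy => ?_, fun x hx y hy => ?_⟩
  · exact ContinuousLinearMap.opNorm_le_bound _ (hC x hx) (scale (N := fun v => ‖Y x v‖) (hC x hx)
      (fun r v => by rw [map_smul, norm_smul, Real.norm_eq_abs]) fun v hv => (h v hv).bound x hx)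
  · rw [(hder x hx).fderiv, ContinuousLinearMap.opNorm_flip]
    exact LinearMap.mkContinuous_norm_le _ (hC x hx) _
  · have hn : 0 ≤ C * ‖x - y‖ := mul_nonneg (hC x hx) (norm_nonneg _)
    exact ContinuousLinearMap.opNorm_le_bound _ hn (scale (N := fun v => ‖(Y x - Y y) v‖) hn
      (fun r v => by rw [map_smul, norm_smul, Real.norm_eq_abs]) fun v hv => (h v hv).lip x hx y hy)
  · have hn : 0 ≤ C * ‖x - y‖ := mul_nonneg (hC x hx) (norm_nonneg _)
    have hfl : (Q x hx).flip - (Q y hy).flip = (Q x hx - Q y hy).flip := by ext; simp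
    rw [(hder x hx).fderiv, (hder y hy).fderiv, hfl, ContinuousLinearMap.opNorm_flip]
    refine ContinuousLinearMap.opNorm_le_bound _ hn (scale (N := fun v => ‖(Q x hx - Q y hy) v‖) hn
      (fun r v => by rw [map_smul, norm_smul, Real.norm_eq_abs])
      fun v hv => (h v hv).fderiv_lip x hx y hy)

/-- Functions of class `C²` are locally of class `C^{1,1}`. -/
theorem exists_of_contDiffAt {f : E → F} {x : E} (h : ContDiffAt ℝ 2 f x) :
    ∃ r > 0, ∃ C, C11On C f (Metric.ball x r) := by
  have h1 : ContDiffAt ℝ 1 (fderiv ℝ f) x := h.fderiv_right (by norm_num)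
  obtain ⟨K, t, ht, hK⟩ := h1.exists_lipschitzOnWith
  have hd : ∀ᶠ y in 𝓝 x, DifferentiableAt ℝ f y :=
    (h.eventually (by simp)).mono fun y hy => hy.differentiableAt (by simp)
  have hb : ∀ᶠ y in 𝓝 x, ‖f y‖ < ‖f x‖ + 1 :=
    h.continuousAt.norm.eventually_lt_const (by linarith)
  have hb' : ∀ᶠ y in 𝓝 x, ‖fderiv ℝ f y‖ < ‖fderiv ℝ f x‖ + 1 :=
    h1.continuousAt.norm.eventually_lt_const (by linarith)
  obtain ⟨r, hr, hr'⟩ := Metric.eventually_nhds_iff_ball.1 (hd.and (hb.and (hb'.and ht)))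
  have n1 := norm_nonneg (f x)
  have n2 := norm_nonneg (fderiv ℝ f x)
  have n3 := K.2
  refine ⟨r, hr, ‖f x‖ + 1 + (‖fderiv ℝ f x‖ + 1) + K, of_fderiv_bound (convex_ball x r)
    (fun y hy => (hr' y hy).1) (fun y hy => ?_) (fun y hy => ?_) fun y hy z hz => ?_⟩
  · linarith [(hr' y hy).2.1, K.coe_nonneg]
  · linarith [(hr' y hy).2.2.1, K.coe_nonneg]
  · have := hK.dist_le_mul y (hr' y hy).2.2.2 z (hr' z hz).2.2.2
    rw [dist_eq_norm, dist_eq_norm] at this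
    refine this.trans (mul_le_mul_of_nonneg_right ?_ (norm_nonneg _))
    linarith

end C11On

end C11

/-! ### Dependence of solutions on parameters, of first and second order. -/

section Flow

variable {E F G : Type*} [NormedAddCommGroup E] [NormedSpace ℝ E] [NormedAddCommGroup F]
  [NormedSpace ℝ F] [NormedAddCommGroup G] [NormedSpace ℝ G]

/-- Gronwall's inequality for primitives. -/
theorem gronwall_isPrim (G : Type*) [NormedAddCommGroup G] [NormedSpace ℝ G]
    {m : ℝ → ℝ} {a b : ℝ} (hab : a ≤ b) (hm : IntegrableOn m (Icc a b))
    (hm0 : ∀ t, 0 ≤ m t) :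
    ∃ C, 1 ≤ C ∧ ∀ (e γ : ℝ → G) (α β : ℝ), IsPrim e γ a b →
      (∀ᵐ t ∂volume.restrict (Icc a b), ‖γ t‖ ≤ m t * (‖e t‖ + β)) → ‖e a‖ ≤ α → 0 ≤ β →
      ∀ t ∈ Icc a b, ‖e t‖ ≤ C * (α + β) := by
  obtain ⟨C, hC, hg⟩ := gronwall hab hm hm0
  set K := ∫ t in a..b, m t with hK
  have hK0 : 0 ≤ K := intervalIntegral.integral_nonneg hab fun τ _ => hm0 τ
  refine ⟨C * (1 + K), by nlinarith, fun e γ α β he hγ hα hβ t ht => ?_⟩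
  have hα0 : 0 ≤ α := (norm_nonneg _).trans hα
  have hec := he.continuousOn.norm
  have hme : IntegrableOn (fun t => m t * ‖e t‖) (Icc a b) := integrableOn_mul_continuousOn hm hec
  have hmβ : IntegrableOn (fun t => m t * β) (Icc a b) := hm.mul_const _
  refine (hg (fun t => ‖e t‖) (α + K * β) hec ?_ (by positivity) (fun _ _ => norm_nonneg _)
    t ht).trans ?_
  · intro t ht
    have hint : IntegrableOn (fun t => m t * (‖e t‖ + β)) (Icc a b) := by
      simp only [mul_add]; exact hme.add hmβ
    have h1 := he.norm_sub_le hint le_rfl ht.1 ht.2 hγ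
    have h2 : ‖e t‖ ≤ ‖e a‖ + ‖e t - e a‖ := by simpa using norm_add_le (e a) (e t - e a)
    have h3 : ∫ r in a..t, m r * (‖e r‖ + β)
        = (∫ r in a..t, m r * ‖e r‖) + (∫ r in a..t, m r) * β := by
      simp only [mul_add]
      rw [intervalIntegral.integral_add (intervalIntegrable_of_integrableOn hme le_rfl ht.1 ht.2)
        (intervalIntegrable_of_integrableOn hmβ le_rfl ht.1 ht.2),
        intervalIntegral.integral_mul_const]
    have h4 : (∫ r in a..t, m r) * β ≤ K * β :=
      mul_le_mul_of_nonneg_right (integral_mono_interval hm hm0 le_rfl ht.1 ht.2) hβ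
    linarith
  · have : 0 ≤ C * (K * α + β) := by positivity
    nlinarith

/-- A directional derivative is the limit of measurable difference quotients. The shift by N keeps
the displaced points in the open set D. -/
theorem aestronglyMeasurable_fderiv_apply {W : ℝ → E → F} {D : Set E} (hD : IsOpen D)
    {μ : Measure ℝ} (hW : ∀ z ∈ D, AEStronglyMeasurable (fun t => W t z) μ)
    (hd : ∀ᵐ t ∂μ, ∀ z ∈ D, DifferentiableAt ℝ (W t) z) {z : E} (hz : z ∈ D) (v : E) :
    AEStronglyMeasurable (fun t => fderiv ℝ (W t) z v) μ := by
  have hlim : Tendsto (fun n : ℕ => z + ((n : ℝ))⁻¹ • v) atTop (𝓝 z) := by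
    have : Tendsto (fun n : ℕ => z + ((n : ℝ))⁻¹ • v) atTop (𝓝 (z + (0 : ℝ) • v)) :=
      tendsto_const_nhds.add (tendsto_inv_atTop_nhds_zero_nat.smul_const v)
    simpa using this
  obtain ⟨N, hN⟩ := eventually_atTop.1 (hlim.eventually (hD.mem_nhds hz))
  refine aestronglyMeasurable_of_tendsto_ae (u := atTop) (f := fun (n : ℕ) t =>
    ((n + N : ℕ) : ℝ) • (W t (z + ((n + N : ℕ) : ℝ)⁻¹ • v) - W t z)) ?_ ?_
  · intro n
    exact ((hW _ (hN _ (Nat.le_add_left _ _))).sub (hW z hz)).const_smul _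
  · filter_upwards [hd] with t ht
    have h1 := (ht z hz).hasFDerivAt.lim_real v
    exact h1.comp (tendsto_natCast_atTop_atTop.comp (tendsto_add_atTop_nat N))

/-- The solutions of a differential equation of class `C^{1,1}` depend on parameters
as regularly as their initial values, and their derivatives solve the linearised equation. -/
theorem flow_C11 {m : ℝ → ℝ} {a b C₀ : ℝ} [CompleteSpace G] (hab : a ≤ b)
    (hm : IntegrableOn m (Icc a b)) (hm0 : ∀ t, 0 ≤ m t) (hC₀ : 0 ≤ C₀) :
    ∃ C, 0 ≤ C ∧ ∀ (W : ℝ → G → G) (D : Set G) (B : Set F) (ζ : ℝ → F → G),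
      Convex ℝ D → IsOpen D → IsOpen B →
      (∀ᵐ t ∂volume.restrict (Icc a b), C11On (m t) (W t) D) →
      (∀ z ∈ D, AEStronglyMeasurable (fun t => W t z) (volume.restrict (Icc a b))) →
      (∀ x ∈ B, ∀ t ∈ Icc a b, ζ t x ∈ D) →
      (∀ x ∈ B, IsPrim (fun t => ζ t x) (fun t => W t (ζ t x)) a b) → Convex ℝ B →
      C11On C₀ (ζ a) B →
      (∀ t ∈ Icc a b, C11On C (ζ t) B) ∧
      ∀ x ∈ B, ∀ v, IsPrim (fun t => fderiv ℝ (ζ t) x v)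
        (fun t => fderiv ℝ (W t) (ζ t x) (fderiv ℝ (ζ t) x v)) a b := by
  obtain ⟨C, hC, hg⟩ := gronwall_isPrim G hab hm hm0
  set K := ∫ t in a..b, m t with hK
  have hK0 : 0 ≤ K := intervalIntegral.integral_nonneg hab fun τ _ => hm0 τ
  -- L₁ bounds the dependence on the parameter and the linearised solutions; L₂ bounds the
  -- second-order remainder and the variation of the linearised solutions. Each comes from Gronwall
  -- applied to a difference of solutions.
  set L₁ := C * C₀ with hL₁
  set L₂ := C * (C₀ + L₁ ^ 2) with hL₂
  have hL₁0 : 0 ≤ L₁ := by positivity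
  have hL₂0 : 0 ≤ L₂ := by positivity
  refine ⟨L₁ + L₂ + (C₀ + K), by positivity, ?_⟩
  intro W D B ζ hDc hDo hBo hW hWm hζD hζ hBc hι
  have hlip : ∀ x ∈ B, ∀ x' ∈ B, ∀ t ∈ Icc a b, ‖ζ t x - ζ t x'‖ ≤ L₁ * ‖x - x'‖ := by
    intro x hx x' hx' t ht
    have := hg _ _ (C₀ * ‖x - x'‖) 0 ((hζ x hx).subFun (hζ x' hx')) ?_
      (hι.lip x hx x' hx') le_rfl t ht
    · simpa [hL₁, mul_assoc] using this
    · filter_upwards [hW, ae_restrict_mem measurableSet_Icc] with t ht ht'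
      simpa using ht.lip _ (hζD x hx t ht') _ (hζD x' hx' t ht')
  -- The candidate for the derivative in direction v is constructed first, as the solution of the
  -- linearised equation; its linearity in v follows from uniqueness.
  have hex : ∀ x ∈ B, ∀ v : F, ∃ y : ℝ → G, y a = fderiv ℝ (ζ a) x v ∧
      IsPrim y (fun t => fderiv ℝ (W t) (ζ t x) (y t)) a b := by
    intro x hx v
    refine exists_isPrim hab hm hm0 (fun z => ?_) ?_ ?_ _
    · refine aestronglyMeasurable_comp_continuousOn (h := fun t w => fderiv ℝ (W t) w z) hab
        (fun w hw => aestronglyMeasurable_fderiv_apply hDo hWm (hW.mono fun t ht => ht.diff) hw z)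
        ?_ (hζ x hx).continuousOn (hζD x hx)
      filter_upwards [hW] with t ht
      have : ContinuousOn (fderiv ℝ (W t)) D :=
        (LipschitzOnWith.of_dist_le_mul (K := (m t).toNNReal) fun z hz z' hz' => by
          rw [dist_eq_norm, dist_eq_norm, Real.coe_toNNReal _ (hm0 t)]
          exact ht.fderiv_lip z hz z' hz').continuousOn
      exact this.clm_apply continuousOn_const
    · filter_upwards [hW, ae_restrict_mem measurableSet_Icc] with t ht ht' z z'
      rw [← map_sub]
      exact (fderiv ℝ (W t) (ζ t x)).le_of_opNorm_le (ht.fderiv_bound _ (hζD x hx t ht')) _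
    · filter_upwards with t
      simpa using hm0 t
  choose! y hya hy using hex
  have hyb : ∀ x ∈ B, ∀ v, ∀ t ∈ Icc a b, ‖y x v t‖ ≤ L₁ * ‖v‖ := by
    intro x hx v t ht
    have := hg _ _ (C₀ * ‖v‖) 0 (hy x hx v) ?_ ?_ le_rfl t ht
    · simpa [hL₁, mul_assoc] using this
    · filter_upwards [hW, ae_restrict_mem measurableSet_Icc] with t ht ht'
      rw [add_zero]
      exact (fderiv ℝ (W t) (ζ t x)).le_of_opNorm_le (ht.fderiv_bound _ (hζD x hx t ht')) _
    · rw [hya x hx]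
      exact (fderiv ℝ (ζ a) x).le_of_opNorm_le (hι.fderiv_bound x hx) _
  have huniq : ∀ x ∈ B, ∀ e : ℝ → G, IsPrim e (fun t => fderiv ℝ (W t) (ζ t x) (e t)) a b →
      e a = 0 → ∀ t ∈ Icc a b, e t = 0 := by
    intro x hx e he he0 t ht
    have := hg _ _ 0 0 he ?_ (by simp [he0]) le_rfl t ht
    · simpa using this
    · filter_upwards [hW, ae_restrict_mem measurableSet_Icc] with t ht ht'
      rw [add_zero]
      exact (fderiv ℝ (W t) (ζ t x)).le_of_opNorm_le (ht.fderiv_bound _ (hζD x hx t ht')) _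
  have hadd : ∀ x ∈ B, ∀ v w, ∀ t ∈ Icc a b, y x (v + w) t = y x v t + y x w t := by
    intro x hx v w t ht
    have := huniq x hx (fun t => y x (v + w) t - (y x v t + y x w t)) ?_ ?_ t ht
    · exact sub_eq_zero.1 this
    · refine ((hy x hx (v + w)).subFun ((hy x hx v).addFun (hy x hx w))).congr
        (fun _ _ => rfl) (ae_of_all _ fun t => ?_)
      simp
    · simp [hya x hx]
  have hsmul : ∀ x ∈ B, ∀ (r : ℝ) v, ∀ t ∈ Icc a b, y x (r • v) t = r • y x v t := by
    intro x hx r v t ht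
    have := huniq x hx (fun t => y x (r • v) t - r • y x v t) ?_ ?_ t ht
    · exact sub_eq_zero.1 this
    · refine ((hy x hx (r • v)).subFun ((hy x hx v).smulFun r)).congr
        (fun _ _ => rfl) (ae_of_all _ fun t => ?_)
      simp
    · simp [hya x hx]
  have hrem : ∀ x ∈ B, ∀ x' ∈ B, ∀ t ∈ Icc a b,
      ‖ζ t x' - ζ t x - y x (x' - x) t‖ ≤ L₂ * ‖x' - x‖ ^ 2 := by
    intro x hx x' hx' t ht
    have := hg _ _ (C₀ * ‖x' - x‖ ^ 2) ((L₁ * ‖x' - x‖) ^ 2)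
      (((hζ x' hx').subFun (hζ x hx)).subFun (hy x hx (x' - x))) ?_ ?_ (by positivity) t ht
    · refine this.trans (le_of_eq ?_)
      rw [hL₂]; ring
    · filter_upwards [hW, ae_restrict_mem measurableSet_Icc] with t ht ht'
      -- The velocity of the remainder is the Taylor remainder of W_t, of order ‖x' − x‖², plus a
      -- linear term in the remainder itself, which Gronwall absorbs.
      have e : W t (ζ t x') - W t (ζ t x) - fderiv ℝ (W t) (ζ t x) (y x (x' - x) t)
          = (W t (ζ t x') - W t (ζ t x) - fderiv ℝ (W t) (ζ t x) (ζ t x' - ζ t x))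
            + fderiv ℝ (W t) (ζ t x) (ζ t x' - ζ t x - y x (x' - x) t) := by
        simp only [map_sub]; abel
      rw [e]
      have e1 := ht.norm_taylor_le hDc (hζD x hx t ht') (hζD x' hx' t ht')
      have e2 := (fderiv ℝ (W t) (ζ t x)).le_of_opNorm_le (ht.fderiv_bound _ (hζD x hx t ht'))
        (ζ t x' - ζ t x - y x (x' - x) t)
      have e3 : m t * ‖ζ t x' - ζ t x‖ ^ 2 ≤ m t * (L₁ * ‖x' - x‖) ^ 2 := by
        gcongr
        · exact hm0 t
        · exact hlip x' hx' x hx t ht'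
      refine (norm_add_le _ _).trans ?_
      linarith
    · rw [hya x hx]
      exact hι.norm_taylor_le hBc hx hx'
  have hylip : ∀ x ∈ B, ∀ x' ∈ B, ∀ v, ∀ t ∈ Icc a b,
      ‖y x v t - y x' v t‖ ≤ L₂ * ‖x - x'‖ * ‖v‖ := by
    intro x hx x' hx' v t ht
    have := hg _ _ (C₀ * ‖x - x'‖ * ‖v‖) (L₁ * ‖x - x'‖ * (L₁ * ‖v‖))
      ((hy x hx v).subFun (hy x' hx' v)) ?_ ?_ (by positivity) t ht
    · refine this.trans (le_of_eq ?_)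
      rw [hL₂]; ring
    · filter_upwards [hW, ae_restrict_mem measurableSet_Icc] with t ht ht'
      have e : fderiv ℝ (W t) (ζ t x) (y x v t) - fderiv ℝ (W t) (ζ t x') (y x' v t)
          = fderiv ℝ (W t) (ζ t x) (y x v t - y x' v t)
            + (fderiv ℝ (W t) (ζ t x) - fderiv ℝ (W t) (ζ t x')) (y x' v t) := by
        simp
      rw [e]
      have e1 := (fderiv ℝ (W t) (ζ t x)).le_of_opNorm_le (ht.fderiv_bound _ (hζD x hx t ht'))
        (y x v t - y x' v t)
      have e2 := (fderiv ℝ (W t) (ζ t x) - fderiv ℝ (W t) (ζ t x')).le_of_opNorm_le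
        (ht.fderiv_lip _ (hζD x hx t ht') _ (hζD x' hx' t ht')) (y x' v t)
      have e3 : m t * ‖ζ t x - ζ t x'‖ * ‖y x' v t‖ ≤ m t * (L₁ * ‖x - x'‖) * (L₁ * ‖v‖) := by
        exact mul_le_mul (mul_le_mul_of_nonneg_left (hlip x hx x' hx' t ht') (hm0 t))
          (hyb x' hx' v t ht') (norm_nonneg _) (mul_nonneg (hm0 t) (by positivity))
      refine (norm_add_le _ _).trans ?_
      linarith
    · rw [hya x hx, hya x' hx', ← _root_.sub_apply]
      exact (fderiv ℝ (ζ a) x - fderiv ℝ (ζ a) x').le_of_opNorm_le (hι.fderiv_lip x hx x' hx') v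
  have hder : ∀ x ∈ B, ∀ t ∈ Icc a b, DifferentiableAt ℝ (ζ t) x ∧
      ∀ v, fderiv ℝ (ζ t) x v = y x v t := by
    intro x hx t ht
    let A : F →L[ℝ] G := LinearMap.mkContinuous
      { toFun := fun v => y x v t
        map_add' := fun v w => hadd x hx v w t ht
        map_smul' := fun r v => hsmul x hx r v t ht } L₁ (fun v => hyb x hx v t ht)
    have hA : ∀ v, A v = y x v t := fun v => rfl
    have : HasFDerivAt (ζ t) A x := by
      rw [hasFDerivAt_iff_isLittleO]
      have hO : (fun x' => ζ t x' - ζ t x - A (x' - x)) =O[𝓝 x] fun x' => ‖x' - x‖ ^ 2 := by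
        refine Asymptotics.IsBigO.of_bound L₂ ?_
        filter_upwards [hBo.mem_nhds hx] with x' hx'
        rw [norm_pow, norm_norm]
        exact hrem x hx x' hx' t ht
      have hlim : Tendsto (fun x' : F => x' - x) (𝓝 x) (𝓝 (x - x)) :=
        tendsto_id.sub tendsto_const_nhds
      rw [sub_self] at hlim
      exact hO.trans_isLittleO ((Asymptotics.isLittleO_norm_pow_id one_lt_two).comp_tendsto hlim)
    exact ⟨this.differentiableAt, fun v => by rw [this.fderiv, hA]⟩
  have hKC : L₁ ≤ L₁ + L₂ + (C₀ + K) := by linarith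
  have hKC2 : L₂ ≤ L₁ + L₂ + (C₀ + K) := by linarith
  refine ⟨fun t ht => ⟨fun x hx => (hder x hx t ht).1, fun x hx => ?_, fun x hx => ?_,
    fun x hx x' hx' => ?_, fun x hx x' hx' => ?_⟩, fun x hx v => ?_⟩
  · have h1 := (hζ x hx).norm_sub_le hm le_rfl ht.1 ht.2 (by
      filter_upwards [hW, ae_restrict_mem measurableSet_Icc] with t ht ht'
      exact ht.bound _ (hζD x hx t ht'))
    have h2 := integral_mono_interval hm hm0 le_rfl ht.1 ht.2
    have h3 : ‖ζ t x‖ ≤ ‖ζ a x‖ + ‖ζ t x - ζ a x‖ := by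
      simpa using norm_add_le (ζ a x) (ζ t x - ζ a x)
    linarith [hι.bound x hx]
  · refine ContinuousLinearMap.opNorm_le_bound _ (by positivity) fun v => ?_
    rw [(hder x hx t ht).2]
    exact (hyb x hx v t ht).trans (by gcongr)
  · exact (hlip x hx x' hx' t ht).trans (by gcongr)
  · refine ContinuousLinearMap.opNorm_le_bound _ (by positivity) fun v => ?_
    rw [_root_.sub_apply, (hder x hx t ht).2, (hder x' hx' t ht).2]
    exact (hylip x hx x' hx' v t ht).trans (by gcongr)
  · refine (hy x hx v).congr (fun t ht => (hder x hx t ht).2 v) ?_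
    filter_upwards [ae_restrict_mem measurableSet_Icc] with t ht
    rw [(hder x hx t ht).2]

theorem C11On.comp_clm {C : ℝ} {f : E → F} {s : Set E} {t : Set G} (hf : C11On C f s)
    (A : G →L[ℝ] E) (hA : ‖A‖ ≤ 1) (hst : MapsTo A t s) : C11On C (fun x => f (A x)) t := by
  have hfd : ∀ x ∈ t, fderiv ℝ (fun x => f (A x)) x = (fderiv ℝ f (A x)).comp A := fun x hx =>
    ((hf.diff _ (hst hx)).hasFDerivAt.comp x A.hasFDerivAt).fderiv
  have hle : ∀ v, ‖A v‖ ≤ ‖v‖ := fun v => by simpa using A.le_of_opNorm_le hA v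
  have hle' : ∀ B : E →L[ℝ] F, ‖B.comp A‖ ≤ ‖B‖ := fun B => by
    simpa using (B.opNorm_comp_le A).trans (mul_le_mul_of_nonneg_left hA (norm_nonneg _))
  have nn : ∀ x ∈ t, 0 ≤ C := fun x hx => (norm_nonneg _).trans (hf.bound _ (hst hx))
  refine ⟨fun x hx => (hf.diff _ (hst hx)).comp x A.differentiableAt,
    fun x hx => hf.bound _ (hst hx), fun x hx => ?_, fun x hx y hy => ?_, fun x hx y hy => ?_⟩
  · rw [hfd x hx]; exact (hle' _).trans (hf.fderiv_bound _ (hst hx))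
  · refine (hf.lip _ (hst hx) _ (hst hy)).trans (mul_le_mul_of_nonneg_left ?_ (nn x hx))
    rw [← map_sub]; exact hle _
  · rw [hfd x hx, hfd y hy, ← ContinuousLinearMap.sub_comp]
    refine (hle' _).trans ((hf.fderiv_lip _ (hst hx) _ (hst hy)).trans
      (mul_le_mul_of_nonneg_left ?_ (nn x hx)))
    rw [← map_sub]; exact hle _

theorem C11On.of_clm {C : ℝ} {s : Set E} (A : E →L[ℝ] F) (hA : ‖A‖ ≤ 1) (hC : 1 ≤ C)
    (hs : ∀ x ∈ s, ‖A x‖ ≤ C) : C11On C A s := by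
  refine ⟨fun x _ => A.differentiableAt, hs, fun x _ => ?_, fun x _ y _ => ?_, fun x _ y _ => ?_⟩
  · rw [A.fderiv]; exact hA.trans hC
  · rw [← map_sub]; exact A.le_of_opNorm_le (hA.trans hC) _
  · rw [A.fderiv, A.fderiv, sub_self, norm_zero]; positivity

theorem IsPrim.prodMk [CompleteSpace E] [CompleteSpace F] {x γ : ℝ → E} {y κ : ℝ → F} {a b : ℝ}
    (hx : IsPrim x γ a b) (hy : IsPrim y κ a b) :
    IsPrim (fun t => (x t, y t)) (fun t => (γ t, κ t)) a b := by
  have hint : IntegrableOn (fun t => (γ t, κ t)) (Icc a b) :=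
    Integrable.prodMk hx.integrable hy.integrable
  refine ⟨hint, fun s t hs hst ht => ?_⟩
  have hI := intervalIntegrable_of_integrableOn hint hs hst ht
  have h1 := (ContinuousLinearMap.fst ℝ E F).intervalIntegral_comp_comm hI
  have h2 := (ContinuousLinearMap.snd ℝ E F).intervalIntegral_comp_comm hI
  refine Prod.ext ?_ ?_
  · simpa using (hx.sub s t hs hst ht).trans h1
  · simpa using (hy.sub s t hs hst ht).trans h2

/-- The second order version of `flow_C11`. -/
theorem flow_C21 {m : ℝ → ℝ} {a b C₀ : ℝ} [CompleteSpace E] (hab : a ≤ b)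
    (hm : IntegrableOn m (Icc a b)) (hm0 : ∀ t, 0 ≤ m t) (hC₀ : 0 ≤ C₀)
    {V : ℝ → E → E} {D : Set E} {B : Set F} {ξ : ℝ → F → E}
    (hDc : Convex ℝ D) (hDo : IsOpen D) (hBc : Convex ℝ B) (hBo : IsOpen B)
    (hV : ∀ᵐ t ∂volume.restrict (Icc a b), C11On (m t) (V t) D ∧ C11On (m t) (fderiv ℝ (V t)) D)
    (hVm : ∀ z ∈ D, AEStronglyMeasurable (fun t => V t z) (volume.restrict (Icc a b)))
    (hξD : ∀ x ∈ B, ∀ t ∈ Icc a b, ξ t x ∈ D)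
    (hξ : ∀ x ∈ B, IsPrim (fun t => ξ t x) (fun t => V t (ξ t x)) a b)
    (hι : C11On C₀ (ξ a) B) (hι' : C11On C₀ (fderiv ℝ (ξ a)) B) :
    ∃ C, 0 ≤ C ∧ (∀ t ∈ Icc a b, C11On C (ξ t) B ∧ C11On C (fderiv ℝ (ξ t)) B) ∧
      ∀ x ∈ B, ∀ v, IsPrim (fun t => fderiv ℝ (ξ t) x v)
        (fun t => fderiv ℝ (V t) (ξ t x) (fderiv ℝ (ξ t) x v)) a b := by
  obtain ⟨C₁, hC₁, h₁⟩ := flow_C11 (F := F) (G := E) hab hm hm0 hC₀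
  obtain ⟨hC11, hlin⟩ := h₁ V D B ξ hDc hDo hBo (hV.mono fun t ht => ht.1) hVm hξD hξ hBc hι
  -- Apply the first-order result to the pair (ξ, Dξ·v), which solves ż = V(z), ẏ = V'(z)y. For ‖v‖
  -- ≤ 1 the second component stays in the ball of radius C₁ + 1, on which V'(z)y has the C^{1,1}
  -- constant 4m(C₁ + 2).
  obtain ⟨C₂, hC₂, h₂⟩ := flow_C11 (F := F) (G := E × E) hab (hm.const_mul (4 * (C₁ + 2)))
    (fun t => mul_nonneg (by positivity) (hm0 t)) hC₀
  have hD'o : IsOpen (D ×ˢ Metric.ball (0 : E) (C₁ + 1)) := hDo.prod Metric.isOpen_ball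
  refine ⟨C₁ + C₂, by positivity, fun t ht => ⟨(hC11 t ht).mono_const (by linarith), ?_⟩, hlin⟩
  refine C11On.mono_const (C := C₂) ?_ (by linarith)
  refine C11On.of_apply hBo hBc fun v hv => ?_
  have happ : ‖ContinuousLinearMap.apply ℝ E v‖ ≤ 1 :=
    ContinuousLinearMap.opNorm_le_bound _ zero_le_one fun A => by
      rw [one_mul]
      simpa using A.le_of_opNorm_le_of_le le_rfl hv
  have h3 := h₂ (fun t p => (V t p.1, fderiv ℝ (V t) p.1 p.2))
    (D ×ˢ Metric.ball (0 : E) (C₁ + 1)) B (fun t x => (ξ t x, fderiv ℝ (ξ t) x v))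
    (hDc.prod (convex_ball _ _)) hD'o hBo ?_ ?_ ?_ ?_ hBc
    (hι.prodMk (hι'.clm (ContinuousLinearMap.apply ℝ E v) happ))
  · exact (h3.1 t ht).clm (ContinuousLinearMap.snd ℝ E E) (ContinuousLinearMap.norm_snd_le ..)
  · filter_upwards [hV] with t ht
    have hm1 : 0 ≤ m t := hm0 t
    have e1 := ht.1.comp_clm (t := D ×ˢ Metric.ball (0 : E) (C₁ + 1))
      (ContinuousLinearMap.fst ℝ E E) (ContinuousLinearMap.norm_fst_le ..) (fun p hp => hp.1)
    have e2 := ht.2.comp_clm (t := D ×ˢ Metric.ball (0 : E) (C₁ + 1))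
      (ContinuousLinearMap.fst ℝ E E) (ContinuousLinearMap.norm_fst_le ..) (fun p hp => hp.1)
    have e3 : C11On (C₁ + 2) (ContinuousLinearMap.snd ℝ E E)
        (D ×ˢ Metric.ball (0 : E) (C₁ + 1)) :=
      C11On.of_clm _ (ContinuousLinearMap.norm_snd_le ..) (by linarith) fun p hp => by
        have : ‖p.2‖ < C₁ + 1 := by simpa using hp.2
        simp only [ContinuousLinearMap.coe_snd']
        linarith
    refine (e1.mono_const ?_).prodMk ((e2.clm_apply e3).mono_const (le_of_eq ?_))
    · nlinarith
    · ring
  · rintro ⟨z, w⟩ ⟨hz, -⟩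
    exact (hVm z hz).prodMk (aestronglyMeasurable_fderiv_apply hDo hVm
      (hV.mono fun t ht => ht.1.diff) hz w)
  · intro x hx t ht
    refine ⟨hξD x hx t ht, ?_⟩
    have := (fderiv ℝ (ξ t) x).le_of_opNorm_le_of_le ((hC11 t ht).fderiv_bound x hx) hv
    simp only [Metric.mem_ball, dist_zero_right]
    linarith
  · intro x hx
    exact (hξ x hx).prodMk (hlin x hx v)

/-- Closeness is measured relative to ‖A v‖, so that B A⁻¹ is within 1/2 of the identity and a
Neumann series applies, however large A⁻¹ is. This is the form in which a linear equation over a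
short interval delivers it. -/
theorem isUnit_of_close [CompleteSpace E] {A B : E →L[ℝ] E} (hA : IsUnit A)
    (h : ∀ v, ‖B v - A v‖ ≤ 1 / 2 * ‖A v‖) :
    IsUnit B ∧ ‖Ring.inverse B‖ ≤ 2 * ‖Ring.inverse A‖ := by
  have hAA : ∀ w, A (Ring.inverse A w) = w := fun w => by
    rw [← _root_.mul_apply_eq_comp, Ring.mul_inverse_cancel A hA]; rfl
  have hAA' : ∀ w, Ring.inverse A (A w) = w := fun w => by
    rw [← _root_.mul_apply_eq_comp, Ring.inverse_mul_cancel A hA]; rfl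
  have hX : ‖1 - B * Ring.inverse A‖ < 1 := by
    refine lt_of_le_of_lt (b := 1 / 2) ?_ (by norm_num)
    refine ContinuousLinearMap.opNorm_le_bound _ (by norm_num) fun w => ?_
    have := h (Ring.inverse A w)
    rw [hAA, norm_sub_rev] at this
    simpa using this
  have hXu : IsUnit (B * Ring.inverse A) := by
    have := (Units.oneSub _ hX).isUnit
    simpa using this
  have hB : IsUnit B := by
    have := hXu.mul hA
    rwa [mul_assoc, Ring.inverse_mul_cancel A hA, mul_one] at this
  refine ⟨hB, ContinuousLinearMap.opNorm_le_bound _ (by positivity) fun w => ?_⟩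
  set u := Ring.inverse B w with hu
  have hBu : B u = w := by
    rw [hu, ← _root_.mul_apply_eq_comp, Ring.mul_inverse_cancel B hB]; rfl
  have h1 : ‖A u‖ ≤ ‖B u‖ + ‖B u - A u‖ := by
    have := norm_sub_le (B u) (B u - A u)
    simpa using this
  have h2 := h u
  rw [hBu] at h1 h2
  have h3 : ‖A u‖ ≤ 2 * ‖w‖ := by linarith
  calc ‖u‖ = ‖Ring.inverse A (A u)‖ := by rw [hAA']
    _ ≤ ‖Ring.inverse A‖ * (2 * ‖w‖) := (Ring.inverse A).le_of_opNorm_le_of_le le_rfl h3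
    _ = _ := by ring

/-- Over a short interval the solutions of a linear equation stay close to their
initial values. -/
theorem IsPrim.norm_sub_le_half {m : ℝ → ℝ} {a b : ℝ} (hm : IntegrableOn m (Icc a b))
    (hm0 : ∀ t, 0 ≤ m t) (hK : ∫ t in a..b, m t ≤ 1 / 4) {y γ : ℝ → E} (hy : IsPrim y γ a b)
    (hγ : ∀ᵐ t ∂volume.restrict (Icc a b), ‖γ t‖ ≤ m t * ‖y t‖) {t : ℝ} (ht : t ∈ Icc a b) :
    ‖y t - y a‖ ≤ 1 / 2 * ‖y a‖ := by
  -- At the maximum, ‖y τ‖ ≤ ‖y a‖ + ‖y τ‖/4, so every displacement is at most ‖y a‖/3.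
  obtain ⟨τ, hτ, hmax⟩ := isCompact_Icc.exists_isMaxOn ⟨t, ht⟩ hy.continuousOn.norm
  have key : ∀ t ∈ Icc a b, ‖y t - y a‖ ≤ 1 / 4 * ‖y τ‖ := by
    intro t ht
    have h1 := hy.norm_sub_le (hm.mul_const ‖y τ‖) le_rfl ht.1 ht.2 (by
      filter_upwards [hγ, ae_restrict_mem measurableSet_Icc] with s hs hs'
      exact hs.trans (mul_le_mul_of_nonneg_left (hmax hs') (hm0 s)))
    rw [intervalIntegral.integral_mul_const] at h1
    refine h1.trans (mul_le_mul_of_nonneg_right ?_ (norm_nonneg _))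
    exact (integral_mono_interval hm hm0 le_rfl ht.1 ht.2).trans hK
  have h1 := key τ hτ
  have h2 : ‖y τ‖ ≤ ‖y a‖ + ‖y τ - y a‖ := by simpa using norm_add_le (y a) (y τ - y a)
  have h3 := key t ht
  have := norm_nonneg (y τ)
  linarith

end Flow

/-! ### Integral curves on the manifold: chain rule, independence of the chart, uniqueness. -/

section Manifold

variable {E : Type*} [NormedAddCommGroup E] [NormedSpace ℝ E]
  {M : Type*} [TopologicalSpace M] [ChartedSpace E M]

theorem integrableOn_clm_apply {F : Type*} [NormedAddCommGroup F] [NormedSpace ℝ F]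
    {A : ℝ → E →L[ℝ] F} {h : ℝ → E} {a b : ℝ} (hA : ContinuousOn A (Icc a b))
    (hh : IntegrableOn h (Icc a b)) : IntegrableOn (fun t => A t (h t)) (Icc a b) := by
  obtain ⟨C, hC⟩ := isCompact_Icc.exists_bound_of_continuousOn hA
  refine Integrable.mono' (hh.norm.const_mul C) ?_ ?_
  · exact isBoundedBilinearMap_apply.continuous.comp_aestronglyMeasurable
      ((hA.aestronglyMeasurable measurableSet_Icc).prodMk hh.aestronglyMeasurable)
  · filter_upwards [ae_restrict_mem measurableSet_Icc] with t ht
    exact (A t).le_of_opNorm_le (hC t ht) _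

/-- The chain rule for primitives. -/
theorem IsPrim.comp {F : Type*} [NormedAddCommGroup F] [NormedSpace ℝ F] [CompleteSpace E]
    [CompleteSpace F]
    {τ : E → F} {D : Set E} {C : ℝ} (hτ : C11On C τ D) (hD : Convex ℝ D) {η h : ℝ → E} {a b : ℝ}
    (hη : IsPrim η h a b) (hηD : ∀ t ∈ Icc a b, η t ∈ D) :
    IsPrim (fun t => τ (η t)) (fun t => fderiv ℝ τ (η t) (h t)) a b := by
  rcases lt_or_ge b a with hba | hab
  · exact ⟨by simp [Icc_eq_empty (not_le.2 hba)], fun s t h1 h2 h3 => by linarith⟩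
  have hC : 0 ≤ C := (norm_nonneg _).trans (hτ.bound _ (hηD a ⟨le_rfl, hab⟩))
  have hcont : ContinuousOn (fderiv ℝ τ) D :=
    (LipschitzOnWith.of_dist_le_mul (K := C.toNNReal) fun z hz z' hz' => by
      rw [dist_eq_norm, dist_eq_norm, Real.coe_toNNReal _ hC]
      exact hτ.fderiv_lip z hz z' hz').continuousOn
  have hAc : ContinuousOn (fun t => fderiv ℝ τ (η t)) (Icc a b) :=
    hcont.comp hη.continuousOn hηD
  have hint := integrableOn_clm_apply hAc hη.integrable
  -- Freeze the derivative at time s: Taylor's remainder and the variation of Dτ along the curve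
  -- each cost C(∫‖h‖)².
  refine IsPrim.of_quadratic (m := fun t => ‖h t‖) (C := 2 * C) hint hη.integrable.norm
    (fun t => norm_nonneg _) fun s t hs hst ht => ?_
  set H := ∫ r in s..t, ‖h r‖ with hH
  have hH0 : 0 ≤ H := intervalIntegral.integral_nonneg hst fun _ _ => norm_nonneg _
  have hn : IntegrableOn (fun r => ‖h r‖) (Icc s t) :=
    IntegrableOn.mono_set hη.integrable.norm (Icc_subset_Icc hs ht)
  have hsm : ∀ r ∈ Icc s t, ‖η r - η s‖ ≤ H := fun r hr =>
    (hη.norm_sub_le hη.integrable.norm hs hr.1 (hr.2.trans ht) (ae_of_all _ fun _ => le_rfl)).trans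
      (integral_mono_interval hn (fun _ => norm_nonneg _) le_rfl hr.1 hr.2)
  have hsD := hηD s ⟨hs, hst.trans ht⟩
  have e1 := hτ.norm_taylor_le hD hsD (hηD t ⟨hs.trans hst, ht⟩)
  have hi1 := intervalIntegrable_of_integrableOn hint hs hst ht
  have hi2 := intervalIntegrable_of_integrableOn hη.integrable hs hst ht
  have e2 : fderiv ℝ τ (η s) (η t - η s) = ∫ r in s..t, fderiv ℝ τ (η s) (h r) := by
    rw [hη.sub s t hs hst ht, ContinuousLinearMap.intervalIntegral_comp_comm _ hi2]
  have e3 : ‖∫ r in s..t, (fderiv ℝ τ (η r) (h r) - fderiv ℝ τ (η s) (h r))‖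
      ≤ ∫ r in s..t, C * H * ‖h r‖ := by
    refine norm_integral_le_of_ae_le (hn.const_mul _) le_rfl hst le_rfl ?_
    filter_upwards [ae_restrict_mem measurableSet_Icc] with r hr
    rw [← _root_.sub_apply]
    refine ContinuousLinearMap.le_of_opNorm_le _ ?_ _
    exact (hτ.fderiv_lip _ (hηD r ⟨hs.trans hr.1, hr.2.trans ht⟩) _ hsD).trans
      (mul_le_mul_of_nonneg_left (hsm r hr) hC)
  rw [intervalIntegral.integral_const_mul, intervalIntegral.integral_sub hi1
    ⟨(fderiv ℝ τ (η s)).integrable_comp hi2.1, (fderiv ℝ τ (η s)).integrable_comp hi2.2⟩] at e3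
  calc ‖τ (η t) - τ (η s) - ∫ r in s..t, fderiv ℝ τ (η r) (h r)‖
      = ‖(τ (η t) - τ (η s) - fderiv ℝ τ (η s) (η t - η s))
        - ((∫ r in s..t, fderiv ℝ τ (η r) (h r)) - ∫ r in s..t, fderiv ℝ τ (η s) (h r))‖ := by
        rw [e2]; congr 1; abel
    _ ≤ C * ‖η t - η s‖ ^ 2 + C * H * H := (_root_.norm_sub_le _ _).trans (add_le_add e1 e3)
    _ ≤ C * H ^ 2 + C * H * H := by
        gcongr
        exact hsm t ⟨hst, le_rfl⟩
    _ = 2 * C * H ^ 2 := by ring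

/-- A curve starting from zero with sublinear growth vanishes over a short interval. -/
theorem IsPrim.eq_zero_of_small {k : ℝ → ℝ} {s t t₀ : ℝ} {e γ : ℝ → E} (he : IsPrim e γ s t)
    (hk : IntegrableOn k (Icc s t)) (hk0 : ∀ r, 0 ≤ k r) (hK : ∫ r in s..t, k r ≤ 1 / 2)
    (hγ : ∀ᵐ r ∂volume.restrict (Icc s t), ‖γ r‖ ≤ k r * ‖e r‖) (ht₀ : t₀ ∈ Icc s t)
    (h0 : e t₀ = 0) : ∀ r ∈ Icc s t, e r = 0 := by
  obtain ⟨τ, hτ, hmax⟩ := isCompact_Icc.exists_isMaxOn ⟨t₀, ht₀⟩ he.continuousOn.norm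
  have hγ' : ∀ᵐ r ∂volume.restrict (Icc s t), ‖γ r‖ ≤ k r * ‖e τ‖ := by
    filter_upwards [hγ, ae_restrict_mem measurableSet_Icc] with r hr hr'
    exact hr.trans (mul_le_mul_of_nonneg_left (hmax hr') (hk0 r))
  have key : ‖e τ‖ ≤ 1 / 2 * ‖e τ‖ := by
    -- The zero t₀ may lie on either side of the maximum τ, so that uniqueness holds in both
    -- directions of time.
    rcases le_total t₀ τ with h | h
    · have := he.norm_sub_le (hk.mul_const ‖e τ‖) ht₀.1 h hτ.2 hγ'
      rw [h0, sub_zero, intervalIntegral.integral_mul_const] at this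
      exact this.trans (mul_le_mul_of_nonneg_right
        ((integral_mono_interval hk hk0 ht₀.1 h hτ.2).trans hK) (norm_nonneg _))
    · have := he.norm_sub_le (hk.mul_const ‖e τ‖) hτ.1 h ht₀.2 hγ'
      rw [h0, zero_sub, norm_neg, intervalIntegral.integral_mul_const] at this
      exact this.trans (mul_le_mul_of_nonneg_right
        ((integral_mono_interval hk hk0 hτ.1 h ht₀.2).trans hK) (norm_nonneg _))
  have h0' : ‖e τ‖ ≤ 0 := by linarith
  intro r hr
  exact norm_le_zero_iff.1 ((show ‖e r‖ ≤ ‖e τ‖ from hmax hr).trans h0')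

/-- `c` is an absolutely continuous integral curve of `X` on `[a, b]`. -/
structure IsACOn (X : TimeField E M) (a b : ℝ) (c : ℝ → M) : Prop where
  continuousOn : ContinuousOn c (Icc a b)
  prim : ∀ χ : OpenPartialHomeomorph M E, IsChart χ → ∀ s t, a ≤ s → s ≤ t → t ≤ b →
    (∀ r ∈ Icc s t, c r ∈ χ.source) →
      IsPrim (fun r => χ (c r)) (fun r => push χ (c r) (X r (c r))) s t

theorem IsACSolution.isACOn {X : TimeField E M} {T : ℝ} {q : M} {c : ℝ → M}
    (h : IsACSolution X T q c) : IsACOn X 0 T c := by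
  refine ⟨h.continuousOn, fun χ hχ s t hs hst ht hc => ⟨?_, fun s' t' hs' hst' ht' => ?_⟩⟩
  · exact (intervalIntegrable_iff_integrableOn_Icc_of_le hst).1
      (h.integral_eq χ hχ s t hs hst ht hc).1
  · exact (h.integral_eq χ hχ s' t' (hs.trans hs') hst' (ht'.trans ht)
      fun r hr => hc r ⟨hs'.trans hr.1, hr.2.trans ht'⟩).2

theorem IsACOn.isACSolution {X : TimeField E M} {T : ℝ} {c : ℝ → M} (h : IsACOn X 0 T c) :
    IsACSolution X T (c 0) c :=
  ⟨rfl, h.continuousOn, fun χ hχ s t hs hst ht hc =>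
    ⟨intervalIntegrable_of_integrableOn (h.prim χ hχ s t hs hst ht hc).integrable le_rfl hst le_rfl,
      (h.prim χ hχ s t hs hst ht hc).sub s t le_rfl hst le_rfl⟩⟩

theorem IsACOn.mono {X : TimeField E M} {a b a' b' : ℝ} {c : ℝ → M} (h : IsACOn X a b c)
    (ha : a ≤ a') (hb : b' ≤ b) : IsACOn X a' b' c :=
  ⟨h.continuousOn.mono (Icc_subset_Icc ha hb), fun χ hχ s t hs hst ht hc =>
    h.prim χ hχ s t (ha.trans hs) hst (ht.trans hb) hc⟩

theorem IsACOn.trans {X : TimeField E M} {a r b : ℝ} {c : ℝ → M} (har : a ≤ r) (hrb : r ≤ b)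
    (h₁ : IsACOn X a r c) (h₂ : IsACOn X r b c) : IsACOn X a b c := by
  refine ⟨?_, fun χ hχ s t hs hst ht hc => ?_⟩
  · rw [← Icc_union_Icc_eq_Icc har hrb]
    exact h₁.continuousOn.union_of_isClosed h₂.continuousOn isClosed_Icc isClosed_Icc
  rcases le_total t r with h | h
  · exact h₁.prim χ hχ s t hs hst h hc
  rcases le_total r s with h' | h'
  · exact h₂.prim χ hχ s t h' hst ht hc
  · exact (h₁.prim χ hχ s r hs h' le_rfl fun x hx => hc x ⟨hx.1, hx.2.trans h⟩).trans h' h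
      (h₂.prim χ hχ r t le_rfl h ht fun x hx => hc x ⟨h'.trans hx.1, hx.2⟩)

/-- Chain rule for ψ = (ψ ∘ χ⁻¹) ∘ χ near p; only differentiability of ψ in the chart is needed,
which suits maps such as ψ_t that are known through a chart. -/
theorem push_eq {χ : OpenPartialHomeomorph M E} (hχ : IsChart χ) {ψ : M → E} {p : M}
    (hp : p ∈ χ.source) (hψ : DifferentiableAt ℝ (fun z => ψ (χ.symm z)) (χ p))
    (v : TangentSpace 𝓘(ℝ, E) p) :
    push ψ p v = fderiv ℝ (fun z => ψ (χ.symm z)) (χ p) (push χ p v) := by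
  have hχd : MDifferentiableAt 𝓘(ℝ, E) 𝓘(ℝ, E) χ p :=
    (contMDiffAt_of_mem_maximalAtlas hχ hp).mdifferentiableAt (by simp)
  have hev : ψ =ᶠ[𝓝 p] (fun z => ψ (χ.symm z)) ∘ χ := by
    filter_upwards [χ.open_source.mem_nhds hp] with q hq
    simp [χ.left_inv hq]
  unfold push
  rw [hev.mfderiv_eq, mfderiv_comp p hψ.mdifferentiableAt hχd, mfderiv_eq_fderiv]
  rfl

theorem contDiffAt_transition {χ χ' : OpenPartialHomeomorph M E} (hχ : IsChart χ)
    (hχ' : IsChart χ') {z : E} (hz : z ∈ χ.target) (hz' : χ.symm z ∈ χ'.source) :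
    ContDiffAt ℝ ∞ (fun z => χ' (χ.symm z)) z := by
  rw [← contMDiffAt_iff_contDiffAt]
  exact (contMDiffAt_of_mem_maximalAtlas hχ' hz').comp z
    (contMDiffAt_symm_of_mem_maximalAtlas hχ hz)

theorem push_transition {χ χ' : OpenPartialHomeomorph M E} (hχ : IsChart χ)
    (hχ' : IsChart χ') {p : M} (hp : p ∈ χ.source) (hp' : p ∈ χ'.source)
    (v : TangentSpace 𝓘(ℝ, E) p) :
    push χ' p v = fderiv ℝ (fun z => χ' (χ.symm z)) (χ p) (push χ p v) := by
  refine push_eq hχ hp ?_ v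
  exact (contDiffAt_transition hχ hχ' (χ.map_source hp) (by rwa [χ.left_inv hp])).differentiableAt
    (by simp)

/-- To be an integral curve can be checked in one chart. -/
theorem IsACOn.of_chart [CompleteSpace E] {X : TimeField E M} {a b : ℝ} {c : ℝ → M}
    (hc : ContinuousOn c (Icc a b)) {χ : OpenPartialHomeomorph M E} (hχ : IsChart χ)
    (hcχ : ∀ t ∈ Icc a b, c t ∈ χ.source)
    (h : IsPrim (fun r => χ (c r)) (fun r => push χ (c r) (X r (c r))) a b) : IsACOn X a b c := by
  refine ⟨hc, fun χ' hχ' s t hs hst ht hc' => ?_⟩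
  -- The change of chart has C^{1,1} bounds only near each point of the curve, so the chain rule is
  -- applied on short intervals.
  refine interval_glue (P := fun s t => IsPrim (fun r => χ' (c r))
    (fun r => push χ' (c r) (X r (c r))) s t) hst
    (fun r s t _ h1 h2 _ h3 h4 => h3.trans h1 h2 h4) ?_
  intro t₀ ht₀
  have ht₀' : t₀ ∈ Icc a b := ⟨hs.trans ht₀.1, ht₀.2.trans ht⟩
  have hz := χ.map_source (hcχ t₀ ht₀')
  obtain ⟨r, hr, C, hC⟩ := C11On.exists_of_contDiffAt ((contDiffAt_transition hχ hχ' hz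
    (by rw [χ.left_inv (hcχ t₀ ht₀')]; exact hc' t₀ ht₀)).of_le
      (WithTop.coe_le_coe.2 (le_top : (2 : ℕ∞) ≤ ⊤)))
  obtain ⟨ε, hε, hclose⟩ := Metric.continuousOn_iff.1 h.continuousOn t₀ ht₀' r hr
  refine ⟨ε, hε, fun s' t' hs' hst' ht' hs'' ht'' => ?_⟩
  have hsub : ∀ x ∈ Icc s' t', x ∈ Icc s t := fun x hx => ⟨hs'.trans hx.1, hx.2.trans ht'⟩
  have hsub' : ∀ x ∈ Icc s' t', x ∈ Icc a b :=
    fun x hx => ⟨hs.trans (hsub x hx).1, (hsub x hx).2.trans ht⟩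
  have hball : ∀ x ∈ Icc s' t', χ (c x) ∈ Metric.ball (χ (c t₀)) r := by
    intro x hx
    refine hclose x (hsub' x hx) ?_
    rw [Real.dist_eq, abs_lt]
    rw [abs_lt] at hs'' ht''
    exact ⟨by linarith [hx.1], by linarith [hx.2]⟩
  refine ((h.mono (hs.trans hs') (ht'.trans ht)).comp hC (convex_ball _ _) hball).congr
    (fun x hx => ?_) ?_
  · rw [χ.left_inv (hcχ x (hsub' x hx))]
  · filter_upwards [ae_restrict_mem measurableSet_Icc] with x hx
    exact push_transition hχ hχ' (hcχ x (hsub' x hx)) (hc' x (hsub x hx)) _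

theorem localExpr_apply {χ : OpenPartialHomeomorph M E} {p : M} (hp : p ∈ χ.source)
    (X : (q : M) → TangentSpace 𝓘(ℝ, E) q) : localExpr χ X (χ p) = push χ p (X p) := by
  unfold localExpr
  rw [χ.left_inv hp]

/-- Uniqueness of integral curves of locally Lipschitz fields. -/
theorem IsACOn.eqOn [T2Space M] {Y : TimeField E M} {a b t₁ : ℝ} {c c' : ℝ → M}
    (hc : IsACOn Y a b c) (hc' : IsACOn Y a b c') (ht₁ : t₁ ∈ Icc a b) (h1 : c t₁ = c' t₁)
    (hlip : ∀ t₀ ∈ Icc a b, ∃ χ : OpenPartialHomeomorph M E, IsChart χ ∧ c t₀ ∈ χ.source ∧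
      ∃ ρ > 0, ∃ k : ℝ → ℝ, IntegrableOn k (Icc a b) ∧ (∀ t, 0 ≤ k t) ∧
        ∀ᵐ t ∂volume.restrict (Icc a b), ∀ x ∈ Metric.ball (χ (c t₀)) ρ,
          ∀ y ∈ Metric.ball (χ (c t₀)) ρ,
            ‖localExpr χ (Y t) x - localExpr χ (Y t) y‖ ≤ k t * ‖x - y‖) :
    ∀ t ∈ Icc a b, c t = c' t := by
  have hC : Continuous (fun t : Icc a b => c t) :=
    continuousOn_iff_continuous_domRestrict.1 hc.continuousOn
  have hC' : Continuous (fun t : Icc a b => c' t) :=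
    continuousOn_iff_continuous_domRestrict.1 hc'.continuousOn
  -- The coincidence set is closed because M is Hausdorff, and open by the local Lipschitz estimate
  -- in a chart; connectedness of [a, b] concludes.
  let S : Set (Icc a b) := {t | c t = c' t}
  have hSc : IsClosed S := isClosed_eq hC hC'
  have hSo : IsOpen S := by
    rw [isOpen_iff_mem_nhds]
    rintro ⟨t₀, ht₀⟩ (heq : c t₀ = c' t₀)
    obtain ⟨χ, hχ, hp, ρ, hρ, k, hk, hk0, hl⟩ := hlip t₀ ht₀
    obtain ⟨ε, hε, hsmall⟩ := exists_integral_le hk (η := 1 / 2) (by norm_num) t₀ ht₀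
    let N : Set M := χ.source ∩ χ ⁻¹' Metric.ball (χ (c t₀)) ρ
    have hN : N ∈ 𝓝 (c t₀) :=
      (χ.isOpen_inter_preimage Metric.isOpen_ball).mem_nhds ⟨hp, Metric.mem_ball_self hρ⟩
    have hcN : ∀ᶠ t in 𝓝[Icc a b] t₀, c t ∈ N := hc.continuousOn t₀ ht₀ hN
    have hcN' : ∀ᶠ t in 𝓝[Icc a b] t₀, c' t ∈ N := by
      have := hc'.continuousOn t₀ ht₀
      rw [ContinuousWithinAt, ← heq] at this
      exact this hN
    obtain ⟨ε', hε', hin⟩ := Metric.nhdsWithin_basis_ball.eventually_iff.1 (hcN.and hcN')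
    refine Metric.mem_nhds_iff.2 ⟨min ε ε', lt_min hε hε', ?_⟩
    rintro ⟨t, ht⟩ htb
    have htd : |t - t₀| < min ε ε' := by
      have := htb
      rwa [Metric.mem_ball, Subtype.dist_eq, Real.dist_eq] at this
    set s' := min t t₀ with hs'
    set t' := max t t₀ with ht'
    have has : a ≤ s' := le_min ht.1 ht₀.1
    have hst : s' ≤ t' := min_le_max
    have htb' : t' ≤ b := max_le ht.2 ht₀.2
    have hd : ∀ x ∈ Icc s' t', |x - t₀| ≤ |t - t₀| := by
      intro x hx
      rcases le_total t t₀ with h | h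
      · rw [hs', ht', min_eq_left h, max_eq_right h] at hx
        rw [abs_of_nonpos (by linarith [hx.2]), abs_of_nonpos (by linarith)]
        linarith [hx.1]
      · rw [hs', ht', min_eq_right h, max_eq_left h] at hx
        rw [abs_of_nonneg (by linarith [hx.1]), abs_of_nonneg (by linarith)]
        linarith [hx.2]
    have hin' : ∀ x ∈ Icc s' t', c x ∈ N ∧ c' x ∈ N := by
      intro x hx
      refine hin ⟨?_, has.trans hx.1, hx.2.trans htb'⟩
      rw [Metric.mem_ball, Real.dist_eq]
      exact (hd x hx).trans_lt (htd.trans_le (min_le_right _ _))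
    have hprim := (hc.prim χ hχ s' t' has hst htb' fun r hr => (hin' r hr).1.1).subFun
      (hc'.prim χ hχ s' t' has hst htb' fun r hr => (hin' r hr).2.1)
    have hsub : Icc s' t' ⊆ Icc a b := Icc_subset_Icc has htb'
    have hz := hprim.eq_zero_of_small (hk.mono_set hsub) hk0
      (hsmall s' t' has hst htb' ((hd s' ⟨le_rfl, hst⟩).trans_lt (htd.trans_le (min_le_left _ _)))
        ((hd t' ⟨hst, le_rfl⟩).trans_lt (htd.trans_le (min_le_left _ _)))) ?_
      (t₀ := t₀) ⟨min_le_right _ _, le_max_right _ _⟩ (by simp [heq]) t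
      ⟨min_le_left _ _, le_max_left _ _⟩
    · have htm : t ∈ Icc s' t' := ⟨min_le_left _ _, le_max_left _ _⟩
      exact χ.injOn (hin' t htm).1.1 (hin' t htm).2.1 (sub_eq_zero.1 hz)
    · filter_upwards [ae_restrict_of_ae_restrict_of_subset hsub hl,
        ae_restrict_mem measurableSet_Icc] with r hr hr'
      have := hr _ (hin' r hr').1.2 _ (hin' r hr').2.2
      rwa [localExpr_apply (hin' r hr').1.1, localExpr_apply (hin' r hr').2.1] at this
  have : PreconnectedSpace (Icc a b) := isPreconnected_iff_preconnectedSpace.1 isPreconnected_Icc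
  have hS : S = univ := IsClopen.eq_univ ⟨hSc, hSo⟩ ⟨⟨t₁, ht₁⟩, h1⟩
  intro t ht
  have : (⟨t, ht⟩ : Icc a b) ∈ S := hS ▸ mem_univ _
  exact this

/-- Translates the bounds on iterated derivatives into C^{1,1} bounds for the field and for its
derivative on a convex set, with |m| in place of m so that the bound is nonnegative at all times. -/
theorem IsRegularField.exists_chart {X : TimeField E M} {T : ℝ} (h : IsRegularField X T) (p : M) :
    ∃ χ : OpenPartialHomeomorph M E, IsChart χ ∧ p ∈ χ.source ∧ ∃ R > 0,
      Metric.ball (χ p) R ⊆ χ.target ∧ ∃ m : ℝ → ℝ, IntegrableOn m (Icc 0 T) ∧ (∀ t, 0 ≤ m t) ∧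
      (∀ x ∈ Metric.ball (χ p) R,
        AEStronglyMeasurable (fun t => localExpr χ (X t) x) (volume.restrict (Icc 0 T))) ∧
      ∀ᵐ t ∂(volume.restrict (Icc 0 T)), C11On (m t) (localExpr χ (X t)) (Metric.ball (χ p) R) ∧
        C11On (m t) (fderiv ℝ (localExpr χ (X t))) (Metric.ball (χ p) R) := by
  obtain ⟨χ, hχ, hp, m, hm, hmeas, hreg⟩ := h p
  obtain ⟨R, hR, hball⟩ := Metric.isOpen_iff.1 χ.open_target _ (χ.map_source hp)
  refine ⟨χ, hχ, hp, R, hR, hball, fun t => |m t|, hm.abs, fun t => abs_nonneg _,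
    fun x hx => hmeas x (hball hx), ?_⟩
  filter_upwards [hreg] with t ⟨hcd, hb, hl⟩
  refine (fun h => ⟨C11On.mono_const h.1 (le_abs_self _), C11On.mono_const h.2 (le_abs_self _)⟩ :
    C11On (m t) _ _ ∧ C11On (m t) _ _ → _) ?_
  set g := localExpr χ (X t)
  have hcd' : ∀ x ∈ Metric.ball (χ p) R, ContDiffAt ℝ 2 g x := fun x hx =>
    hcd.contDiffAt (χ.open_target.mem_nhds (hball hx))
  have hb1 : ∀ x ∈ Metric.ball (χ p) R, ‖fderiv ℝ g x‖ ≤ m t := fun x hx => by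
    simpa using hb 1 (by norm_num) x (hball hx)
  have hm0 : ∀ x ∈ Metric.ball (χ p) R, 0 ≤ m t := fun x hx => (norm_nonneg _).trans (hb1 x hx)
  have hd2 : ∀ x ∈ Metric.ball (χ p) R, DifferentiableAt ℝ (fderiv ℝ g) x := fun x hx =>
    ((hcd' x hx).fderiv_right (m := 1) (by norm_num)).differentiableAt (by simp)
  have hb2 : ∀ x ∈ Metric.ball (χ p) R, ‖fderiv ℝ (fderiv ℝ g) x‖ ≤ m t := fun x hx => by
    refine ContinuousLinearMap.opNorm_le_bound₂ _ (hm0 x hx) fun v w => ?_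
    have h1 := (iteratedFDeriv ℝ 2 g x).le_of_opNorm_le (hb 2 le_rfl x (hball hx)) ![v, w]
    rw [iteratedFDeriv_two_apply, Fin.prod_univ_two] at h1
    simpa [mul_assoc] using h1
  have hl2 : ∀ x ∈ Metric.ball (χ p) R, ∀ y ∈ Metric.ball (χ p) R,
      ‖fderiv ℝ (fderiv ℝ g) x - fderiv ℝ (fderiv ℝ g) y‖ ≤ m t * ‖x - y‖ := fun x hx y hy => by
    refine ContinuousLinearMap.opNorm_le_bound₂ _ (mul_nonneg (hm0 x hx) (norm_nonneg _))
      fun v w => ?_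
    have h1 := (iteratedFDeriv ℝ 2 g x - iteratedFDeriv ℝ 2 g y).le_of_opNorm_le
      (hl x (hball hx) y (hball hy)) ![v, w]
    rw [_root_.sub_apply, iteratedFDeriv_two_apply, iteratedFDeriv_two_apply,
      Fin.prod_univ_two] at h1
    simpa [mul_assoc] using h1
  refine ⟨C11On.of_fderiv_bound (convex_ball _ _)
    (fun x hx => (hcd' x hx).differentiableAt (by simp)) (fun x hx => ?_) hb1 fun x hx y hy => ?_,
    C11On.of_fderiv_bound (convex_ball _ _) hd2 hb1 hb2 hl2⟩
  · simpa using hb 0 (by norm_num) x (hball hx)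
  · exact (convex_ball _ _).norm_image_sub_le_of_norm_fderiv_le hd2 hb2 hy hx

end Manifold

/-! ### The radial retraction, used to cut off vector fields. -/

section Retraction

variable {E : Type*} [NormedAddCommGroup E] [NormedSpace ℝ E]

open Classical in
/-- The radial retraction onto the closed ball of radius `r` about `z₀`. -/
noncomputable def ballRetract (z₀ : E) (r : ℝ) (z : E) : E :=
  if ‖z - z₀‖ ≤ r then z else z₀ + (r / ‖z - z₀‖) • (z - z₀)

theorem ballRetract_of_le {z₀ z : E} {r : ℝ} (h : ‖z - z₀‖ ≤ r) : ballRetract z₀ r z = z :=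
  if_pos h

theorem norm_ballRetract_sub_le (z₀ : E) {r : ℝ} (hr : 0 ≤ r) (z : E) :
    ‖ballRetract z₀ r z - z₀‖ ≤ r := by
  unfold ballRetract
  split_ifs with h
  · exact h
  · have h0 : 0 < ‖z - z₀‖ := lt_of_le_of_lt hr (not_le.1 h)
    rw [add_sub_cancel_left, norm_smul, Real.norm_of_nonneg (by positivity),
      div_mul_cancel₀ _ h0.ne']

/-- The factor 2 is the price of a general norm: outside the ball the difference splits into a
rescaled z − w and a radial part, each at most ‖z − w‖; if only z is outside, retracting it moves it
by ‖z − z₀‖ − r ≤ ‖z − w‖. -/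
theorem norm_ballRetract_sub_ballRetract_le (z₀ : E) {r : ℝ} (hr : 0 ≤ r) (z w : E) :
    ‖ballRetract z₀ r z - ballRetract z₀ r w‖ ≤ 2 * ‖z - w‖ := by
  have mixed : ∀ z w : E, r < ‖z - z₀‖ → ‖w - z₀‖ ≤ r →
      ‖z₀ + (r / ‖z - z₀‖) • (z - z₀) - w‖ ≤ 2 * ‖z - w‖ := by
    intro z w hz hw
    have h0 : 0 < ‖z - z₀‖ := lt_of_le_of_lt hr hz
    have e : z₀ + (r / ‖z - z₀‖) • (z - z₀) - w = (z - w) - (1 - r / ‖z - z₀‖) • (z - z₀) := by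
      rw [sub_smul, one_smul]; abel
    have h1 : ‖(1 - r / ‖z - z₀‖) • (z - z₀)‖ = ‖z - z₀‖ - r := by
      have : r / ‖z - z₀‖ ≤ 1 := (div_le_one h0).2 hz.le
      rw [norm_smul, Real.norm_of_nonneg (by linarith)]
      field_simp
    have h2 : ‖z - z₀‖ ≤ ‖z - w‖ + ‖w - z₀‖ := by simpa using norm_add_le (z - w) (w - z₀)
    rw [e]
    refine (norm_sub_le _ _).trans ?_
    have h3 : ‖z - z₀‖ - ‖w - z₀‖ ≥ ‖z - z₀‖ - r := by linarith
    rw [h1]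
    by_contra hcon
    have h4 : ‖z - w‖ < ‖z - z₀‖ - r := by linarith
    linarith
  unfold ballRetract
  split_ifs with h h' h'
  · linarith [norm_nonneg (z - w)]
  · have := mixed w z (not_le.1 h') h
    rwa [norm_sub_rev, norm_sub_rev z w]
  · exact mixed z w (not_le.1 h) h'
  · have hz : 0 < ‖z - z₀‖ := lt_of_le_of_lt hr (not_le.1 h)
    have hw : 0 < ‖w - z₀‖ := lt_of_le_of_lt hr (not_le.1 h')
    have e : z₀ + (r / ‖z - z₀‖) • (z - z₀) - (z₀ + (r / ‖w - z₀‖) • (w - z₀))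
        = (r / ‖z - z₀‖) • (z - w) + (r / ‖z - z₀‖ - r / ‖w - z₀‖) • (w - z₀) := by
      simp only [sub_smul, smul_sub]; abel
    have hrz : r / ‖z - z₀‖ ≤ 1 := (div_le_one hz).2 (not_le.1 h).le
    have hrz0 : 0 ≤ r / ‖z - z₀‖ := by positivity
    have e1 : ‖(r / ‖z - z₀‖) • (z - w)‖ ≤ ‖z - w‖ := by
      rw [norm_smul, Real.norm_of_nonneg hrz0]
      exact mul_le_of_le_one_left (norm_nonneg _) hrz
    have e2 : ‖(r / ‖z - z₀‖ - r / ‖w - z₀‖) • (w - z₀)‖ ≤ ‖z - w‖ := by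
      rw [norm_smul, Real.norm_eq_abs]
      have h5 : |r / ‖z - z₀‖ - r / ‖w - z₀‖| * ‖w - z₀‖
          = r / ‖z - z₀‖ * |‖w - z₀‖ - ‖z - z₀‖| := by
        have : r / ‖z - z₀‖ - r / ‖w - z₀‖
            = r / ‖z - z₀‖ * ((‖w - z₀‖ - ‖z - z₀‖) / ‖w - z₀‖) := by field_simp
        rw [this, abs_mul, abs_of_nonneg hrz0, abs_div, abs_of_pos hw]
        field_simp
      rw [h5]
      have h6 : |‖w - z₀‖ - ‖z - z₀‖| ≤ ‖z - w‖ := by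
        have := abs_norm_sub_norm_le (w - z₀) (z - z₀)
        rwa [sub_sub_sub_cancel_right, norm_sub_rev w z] at this
      exact (mul_le_of_le_one_left (abs_nonneg _) hrz).trans h6
    rw [e]
    refine (norm_add_le _ _).trans ?_
    linarith

end Retraction

/-! ### Confinement of integral curves to a coordinate ball. -/

section Stay

variable {E : Type*} [NormedAddCommGroup E] [NormedSpace ℝ E] [CompleteSpace E]
  {M : Type*} [TopologicalSpace M] [ChartedSpace E M] [T2Space M]

/-- An integral curve of a bounded field stays for a short time in a coordinate ball. -/
theorem IsACOn.mem_ball {Y : TimeField E M} {a b : ℝ} {c : ℝ → M} (hab : a ≤ b)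
    (hc : IsACOn Y a b c) {χ : OpenPartialHomeomorph M E} (hχ : IsChart χ) (hca : c a ∈ χ.source)
    {z₀ : E} {R : ℝ} (hR : Metric.ball z₀ R ⊆ χ.target) (hca' : ‖χ (c a) - z₀‖ ≤ R / 2)
    (hR0 : 0 < R) {h : ℝ → ℝ} (hh : IntegrableOn h (Icc a b)) (hh0 : ∀ t, 0 ≤ h t)
    (hK : ∫ t in a..b, h t ≤ R / 4)
    (hm : ∀ z ∈ Metric.ball z₀ R, AEStronglyMeasurable (fun t => localExpr χ (Y t) z)
      (volume.restrict (Icc a b)))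
    (hb : ∀ᵐ t ∂volume.restrict (Icc a b), ∀ z ∈ Metric.ball z₀ R, ‖localExpr χ (Y t) z‖ ≤ h t)
    (hl : ∀ᵐ t ∂volume.restrict (Icc a b), ∀ z ∈ Metric.ball z₀ R, ∀ z' ∈ Metric.ball z₀ R,
      ‖localExpr χ (Y t) z - localExpr χ (Y t) z'‖ ≤ h t * ‖z - z'‖) :
    ∀ t ∈ Icc a b, c t ∈ χ.source ∧ χ (c t) ∈ Metric.ball z₀ R := by
  -- The curve starts within R/2 and travels at most R/4. The solution of the field cut off at
  -- radius 3R/4 therefore never meets the cut-off; it is an integral curve in the chart, and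
  -- uniqueness identifies it with c.
  set π := ballRetract z₀ (3 * R / 4) with hπ
  have hπb : ∀ z, π z ∈ Metric.ball z₀ R := fun z => by
    rw [Metric.mem_ball, dist_eq_norm]
    exact (norm_ballRetract_sub_le z₀ (by positivity) z).trans_lt (by linarith)
  have hex := exists_isPrim (W := fun t z => localExpr χ (Y t) (π z))
    (k := fun t => 2 * h t) hab (hh.const_mul 2) (fun t => mul_nonneg zero_le_two (hh0 t))
    (fun z => hm _ (hπb z)) ?_ ?_ (χ (c a))
  rotate_left
  · filter_upwards [hl] with t ht z z'
    refine (ht _ (hπb z) _ (hπb z')).trans ?_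
    have := mul_le_mul_of_nonneg_left
      (norm_ballRetract_sub_ballRetract_le z₀ (r := 3 * R / 4) (by positivity) z z') (hh0 t)
    linarith
  · filter_upwards [hb] with t ht
    linarith [ht _ (hπb 0), hh0 t]
  obtain ⟨x, hxa, hx⟩ := hex
  have hxb : ∀ t ∈ Icc a b, ‖x t - z₀‖ ≤ 3 * R / 4 := by
    intro t ht
    have h1 := hx.norm_sub_le hh le_rfl ht.1 ht.2 (hb.mono fun t ht => ht _ (hπb _))
    have h2 := (integral_mono_interval hh hh0 le_rfl ht.1 ht.2).trans hK
    have h3 : ‖x t - z₀‖ ≤ ‖x t - x a‖ + ‖x a - z₀‖ := by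
      simpa using norm_add_le (x t - x a) (x a - z₀)
    rw [hxa] at h1 h3
    linarith
  have hxball : ∀ t ∈ Icc a b, x t ∈ Metric.ball z₀ R := fun t ht => by
    rw [Metric.mem_ball, dist_eq_norm]
    exact (hxb t ht).trans_lt (by linarith)
  have hxt : ∀ t ∈ Icc a b, x t ∈ χ.target := fun t ht => hR (hxball t ht)
  have hc' : IsACOn Y a b (fun t => χ.symm (x t)) := by
    refine IsACOn.of_chart (χ.continuousOn_symm.comp hx.continuousOn hxt) hχ
      (fun t ht => χ.map_target (hxt t ht)) (hx.congr (fun t ht => χ.right_inv (hxt t ht)) ?_)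
    filter_upwards [ae_restrict_mem measurableSet_Icc] with t ht
    rw [hπ, ballRetract_of_le (hxb t ht)]
    rfl
  have heq := hc'.eqOn hc (t₁ := a) ⟨le_rfl, hab⟩ (by rw [hxa, χ.left_inv hca]) (fun t₀ ht₀ => ?_)
  · intro t ht
    rw [← heq t ht, χ.right_inv (hxt t ht)]
    exact ⟨χ.map_target (hxt t ht), hxball t ht⟩
  · refine ⟨χ, hχ, χ.map_target (hxt t₀ ht₀), R - dist (x t₀) z₀, ?_, h, hh, hh0, ?_⟩
    · have := hxball t₀ ht₀
      rw [Metric.mem_ball] at this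
      linarith
    · rw [χ.right_inv (hxt t₀ ht₀)]
      filter_upwards [hl] with t ht z hz z' hz'
      have hsub : Metric.ball (x t₀) (R - dist (x t₀) z₀) ⊆ Metric.ball z₀ R :=
        Metric.ball_subset_ball' (by linarith)
      exact ht z (hsub hz) z' (hsub hz')

end Stay

/-! ### The flow of a Lagrangian chart, and local diffeomorphisms with bounds. -/

section Flow

variable {E : Type*} [NormedAddCommGroup E] [NormedSpace ℝ E]
  {M : Type*} [TopologicalSpace M] [ChartedSpace E M]

theorem isACSolution_solution {X : TimeField E M} {T : ℝ} {q : M}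
    (h : ∃ c, IsACSolution X T q c) : IsACSolution X T q (solution X T q) := by
  unfold solution
  rw [dif_pos h]
  exact h.choose_spec

namespace LagrangianChart

variable {T : ℝ} {qs : ℝ → M} (L : LagrangianChart E T qs)

theorem isACSolution_P {q : M} (hq : q ∈ L.φ.source) : IsACSolution L.V T q (fun t => L.P t q) :=
  isACSolution_solution (L.flow_exists q hq)

theorem P_zero {q : M} (hq : q ∈ L.φ.source) : L.P 0 q = q := (L.isACSolution_P hq).initial

theorem eqOn_of_isACOn [T2Space M] {a b t₁ : ℝ} (ha : 0 ≤ a) (hb : b ≤ T) {c c' : ℝ → M}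
    (hc : IsACOn L.V a b c)
    (hc' : IsACOn L.V a b c') (ht₁ : t₁ ∈ Icc a b) (h1 : c t₁ = c' t₁) :
    ∀ t ∈ Icc a b, c t = c' t := by
  refine hc.eqOn hc' ht₁ h1 fun t₀ ht₀ => ?_
  obtain ⟨χ, hχ, hp, R, hR, -, m, hm, hm0, -, hreg⟩ := L.regular.exists_chart (c t₀)
  have hsub : Icc a b ⊆ Icc 0 T := Icc_subset_Icc ha hb
  exact ⟨χ, hχ, hp, R, hR, m, hm.mono_set hsub, hm0,
    (ae_restrict_of_ae_restrict_of_subset hsub hreg).mono fun t ht => ht.1.lip⟩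

/-- Integral curves of V that meet at time t coincide back to time 0. Hence the choice in the
definition of ψ is forced. -/
theorem P_injOn [T2Space M] {t : ℝ} (ht : t ∈ Icc 0 T) : InjOn (L.P t) L.φ.source := by
  intro q hq q' hq' h
  have := L.eqOn_of_isACOn le_rfl le_rfl (L.isACSolution_P hq).isACOn
    (L.isACSolution_P hq').isACOn ht h 0 ⟨le_rfl, ht.1.trans ht.2⟩
  rwa [L.P_zero hq, L.P_zero hq'] at this

theorem ψ_P [T2Space M] {t : ℝ} (ht : t ∈ Icc 0 T) {q : M} (hq : q ∈ L.φ.source) :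
    L.ψ t (L.P t q) = L.φ q := by
  have h : ∃ q' ∈ L.φ.source, L.P t q' = L.P t q := ⟨q, hq, rfl⟩
  unfold ψ
  rw [dif_pos h, L.P_injOn ht h.choose_spec.1 hq h.choose_spec.2]

theorem ψ_ψinv [T2Space M] {t : ℝ} (ht : t ∈ Icc 0 T) {x : E} (hx : x ∈ L.φ.target) :
    L.ψ t (L.ψinv t x) = x := by
  unfold ψinv
  rw [L.ψ_P ht (L.φ.map_target hx), L.φ.right_inv hx]

theorem P_base [T2Space M] {t : ℝ} (ht : t ∈ Icc 0 T) : L.P t (qs 0) = qs t :=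
  L.eqOn_of_isACOn le_rfl le_rfl (L.isACSolution_P L.base_mem).isACOn L.V_extends.isACOn
    (t₁ := 0) ⟨le_rfl, ht.1.trans ht.2⟩ (L.P_zero L.base_mem) t ht

theorem ψinv_base [T2Space M] {t : ℝ} (ht : t ∈ Icc 0 T) : L.ψinv t (L.φ (qs 0)) = qs t := by
  unfold ψinv
  rw [L.φ.left_inv L.base_mem, L.P_base ht]

theorem isACOn_ψinv {x : E} (hx : x ∈ L.φ.target) : IsACOn L.V 0 T (fun t => L.ψinv t x) :=
  (L.isACSolution_P (L.φ.map_target hx)).isACOn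

end LagrangianChart

/-- Local diffeomorphisms with bounds: `f` and its derivative are `C^{1,1}` with
constant `C`, and the derivative has an inverse bounded by `C`. -/
structure RegOn (C : ℝ) (f : E → E) (s : Set E) : Prop where
  one : C11On C f s
  two : C11On C (fderiv ℝ f) s
  unit : ∀ x ∈ s, IsUnit (fderiv ℝ f x) ∧ ‖Ring.inverse (fderiv ℝ f x)‖ ≤ C

theorem RegOn.mono_set {C : ℝ} {f : E → E} {s t : Set E} (h : RegOn C f s) (hts : t ⊆ s) :
    RegOn C f t :=
  ⟨h.one.mono_set hts, h.two.mono_set hts, fun x hx => h.unit x (hts hx)⟩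

theorem RegOn.comp {C₁ C₂ : ℝ} {f g : E → E} {s t : Set E} (hs : IsOpen s) (hC₁ : 0 ≤ C₁)
    (hC₂ : 0 ≤ C₂) (hg : RegOn C₂ g t) (hf : RegOn C₁ f s) (hst : MapsTo f s t) :
    ∃ C, 0 ≤ C ∧ RegOn C (fun x => g (f x)) s := by
  have hfd : ∀ x ∈ s, fderiv ℝ (fun x => g (f x)) x = (fderiv ℝ g (f x)).comp (fderiv ℝ f x) :=
    fun x hx => fderiv_comp x (hg.one.diff _ (hst hx)) (hf.one.diff x hx)
  have h1 := hg.one.comp hf.one hst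
  have h2 := ((hg.two.comp hf.one hst).clm_comp hf.two).congr hs hfd
  refine ⟨C₂ * (1 + C₁) ^ 2 + 4 * (C₂ * (1 + C₁) ^ 2) * C₁ + C₁ * C₂, by positivity,
    h1.mono_const ?_, h2.mono_const ?_, fun x hx => ?_⟩
  · have : 0 ≤ 4 * (C₂ * (1 + C₁) ^ 2) * C₁ + C₁ * C₂ := by positivity
    linarith
  · have : 0 ≤ C₂ * (1 + C₁) ^ 2 + C₁ * C₂ := by positivity
    linarith
  · obtain ⟨⟨u, hu⟩, hu'⟩ := hf.unit x hx
    obtain ⟨⟨v, hv⟩, hv'⟩ := hg.unit _ (hst hx)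
    have e : fderiv ℝ (fun x => g (f x)) x = ((v * u : (E →L[ℝ] E)ˣ) : E →L[ℝ] E) := by
      rw [hfd x hx, Units.val_mul, hu, hv]; rfl
    rw [← hu, Ring.inverse_unit] at hu'
    rw [← hv, Ring.inverse_unit] at hv'
    rw [e]
    refine ⟨Units.isUnit _, ?_⟩
    rw [Ring.inverse_unit, mul_inv_rev, Units.val_mul]
    have := (norm_mul_le (↑u⁻¹ : E →L[ℝ] E) (↑v⁻¹)).trans
      (mul_le_mul hu' hv' (norm_nonneg _) hC₁)
    have h3 : 0 ≤ C₂ * (1 + C₁) ^ 2 + 4 * (C₂ * (1 + C₁) ^ 2) * C₁ := by positivity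
    linarith

theorem RegOn.exists_of_contDiffAt [CompleteSpace E] {f : E → E} {x : E} (h : ContDiffAt ℝ 3 f x)
    (hu : IsUnit (fderiv ℝ f x)) : ∃ r > 0, ∃ C, 0 ≤ C ∧ RegOn C f (Metric.ball x r) := by
  obtain ⟨r₁, hr₁, C₁, h₁⟩ := C11On.exists_of_contDiffAt (h.of_le (by norm_num : (2 : ℕ∞ω) ≤ 3))
  have h' : ContDiffAt ℝ 2 (fderiv ℝ f) x := h.fderiv_right (by norm_num)
  obtain ⟨r₂, hr₂, C₂, h₂⟩ := C11On.exists_of_contDiffAt h'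
  have hc : ContinuousAt (fderiv ℝ f) x := h'.continuousAt
  have hev : ∀ᶠ y in 𝓝 x, IsUnit (fderiv ℝ f y) := hc (Units.isOpen.mem_nhds hu)
  have hinv : ContinuousAt (fun y => ‖Ring.inverse (fderiv ℝ f y)‖) x := by
    obtain ⟨u, hu⟩ := hu
    have : ContinuousAt (Ring.inverse : (E →L[ℝ] E) → _) (fderiv ℝ f x) := by
      rw [← hu]; exact NormedRing.inverse_continuousAt u
    exact (this.comp (f := fderiv ℝ f) hc).norm
  have hev' : ∀ᶠ y in 𝓝 x, ‖Ring.inverse (fderiv ℝ f y)‖ <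
      ‖Ring.inverse (fderiv ℝ f x)‖ + 1 := hinv.eventually_lt_const (by linarith)
  obtain ⟨r₃, hr₃, h₃⟩ := Metric.eventually_nhds_iff_ball.1 (hev.and hev')
  have p1 : 0 ≤ C₁ := (norm_nonneg _).trans (h₁.bound x (Metric.mem_ball_self hr₁))
  have p2 : 0 ≤ C₂ := (norm_nonneg _).trans (h₂.bound x (Metric.mem_ball_self hr₂))
  have p3 := norm_nonneg (Ring.inverse (fderiv ℝ f x))
  refine ⟨min r₁ (min r₂ r₃), by positivity, C₁ + C₂ + (‖Ring.inverse (fderiv ℝ f x)‖ + 1),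
    by positivity, ?_, ?_, fun y hy => ?_⟩
  · exact (h₁.mono_set (Metric.ball_subset_ball (min_le_left _ _))).mono_const (by linarith)
  · exact (h₂.mono_set (Metric.ball_subset_ball
      ((min_le_right _ _).trans (min_le_left _ _)))).mono_const (by linarith)
  · have := h₃ y (Metric.ball_subset_ball ((min_le_right _ _).trans (min_le_right _ _)) hy)
    exact ⟨this.1, by linarith [this.2]⟩

theorem isUnit_fderiv_transition {χ χ' : OpenPartialHomeomorph M E} (hχ : IsChart χ)
    (hχ' : IsChart χ') {p : M} (hp : p ∈ χ.source) (hp' : p ∈ χ'.source) :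
    IsUnit (fderiv ℝ (fun z => χ' (χ.symm z)) (χ p)) := by
  have key : ∀ {χ χ' : OpenPartialHomeomorph M E}, IsChart χ → IsChart χ' → p ∈ χ.source →
      p ∈ χ'.source → fderiv ℝ (fun z => χ (χ'.symm z)) (χ' p) *
        fderiv ℝ (fun z => χ' (χ.symm z)) (χ p) = 1 := by
    intro χ χ' hχ hχ' hp hp'
    have d1 := (contDiffAt_transition hχ hχ' (χ.map_source hp)
      (by rwa [χ.left_inv hp])).differentiableAt (by simp)
    have d2 := (contDiffAt_transition hχ' hχ (χ'.map_source hp')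
      (by rwa [χ'.left_inv hp'])).differentiableAt (by simp)
    have e : χ' p = χ' (χ.symm (χ p)) := by rw [χ.left_inv hp]
    rw [e] at d2 ⊢
    have h1 := fderiv_comp (χ p) d2 d1
    have hev : (fun z => χ (χ'.symm z)) ∘ (fun z => χ' (χ.symm z)) =ᶠ[𝓝 (χ p)] id := by
      have hn : ∀ᶠ z in 𝓝 (χ p), z ∈ χ.target ∧ χ.symm z ∈ χ'.source := by
        refine Filter.Eventually.and (χ.open_target.mem_nhds (χ.map_source hp)) ?_
        refine (χ.continuousAt_symm (χ.map_source hp)) (χ'.open_source.mem_nhds ?_)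
        rwa [χ.left_inv hp]
      filter_upwards [hn] with z hz
      simp [χ'.left_inv hz.2, χ.right_inv hz.1]
    rw [hev.fderiv_eq, fderiv_id] at h1
    exact h1.symm
  exact ⟨⟨_, _, key hχ' hχ hp' hp, key hχ hχ' hp hp'⟩, rfl⟩

end Flow

/-! ### Common local bounds for V and f near a point of the reference trajectory. -/

section LocalData

variable {E : Type*} [NormedAddCommGroup E] [NormedSpace ℝ E]
  {M : Type*} [TopologicalSpace M] [ChartedSpace E M] {U : Type*} [MeasurableSpace U]

/-- On the short time interval `[a, b]` the reference curve stays in a coordinate ball in which the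
field `V` is of class `C^{2,1}` and the control system is of class `C^{1,1}`. -/
structure LocalData (f : ControlSystem E M U) (V : TimeField E M) (T : ℝ) (qs : ℝ → M) (a b : ℝ)
    (χ : OpenPartialHomeomorph M E) (z₀ : E) (R : ℝ) (h : ℝ → ℝ) : Prop where
  chart : IsChart χ
  R_pos : 0 < R
  ball_sub : Metric.ball z₀ R ⊆ χ.target
  int : IntegrableOn h (Icc a b)
  nonneg : ∀ t, 0 ≤ h t
  small : ∫ t in a..b, h t ≤ 1 / 4
  small_R : ∫ t in a..b, h t ≤ R / 4
  base : ∀ t ∈ Icc a b, qs t ∈ χ.source ∧ ‖χ (qs t) - z₀‖ < R / 4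
  V_meas : ∀ z ∈ Metric.ball z₀ R,
    AEStronglyMeasurable (fun t => localExpr χ (V t) z) (volume.restrict (Icc a b))
  V_reg : ∀ᵐ t ∂volume.restrict (Icc a b), C11On (h t) (localExpr χ (V t)) (Metric.ball z₀ R) ∧
    C11On (h t) (fderiv ℝ (localExpr χ (V t))) (Metric.ball z₀ R)
  f_meas : ∀ w : ℝ → U, IsControl T w → ∀ z ∈ Metric.ball z₀ R,
    AEStronglyMeasurable (fun t => localExpr χ (controlField f w t) z) (volume.restrict (Icc a b))
  f_reg : ∀ᵐ t ∂volume.restrict (Icc a b), ∀ u : U,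
    C11On (h t) (localExpr χ (fun q => f t q u)) (Metric.ball z₀ R)

/-- The chart is one adapted to V. The control system is bounded in a chart of assumption (D) and
transported by the change of coordinates, whose effect on fields is a product of C^{1,1} maps.
Chart, ball and bound depend on t₀ only; the smallness of ∫h holds on all short intervals near t₀,
and serves to keep the flow in the ball and its derivative invertible. -/
theorem exists_localData {f : ControlSystem E M U} {T : ℝ} {qs : ℝ → M} (hD : AssumptionD f T qs)
    {V : TimeField E M} (hV : IsRegularField V T) (hqs : ContinuousOn qs (Icc 0 T)) {t₀ : ℝ}
    (ht₀ : t₀ ∈ Icc 0 T) :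
    ∃ χ z₀ R h, ∃ ε > 0, ∀ a b, 0 ≤ a → a ≤ b → b ≤ T → |a - t₀| < ε → |b - t₀| < ε →
      LocalData f V T qs a b χ z₀ R h := by
  obtain ⟨χ, hχ, hp, R₁, hR₁, hball, m₁, hm₁, hm₁0, hVm, hVr⟩ := hV.exists_chart (qs t₀)
  obtain ⟨N, φ, m, k, hφ, hcov, hm, hk, hfm, hfr⟩ := hD.exists_charts
  obtain ⟨i, hi⟩ := hcov t₀ ht₀
  set z₀ := χ (qs t₀) with hz₀
  have hz₀t : z₀ ∈ χ.target := χ.map_source hp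
  have hz₀s : χ.symm z₀ = qs t₀ := χ.left_inv hp
  let σ : E → E := fun z => φ i (χ.symm z)
  let τ : E → E := fun z => χ ((φ i).symm z)
  have hσ : ContDiffAt ℝ ∞ σ z₀ := contDiffAt_transition hχ (hφ i) hz₀t (by rwa [hz₀s])
  have hσ0 : σ z₀ = φ i (qs t₀) := by simp only [σ, hz₀s]
  have hτ : ContDiffAt ℝ ∞ τ (σ z₀) := by
    rw [hσ0]
    exact contDiffAt_transition (hφ i) hχ ((φ i).map_source hi) (by rwa [(φ i).left_inv hi])
  obtain ⟨r₁, hr₁, C₁, hC₁⟩ := C11On.exists_of_contDiffAt (hσ.of_le ENat.LEInfty.out)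
  have hA : ContDiffAt ℝ 2 (fun z => fderiv ℝ τ (σ z)) z₀ := by
    have h1 : ContDiffAt ℝ 2 (fderiv ℝ τ) (σ z₀) := hτ.fderiv_right (m := 2)
      (by norm_num; exact ENat.LEInfty.out)
    exact h1.comp z₀ (hσ.of_le ENat.LEInfty.out)
  obtain ⟨r₂, hr₂, C₂, hC₂⟩ := C11On.exists_of_contDiffAt hA
  have hn : ∀ᶠ z in 𝓝 z₀, χ.symm z ∈ (φ i).source :=
    (χ.continuousAt_symm hz₀t) ((φ i).open_source.mem_nhds (by rwa [hz₀s]))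
  obtain ⟨r₃, hr₃, h₃⟩ := Metric.eventually_nhds_iff_ball.1 hn
  set R := min R₁ (min r₁ (min r₂ r₃)) with hR
  have hR0 : 0 < R := by positivity
  have sR₁ : Metric.ball z₀ R ⊆ Metric.ball z₀ R₁ := Metric.ball_subset_ball (min_le_left _ _)
  have sr₁ : Metric.ball z₀ R ⊆ Metric.ball z₀ r₁ :=
    Metric.ball_subset_ball ((min_le_right _ _).trans (min_le_left _ _))
  have sr₂ : Metric.ball z₀ R ⊆ Metric.ball z₀ r₂ := Metric.ball_subset_ball
    ((min_le_right _ _).trans ((min_le_right _ _).trans (min_le_left _ _)))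
  have sr₃ : Metric.ball z₀ R ⊆ Metric.ball z₀ r₃ := Metric.ball_subset_ball
    ((min_le_right _ _).trans ((min_le_right _ _).trans (min_le_right _ _)))
  have p1 : 0 ≤ C₁ := (norm_nonneg _).trans (hC₁.bound z₀ (Metric.mem_ball_self hr₁))
  have p2 : 0 ≤ C₂ := (norm_nonneg _).trans (hC₂.bound z₀ (Metric.mem_ball_self hr₂))
  have hexpr : ∀ (Y : (q : M) → TangentSpace 𝓘(ℝ, E) q), ∀ z ∈ Metric.ball z₀ R,
      localExpr χ Y z = fderiv ℝ τ (σ z) (localExpr (φ i) Y (σ z)) := by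
    intro Y z hz
    have hzt : z ∈ χ.target := hball (sR₁ hz)
    have hzs : χ.symm z ∈ (φ i).source := h₃ z (sr₃ hz)
    have := push_transition (hφ i) hχ hzs (χ.map_target hzt) (Y (χ.symm z))
    unfold localExpr
    rw [this]
    simp only [σ, τ]
    rw [(φ i).left_inv hzs]
  have hσt : MapsTo σ (Metric.ball z₀ R) (φ i).target := fun z hz =>
    (φ i).map_source (h₃ z (sr₃ hz))
  -- The bound for V plus the one for Dτ(σ z)·F(σ z): the factor 4C₂ comes from applying the
  -- operator, (1 + C₁)² from composing with σ.
  set h : ℝ → ℝ := fun t => m₁ t + 4 * C₂ * ((|m t| + |k t|) * (1 + C₁) ^ 2) with hh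
  have hh0 : ∀ t, 0 ≤ h t := fun t => add_nonneg (hm₁0 t) (by positivity)
  have hhi : IntegrableOn h (Icc 0 T) := by
    have h1 : IntegrableOn (fun t => |m t| + |k t|) (Icc 0 T) := hm.abs.add hk.abs
    exact hm₁.add ((h1.mul_const _).const_mul _)
  obtain ⟨ε₁, hε₁, hs₁⟩ := exists_integral_le hhi (η := min (1 / 4) (R / 4)) (by positivity) t₀ ht₀
  let Nb : Set M := (χ.source ∩ χ ⁻¹' Metric.ball z₀ (R / 4)) ∩ (φ i).source
  have hNb : Nb ∈ 𝓝 (qs t₀) :=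
    ((χ.isOpen_inter_preimage Metric.isOpen_ball).inter (φ i).open_source).mem_nhds
      ⟨⟨hp, Metric.mem_ball_self (by positivity)⟩, hi⟩
  obtain ⟨ε₂, hε₂, hs₂⟩ := Metric.nhdsWithin_basis_ball.eventually_iff.1
    (show ∀ᶠ t in 𝓝[Icc 0 T] t₀, qs t ∈ Nb from hqs t₀ ht₀ hNb)
  refine ⟨χ, z₀, R, h, min ε₁ ε₂, by positivity, fun a b ha hab hb hat hbt => ?_⟩
  have hsub : Icc a b ⊆ Icc 0 T := Icc_subset_Icc ha hb
  have hin : ∀ t ∈ Icc a b, qs t ∈ Nb := by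
    intro t ht
    refine hs₂ ⟨?_, hsub ht⟩
    rw [Metric.mem_ball, Real.dist_eq, abs_lt]
    have h1 := abs_lt.1 (hat.trans_le (min_le_right _ _))
    have h2 := abs_lt.1 (hbt.trans_le (min_le_right _ _))
    exact ⟨by linarith [ht.1], by linarith [ht.2]⟩
  have hsm := hs₁ a b ha hab hb (hat.trans_le (min_le_left _ _)) (hbt.trans_le (min_le_left _ _))
  refine ⟨hχ, hR0, sR₁.trans hball, hhi.mono_set hsub, hh0, hsm.trans (min_le_left _ _),
    hsm.trans (min_le_right _ _), fun t ht => ⟨(hin t ht).1.1, ?_⟩,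
    fun z hz => (hVm z (sR₁ hz)).mono_measure (Measure.restrict_mono hsub le_rfl), ?_,
    fun w hw z hz => ?_, ?_⟩
  · have := (hin t ht).1.2
    rwa [mem_preimage, Metric.mem_ball, dist_eq_norm] at this
  · filter_upwards [ae_restrict_of_ae_restrict_of_subset hsub hVr] with t ht
    have : m₁ t ≤ h t := by
      have : 0 ≤ 4 * C₂ * ((|m t| + |k t|) * (1 + C₁) ^ 2) := by positivity
      simp only [hh]; linarith
    exact ⟨(ht.1.mono_set sR₁).mono_const this, (ht.2.mono_set sR₁).mono_const this⟩
  · have h1 : AEStronglyMeasurable (fun t => localExpr (φ i) (controlField f w t) (σ z))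
        (volume.restrict (Icc a b)) :=
      (hfm i _ (hσt hz) w hw).mono_measure
        (Measure.restrict_mono (show Icc a b ⊆ {t ∈ Icc 0 T | qs t ∈ (φ i).source} from
          fun t ht => ⟨hsub ht, (hin t ht).2⟩) le_rfl)
    have h2 := (fderiv ℝ τ (σ z)).continuous.comp_aestronglyMeasurable h1
    exact h2.congr (ae_of_all _ fun t => (hexpr _ z hz).symm)
  · filter_upwards [ae_restrict_of_ae_restrict_of_subset hsub (hfr i),
      ae_restrict_mem measurableSet_Icc] with t ht ht' u
    obtain ⟨h1, h2⟩ := ht (hin t ht').2 u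
    have hF : C11On (|m t| + |k t|) (localExpr (φ i) (fun q => f t q u)) (φ i).target := by
      have e1 : m t ≤ |m t| + |k t| := by linarith [le_abs_self (m t), abs_nonneg (k t)]
      have e2 : k t ≤ |m t| + |k t| := by linarith [le_abs_self (k t), abs_nonneg (m t)]
      exact ⟨fun x hx => (h1 x hx).1, fun x hx => (h1 x hx).2.1.trans e1,
        fun x hx => (h1 x hx).2.2.trans e1,
        fun x hx y hy => (h2 x hx y hy).1.trans (by gcongr),
        fun x hx y hy => (h2 x hx y hy).2.trans (by gcongr)⟩
    have h3 := (hC₂.mono_set sr₂).clm_apply (hF.comp (hC₁.mono_set sr₁) hσt)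
    refine (h3.congr Metric.isOpen_ball fun z hz => hexpr _ z hz).mono_const ?_
    simp only [hh]
    linarith [hm₁0 t]

end LocalData

/-! ### The flow of V in a chart over a short time interval. -/

section LocalFlow

variable {E : Type*} [NormedAddCommGroup E] [NormedSpace ℝ E]
  {M : Type*} [TopologicalSpace M] [ChartedSpace E M]
  {U : Type*} [MeasurableSpace U]
  {T : ℝ} {qs : ℝ → M} (L : LagrangianChart E T qs)

/-- Near the base point the flow map at time `t` is a local diffeomorphism with bounds. -/
def RegularAt (t : ℝ) : Prop :=
  ∃ χ : OpenPartialHomeomorph M E, IsChart χ ∧ qs t ∈ χ.source ∧ ∃ δ > 0, ∃ C, 0 ≤ C ∧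
    Metric.ball (L.φ (qs 0)) δ ⊆ L.φ.target ∧
    (∀ x ∈ Metric.ball (L.φ (qs 0)) δ, L.ψinv t x ∈ χ.source) ∧
    RegOn C (fun x => χ (L.ψinv t x)) (Metric.ball (L.φ (qs 0)) δ)

/-- The flow in a chart on a short time interval. -/
structure FlowOn (a b : ℝ) (χ : OpenPartialHomeomorph M E) (z₀ : E) (R : ℝ) (h : ℝ → ℝ)
    (δ C : ℝ) : Prop where
  δ_pos : 0 < δ
  C_pos : 0 ≤ C
  ball_sub : Metric.ball (L.φ (qs 0)) δ ⊆ L.φ.target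
  mem_source : ∀ t ∈ Icc a b, ∀ x ∈ Metric.ball (L.φ (qs 0)) δ, L.ψinv t x ∈ χ.source
  mem_ball : ∀ t ∈ Icc a b, ∀ x ∈ Metric.ball (L.φ (qs 0)) δ, χ (L.ψinv t x) ∈ Metric.ball z₀ R
  reg : ∀ t ∈ Icc a b, RegOn C (fun x => χ (L.ψinv t x)) (Metric.ball (L.φ (qs 0)) δ)
  prim : ∀ x ∈ Metric.ball (L.φ (qs 0)) δ, IsPrim (fun t => χ (L.ψinv t x))
    (fun t => localExpr χ (L.V t) (χ (L.ψinv t x))) a b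
  fderiv_sub : ∀ x ∈ Metric.ball (L.φ (qs 0)) δ, ∀ s t, a ≤ s → s ≤ t → t ≤ b →
    ‖fderiv ℝ (fun x => χ (L.ψinv t x)) x - fderiv ℝ (fun x => χ (L.ψinv s x)) x‖
      ≤ C * ∫ r in s..t, h r

variable {L}

theorem RegularAt.zero : RegularAt L 0 := by
  obtain ⟨δ, hδ, hball⟩ := Metric.isOpen_iff.1 L.φ.open_target _ (L.φ.map_source L.base_mem)
  have heq : ∀ x ∈ Metric.ball (L.φ (qs 0)) δ, L.φ (L.ψinv 0 x) = x := fun x hx => by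
    unfold LagrangianChart.ψinv
    rw [L.P_zero (L.φ.map_target (hball hx)), L.φ.right_inv (hball hx)]
  have hfd : ∀ x ∈ Metric.ball (L.φ (qs 0)) δ,
      fderiv ℝ (fun x => L.φ (L.ψinv 0 x)) x = ContinuousLinearMap.id ℝ E := fun x hx => by
    have : (fun x => L.φ (L.ψinv 0 x)) =ᶠ[𝓝 x] fun x => x :=
      Filter.eventually_of_mem (Metric.isOpen_ball.mem_nhds hx) heq
    rw [this.fderiv_eq, fderiv_fun_id]
  have hn := norm_nonneg (L.φ (qs 0))
  refine ⟨L.φ, L.isChart, L.base_mem, δ, hδ, ‖L.φ (qs 0)‖ + δ + 1, by positivity, hball,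
    fun x hx => ?_, C11On.id_ball.congr Metric.isOpen_ball heq, ?_, fun x hx => ?_⟩
  · unfold LagrangianChart.ψinv
    rw [L.P_zero (L.φ.map_target (hball hx))]
    exact L.φ.map_target (hball hx)
  · refine C11On.congr (f := fun _ => ContinuousLinearMap.id ℝ E) ?_ Metric.isOpen_ball hfd
    refine ⟨fun x _ => differentiableAt_const _, fun x _ => ?_, fun x _ => ?_, fun x _ y _ => ?_,
      fun x _ y _ => ?_⟩
    · exact ContinuousLinearMap.norm_id_le.trans (by linarith)
    · simp only [fderiv_fun_const, Pi.zero_apply, norm_zero]; positivity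
    · simp only [sub_self, norm_zero]; positivity
    · simp only [fderiv_fun_const, Pi.zero_apply, sub_self, norm_zero]; positivity
  · rw [hfd x hx]
    refine ⟨isUnit_one, ?_⟩
    have : Ring.inverse (ContinuousLinearMap.id ℝ E) = ContinuousLinearMap.id ℝ E :=
      Ring.inverse_one (E →L[ℝ] E)
    rw [this]
    exact ContinuousLinearMap.norm_id_le.trans (by linarith)

/-- Regularity of the flow at time a is carried over [a, b]: change to the chart of the local data,
keep the orbits in its ball, and apply the second-order dependence on initial values. The derivative
stays invertible because linearised solutions move by at most half of their initial size. -/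
theorem RegularAt.exists_flowOn [CompleteSpace E] [T2Space M] {f : ControlSystem E M U}
    {a b : ℝ} (ha : 0 ≤ a) (hab : a ≤ b) (hb : b ≤ T) (hreg : RegularAt L a)
    {χ : OpenPartialHomeomorph M E} {z₀ : E} {R : ℝ}
    {h : ℝ → ℝ} (D : LocalData f L.V T qs a b χ z₀ R h) :
    ∃ δ C, FlowOn L a b χ z₀ R h δ C := by
  obtain ⟨χ', hχ', hp', δ', hδ', C', hC', hball', hsrc', hreg'⟩ := hreg
  set x₀ := L.φ (qs 0) with hx₀
  have haI : a ∈ Icc a b := ⟨le_rfl, hab⟩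
  have hp : qs a ∈ χ.source := (D.base a haI).1
  let τ : E → E := fun z => χ (χ'.symm z)
  have hz' : χ' (qs a) ∈ χ'.target := χ'.map_source hp'
  have hτ : ContDiffAt ℝ ∞ τ (χ' (qs a)) :=
    contDiffAt_transition hχ' D.chart hz' (by rwa [χ'.left_inv hp'])
  obtain ⟨r₁, hr₁, C₁, hC₁, hτreg⟩ := RegOn.exists_of_contDiffAt (hτ.of_le ENat.LEInfty.out)
    (isUnit_fderiv_transition hχ' D.chart hp' hp)
  have hn : ∀ᶠ z in 𝓝 (χ' (qs a)), χ'.symm z ∈ χ.source ∧ ‖τ z - z₀‖ < R / 4 := by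
    refine Filter.Eventually.and ((χ'.continuousAt_symm hz')
      (χ.open_source.mem_nhds (by rwa [χ'.left_inv hp']))) ?_
    have h1 : ContinuousAt (fun z => ‖τ z - z₀‖) (χ' (qs a)) :=
      (hτ.continuousAt.sub continuousAt_const).norm
    refine h1.eventually_lt_const ?_
    simp only [τ, χ'.left_inv hp']
    exact (D.base a haI).2
  obtain ⟨r₂, hr₂, h₂⟩ := Metric.eventually_nhds_iff_ball.1 hn
  set r := min r₁ r₂ with hr
  have hr0 : 0 < r := by positivity
  -- The flow at time a is C'-Lipschitz in χ', so this radius puts the image of the ball inside the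
  -- ball of radius r; C' + 1 avoids division by zero.
  set δ := min δ' (r / (C' + 1)) with hδ
  have hδ0 : 0 < δ := by positivity
  set B := Metric.ball x₀ δ with hB
  have hBB' : B ⊆ Metric.ball x₀ δ' := Metric.ball_subset_ball (min_le_left _ _)
  have hBt : B ⊆ L.φ.target := hBB'.trans hball'
  have haT : a ∈ Icc 0 T := ⟨ha, hab.trans hb⟩
  have hmaps : MapsTo (fun x => χ' (L.ψinv a x)) B (Metric.ball (χ' (qs a)) r) := by
    intro x hx
    have h1 := hreg'.one.lip x (hBB' hx) x₀ (Metric.mem_ball_self hδ')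
    rw [hx₀, L.ψinv_base haT, ← hx₀] at h1
    rw [Metric.mem_ball, dist_eq_norm]
    have h2 : ‖x - x₀‖ < r / (C' + 1) := by
      rw [hB, Metric.mem_ball, dist_eq_norm] at hx
      exact hx.trans_le (min_le_right _ _)
    calc _ ≤ C' * ‖x - x₀‖ := h1
      _ ≤ (C' + 1) * ‖x - x₀‖ := by gcongr; linarith
      _ < (C' + 1) * (r / (C' + 1)) := by gcongr
      _ = r := by field_simp
  have hinit : ∀ x ∈ B, L.ψinv a x ∈ χ.source ∧ ‖χ (L.ψinv a x) - z₀‖ < R / 4 := by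
    intro x hx
    have := h₂ _ (Metric.ball_subset_ball (min_le_right _ _) (hmaps hx))
    simp only [τ] at this
    rwa [χ'.left_inv (hsrc' x (hBB' hx))] at this
  obtain ⟨C₀, hC₀, hι⟩ := RegOn.comp Metric.isOpen_ball hC' hC₁
    (hτreg.mono_set (Metric.ball_subset_ball (min_le_left _ _)))
    (hreg'.mono_set hBB') hmaps
  have heqι : ∀ x ∈ B, χ (L.ψinv a x) = τ (χ' (L.ψinv a x)) := fun x hx => by
    simp only [τ]; rw [χ'.left_inv (hsrc' x (hBB' hx))]
  have hfdι : ∀ x ∈ B, fderiv ℝ (fun x => χ (L.ψinv a x)) x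
      = fderiv ℝ (fun x => τ (χ' (L.ψinv a x))) x := fun x hx =>
    Filter.EventuallyEq.fderiv_eq
      (Filter.eventually_of_mem (Metric.isOpen_ball.mem_nhds hx) heqι)
  have hι1 : C11On C₀ (fun x => χ (L.ψinv a x)) B := hι.one.congr Metric.isOpen_ball heqι
  have hι2 : C11On C₀ (fderiv ℝ (fun x => χ (L.ψinv a x))) B :=
    hι.two.congr Metric.isOpen_ball hfdι
  have hAC : ∀ x ∈ B, IsACOn L.V a b (fun t => L.ψinv t x) := fun x hx =>
    (L.isACOn_ψinv (hBt hx)).mono ha hb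
  have hstay : ∀ x ∈ B, ∀ t ∈ Icc a b, L.ψinv t x ∈ χ.source ∧
      χ (L.ψinv t x) ∈ Metric.ball z₀ R := fun x hx =>
    (hAC x hx).mem_ball hab D.chart (hinit x hx).1 D.ball_sub
      ((hinit x hx).2.le.trans (by linarith [D.R_pos])) D.R_pos D.int D.nonneg D.small_R D.V_meas
      (D.V_reg.mono fun t ht => ht.1.bound) (D.V_reg.mono fun t ht => ht.1.lip)
  have hprim : ∀ x ∈ B, IsPrim (fun t => χ (L.ψinv t x))
      (fun t => localExpr χ (L.V t) (χ (L.ψinv t x))) a b := by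
    intro x hx
    refine ((hAC x hx).prim χ D.chart a b le_rfl hab le_rfl fun t ht => (hstay x hx t ht).1).congr
      (fun _ _ => rfl) ?_
    filter_upwards [ae_restrict_mem measurableSet_Icc] with t ht
    exact localExpr_apply (hstay x hx t ht).1 _
  obtain ⟨C₂, hC₂, hflow, hlin⟩ := flow_C21 (ξ := fun t x => χ (L.ψinv t x)) hab D.int D.nonneg hC₀
    (convex_ball z₀ R) Metric.isOpen_ball (convex_ball x₀ δ) Metric.isOpen_ball D.V_reg D.V_meas
    (fun x hx t ht => (hstay x hx t ht).2) hprim hι1 hι2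
  refine ⟨δ, C₂ + 2 * C₀, hδ0, by positivity, hBt, fun t ht x hx => (hstay x hx t ht).1,
    fun t ht x hx => (hstay x hx t ht).2, fun t ht => ⟨(hflow t ht).1.mono_const (by linarith),
      (hflow t ht).2.mono_const (by linarith), fun x hx => ?_⟩, hprim, ?_⟩
  · obtain ⟨hu, hu'⟩ := hι.unit x hx
    rw [← hfdι x hx] at hu hu'
    -- This doubles the bound on the inverse, whence the term 2C₀ in the constant.
    have := isUnit_of_close hu (B := fderiv ℝ (fun x => χ (L.ψinv t x)) x) fun v => by
      refine IsPrim.norm_sub_le_half D.int D.nonneg D.small (hlin x hx v) ?_ ht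
      filter_upwards [D.V_reg, ae_restrict_mem measurableSet_Icc] with s hs hs'
      exact ContinuousLinearMap.le_of_opNorm_le _
        (hs.1.fderiv_bound _ (hstay x hx s hs').2) _
    exact ⟨this.1, this.2.trans (by linarith)⟩
  · intro x hx s t hs hst ht
    have hI : 0 ≤ ∫ r in s..t, h r := intervalIntegral.integral_nonneg hst fun r _ => D.nonneg r
    refine ContinuousLinearMap.opNorm_le_bound _ (by positivity) fun v => ?_
    rw [_root_.sub_apply]
    have h1 := (hlin x hx v).norm_sub_le (k := fun r => h r * (C₂ * ‖v‖)) (D.int.mul_const _)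
      hs hst ht (by
        filter_upwards [D.V_reg, ae_restrict_mem measurableSet_Icc] with r hr hr'
        exact ContinuousLinearMap.le_of_opNorm_le_of_le _
          (hr.1.fderiv_bound _ (hstay x hx r hr').2)
          (ContinuousLinearMap.le_of_opNorm_le _ ((hflow r hr').1.fderiv_bound x hx) v))
    rw [intervalIntegral.integral_mul_const] at h1
    refine h1.trans ?_
    have : 0 ≤ C₀ * (∫ r in s..t, h r) * ‖v‖ := by positivity
    nlinarith

theorem FlowOn.regularAt {f : ControlSystem E M U} {a b : ℝ} {χ : OpenPartialHomeomorph M E}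
    {z₀ : E} {R : ℝ} {h : ℝ → ℝ} (D : LocalData f L.V T qs a b χ z₀ R h) {δ C : ℝ}
    (F : FlowOn L a b χ z₀ R h δ C) {t : ℝ} (ht : t ∈ Icc a b) : RegularAt L t :=
  ⟨χ, D.chart, (D.base t ht).1, δ, F.δ_pos, C, F.C_pos, F.ball_sub, F.mem_source t ht, F.reg t ht⟩

end LocalFlow

/-! ### Convex combinations preserve bounds. -/

section Convex

variable {E F : Type*} [NormedAddCommGroup E] [NormedSpace ℝ E] [NormedAddCommGroup F]
  [NormedSpace ℝ F]

theorem norm_sum_smul_le {n : ℕ} {p : Fin n → ℝ} (hp : ∀ i, 0 ≤ p i) (hp1 : ∑ i, p i = 1)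
    {v : Fin n → E} {c : ℝ} (hv : ∀ i, ‖v i‖ ≤ c) : ‖∑ i, p i • v i‖ ≤ c := by
  calc ‖∑ i, p i • v i‖ ≤ ∑ i, p i * c := by
        refine norm_sum_le_of_le _ fun i _ => ?_
        rw [norm_smul, Real.norm_of_nonneg (hp i)]
        exact mul_le_mul_of_nonneg_left (hv i) (hp i)
    _ = c := by rw [← Finset.sum_mul, hp1, one_mul]

theorem C11On.convexSum {n : ℕ} {p : Fin n → ℝ} (hp : ∀ i, 0 ≤ p i) (hp1 : ∑ i, p i = 1)
    {f : Fin n → E → F} {C : ℝ} {s : Set E} (hf : ∀ i, C11On C (f i) s) :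
    C11On C (fun x => ∑ i, p i • f i x) s := by
  have hfd : ∀ x ∈ s, fderiv ℝ (fun x => ∑ i, p i • f i x) x = ∑ i, p i • fderiv ℝ (f i) x := by
    intro x hx
    rw [fderiv_fun_sum fun i _ => ((hf i).diff x hx).fun_const_smul (p i)]
    exact Finset.sum_congr rfl fun i _ => fderiv_fun_const_smul ((hf i).diff x hx) (p i)
  refine ⟨fun x hx => DifferentiableAt.fun_sum fun i _ => ((hf i).diff x hx).fun_const_smul (p i),
    fun x hx => norm_sum_smul_le hp hp1 fun i => (hf i).bound x hx, fun x hx => ?_,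
    fun x hx y hy => ?_, fun x hx y hy => ?_⟩
  · rw [hfd x hx]; exact norm_sum_smul_le hp hp1 fun i => (hf i).fderiv_bound x hx
  · have : ∑ i, p i • f i x - ∑ i, p i • f i y = ∑ i, p i • (f i x - f i y) := by
      simp only [smul_sub, Finset.sum_sub_distrib]
    rw [this]; exact norm_sum_smul_le hp hp1 fun i => (hf i).lip x hx y hy
  · have : ∑ i, p i • fderiv ℝ (f i) x - ∑ i, p i • fderiv ℝ (f i) y
        = ∑ i, p i • (fderiv ℝ (f i) x - fderiv ℝ (f i) y) := by
      simp only [smul_sub, Finset.sum_sub_distrib]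
    rw [hfd x hx, hfd y hy, this]
    exact norm_sum_smul_le hp hp1 fun i => (hf i).fderiv_lip x hx y hy

end Convex

/-! ### The control system in Lagrangian coordinates. -/

section Tube

variable {E : Type*} [NormedAddCommGroup E] [NormedSpace ℝ E]
  {M : Type*} [TopologicalSpace M] [ChartedSpace E M] {U : Type*}

/-- The convex combination `∑ᵢ pᵢ f(t, q, wᵢ(t))`. -/
noncomputable def mix (f : ControlSystem E M U) {n : ℕ} (p : Fin n → ℝ)
    (w : Fin n → ℝ → U) : TimeField E M :=
  fun t q => ∑ i, p i • f t q (w i t)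

theorem push_mix (f : ControlSystem E M U) {n : ℕ} (p : Fin n → ℝ) (w : Fin n → ℝ → U)
    (ψ : M → E) (t : ℝ) (q : M) :
    push ψ q (mix f p w t q) = ∑ i, p i • push ψ q (f t q (w i t)) := by
  unfold push mix
  rw [map_sum]
  exact Finset.sum_congr rfl fun i _ => map_smul _ _ _

theorem localExpr_mix (f : ControlSystem E M U) {n : ℕ} (p : Fin n → ℝ) (w : Fin n → ℝ → U)
    (χ : OpenPartialHomeomorph M E) (t : ℝ) (z : E) :
    localExpr χ (mix f p w t) z = ∑ i, p i • localExpr χ (fun q => f t q (w i t)) z :=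
  push_mix f p w χ t _

variable [MeasurableSpace U] {T : ℝ} {qs : ℝ → M} {L : LagrangianChart E T qs}
  {f : ControlSystem E M U} {a b : ℝ} {χ : OpenPartialHomeomorph M E} {z₀ : E} {R : ℝ} {h : ℝ → ℝ}
  {δ C : ℝ}

variable (L f) in
/-- In Lagrangian coordinates the control system is of class `C^{1,1}` near the base point, and
describes the trajectories of the mixtures of the control system. -/
structure TubeOn (a b : ℝ) (δ : ℝ) (h : ℝ → ℝ) : Prop where
  reg : ∀ᵐ t ∂volume.restrict (Icc a b), ∀ u : U,
    C11On (h t) (fun x => L.g f t x u) (Metric.ball (L.φ (qs 0)) δ)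
  meas : ∀ w : ℝ → U, IsControl T w → ∀ x ∈ Metric.ball (L.φ (qs 0)) δ,
    AEStronglyMeasurable (fun t => L.g f t x (w t)) (volume.restrict (Icc a b))
  sol : ∀ {n : ℕ} (p : Fin n → ℝ) (w : Fin n → ℝ → U), (∀ i, 0 ≤ p i) → ∑ i, p i = 1 →
    (∀ i, IsControl T (w i)) → ∀ e ∈ Icc a b, ∀ x : ℝ → E,
    (∀ t ∈ Icc a e, x t ∈ Metric.ball (L.φ (qs 0)) δ) →
    IsPrim x (fun t => ∑ i, p i • L.g f t (x t) (w i t)) a e →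
    IsACOn (mix f p w) a e (fun t => L.ψinv t (x t)) ∧
    ∀ c, IsACOn (mix f p w) a e c → c a = L.ψinv a (x a) → ∀ t ∈ Icc a e, c t = L.ψinv t (x t)

theorem TubeOn.mono {δ' : ℝ} {h' : ℝ → ℝ} (H : TubeOn L f a b δ h) (hδ : δ' ≤ δ)
    (hh : ∀ t, h t ≤ h' t) : TubeOn L f a b δ' h' := by
  have hsub : Metric.ball (L.φ (qs 0)) δ' ⊆ Metric.ball (L.φ (qs 0)) δ :=
    Metric.ball_subset_ball hδ
  refine ⟨?_, fun w hw x hx => H.meas w hw x (hsub hx), fun p w hp hp1 hw e he x hx hprim =>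
    H.sol p w hp hp1 hw e he x (fun t ht => hsub (hx t ht)) hprim⟩
  filter_upwards [H.reg] with t ht u
  exact ((ht u).mono_set hsub).mono_const (hh t)

theorem TubeOn.trans {r : ℝ} (har : a ≤ r) (hrb : r ≤ b) (H₁ : TubeOn L f a r δ h)
    (H₂ : TubeOn L f r b δ h) : TubeOn L f a b δ h := by
  have hu : Icc a b = Icc a r ∪ Icc r b := (Icc_union_Icc_eq_Icc har hrb).symm
  refine ⟨?_, fun w hw x hx => ?_, fun p w hp hp1 hw e he x hx hprim => ?_⟩
  · rw [hu, ae_restrict_union_iff]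
    exact ⟨H₁.reg, H₂.reg⟩
  · rw [hu, aestronglyMeasurable_union_iff]
    exact ⟨H₁.meas w hw x hx, H₂.meas w hw x hx⟩
  · rcases le_total e r with her | hre
    · exact H₁.sol p w hp hp1 hw e ⟨he.1, her⟩ x hx hprim
    · obtain ⟨h1, h1'⟩ := H₁.sol p w hp hp1 hw r ⟨har, le_rfl⟩ x
        (fun t ht => hx t ⟨ht.1, ht.2.trans hre⟩) (hprim.mono le_rfl hre)
      obtain ⟨h2, h2'⟩ := H₂.sol p w hp hp1 hw e ⟨hre, he.2⟩ x
        (fun t ht => hx t ⟨har.trans ht.1, ht.2⟩) (hprim.mono har le_rfl)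
      refine ⟨h1.trans har hre h2, fun c hc hca t ht => ?_⟩
      have hc1 := h1' c (hc.mono le_rfl hre) hca
      rcases le_total t r with h | h
      · exact hc1 t ⟨ht.1, h⟩
      · exact h2' c (hc.mono har le_rfl) (hc1 r ⟨har, le_rfl⟩) t ⟨h, ht.2⟩

/-- Inverse function theorem for ξ_t = χ ∘ ψ_t⁻¹. The map ψ_t is defined by choice on P_t(O), but
near ξ_t(x) every point is some ξ_t(y) with y in the ball, so injectivity of the flow identifies ψ_t
∘ χ⁻¹ with the local inverse. -/
theorem FlowOn.hasFDerivAt_ψ [CompleteSpace E] [T2Space M] (ha : 0 ≤ a) (hb : b ≤ T)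
    (F : FlowOn L a b χ z₀ R h δ C) {t : ℝ} (ht : t ∈ Icc a b) {x : E}
    (hx : x ∈ Metric.ball (L.φ (qs 0)) δ) :
    HasFDerivAt (fun z => L.ψ t (χ.symm z))
      (Ring.inverse (fderiv ℝ (fun x => χ (L.ψinv t x)) x)) (χ (L.ψinv t x)) := by
  have htT : t ∈ Icc 0 T := ⟨ha.trans ht.1, ht.2.trans hb⟩
  set ξ : E → E := fun x => χ (L.ψinv t x) with hξ
  have hreg := F.reg t ht
  obtain ⟨u, hu⟩ := (hreg.unit x hx).1
  have hu : (u : E →L[ℝ] E) = fderiv ℝ ξ x := hu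
  let A : E ≃L[ℝ] E := ContinuousLinearEquiv.ofUnit u
  have hA : (A : E →L[ℝ] E) = fderiv ℝ ξ x := hu
  have hA' : (A.symm : E →L[ℝ] E) = Ring.inverse (fderiv ℝ ξ x) := by
    rw [← hu, Ring.inverse_unit]; rfl
  have hstrict : HasStrictFDerivAt ξ (A : E →L[ℝ] E) x := by
    rw [hA]
    refine hasStrictFDerivAt_of_hasFDerivAt_of_continuousAt (f' := fderiv ℝ ξ)
      (Filter.eventually_of_mem (Metric.isOpen_ball.mem_nhds hx)
        fun y hy => (hreg.one.diff y hy).hasFDerivAt) (hreg.two.diff x hx).continuousAt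
  have hinv := hstrict.to_localInverse.hasFDerivAt
  rw [hA'] at hinv
  refine hinv.congr_of_eventuallyEq ?_
  have hc : ContinuousAt (hstrict.localInverse ξ A x) (ξ x) := hinv.continuousAt
  have hmem : ∀ᶠ y in 𝓝 (ξ x), hstrict.localInverse ξ A x y ∈ Metric.ball (L.φ (qs 0)) δ := by
    refine hc (Metric.isOpen_ball.mem_nhds ?_)
    rwa [hstrict.localInverse_apply_image]
  filter_upwards [hmem, hstrict.eventually_right_inverse] with y hy hy'
  have h1 : χ.symm y = L.ψinv t (hstrict.localInverse ξ A x y) := by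
    rw [← χ.left_inv (F.mem_source t ht _ hy)]
    exact congrArg χ.symm hy'.symm
  rw [h1, L.ψ_ψinv htT (F.ball_sub hy)]

theorem FlowOn.push_ψ [CompleteSpace E] [T2Space M] (D : LocalData f L.V T qs a b χ z₀ R h)
    (ha : 0 ≤ a) (hb : b ≤ T)
    (F : FlowOn L a b χ z₀ R h δ C) {t : ℝ} (ht : t ∈ Icc a b) {x : E}
    (hx : x ∈ Metric.ball (L.φ (qs 0)) δ) (Y : (q : M) → TangentSpace 𝓘(ℝ, E) q) :
    push (L.ψ t) (L.ψinv t x) (Y (L.ψinv t x))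
      = Ring.inverse (fderiv ℝ (fun x => χ (L.ψinv t x)) x) (localExpr χ Y (χ (L.ψinv t x))) := by
  have h1 := F.hasFDerivAt_ψ ha hb ht hx
  rw [push_eq D.chart (F.mem_source t ht x hx) h1.differentiableAt, h1.fderiv,
    localExpr_apply (F.mem_source t ht x hx)]

/-- The formula from which the regularity and measurability of g and the equation of motion are read
off: it involves only ξ_t, Dξ_t and the coordinate expressions of f and V. -/
theorem FlowOn.g_eq [CompleteSpace E] [T2Space M] (D : LocalData f L.V T qs a b χ z₀ R h)
    (ha : 0 ≤ a) (hb : b ≤ T)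
    (F : FlowOn L a b χ z₀ R h δ C) {t : ℝ} (ht : t ∈ Icc a b) {x : E}
    (hx : x ∈ Metric.ball (L.φ (qs 0)) δ) (u : U) :
    L.g f t x u = Ring.inverse (fderiv ℝ (fun x => χ (L.ψinv t x)) x)
      (localExpr χ (fun q => f t q u) (χ (L.ψinv t x))
        - localExpr χ (L.V t) (χ (L.ψinv t x))) := by
  unfold LagrangianChart.g
  rw [F.push_ψ D ha hb ht hx (fun q => f t q u), F.push_ψ D ha hb ht hx (L.V t), map_sub]

/-- Both maps are Lipschitz in x uniformly in t, and their increments in t are dominated by those of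
the primitive of h. The factor C + 1 covers the flow (factor 1) and its derivative (factor C)
together. -/
theorem FlowOn.continuousOn_fderiv (D : LocalData f L.V T qs a b χ z₀ R h)
    (F : FlowOn L a b χ z₀ R h δ C) {e : ℝ} (he : e ≤ b) {x : ℝ → E}
    (hxc : ContinuousOn x (Icc a e)) (hx : ∀ t ∈ Icc a e, x t ∈ Metric.ball (L.φ (qs 0)) δ) :
    ContinuousOn (fun t => χ (L.ψinv t (x t))) (Icc a e) ∧
    ContinuousOn (fun t => fderiv ℝ (fun x => χ (L.ψinv t x)) (x t)) (Icc a e) := by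
  have hH : ContinuousOn (fun t => ∫ r in a..t, h r) (Icc a b) :=
    continuousOn_primitive_of_integrableOn D.int
  have hIc : ∀ s t, a ≤ s → s ≤ t → t ≤ b →
      ∫ r in s..t, h r = (∫ r in a..t, h r) - ∫ r in a..s, h r := fun s t hs hst ht =>
    (intervalIntegral.integral_interval_sub_left
      (intervalIntegrable_of_integrableOn D.int le_rfl (hs.trans hst) ht)
      (intervalIntegrable_of_integrableOn D.int le_rfl hs (hst.trans ht))).symm
  have key : ∀ {G : Type _} [NormedAddCommGroup G] (Θ : ℝ → E → G),
      (∀ t ∈ Icc a b, ∀ y ∈ Metric.ball (L.φ (qs 0)) δ, ∀ y' ∈ Metric.ball (L.φ (qs 0)) δ,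
        ‖Θ t y - Θ t y'‖ ≤ C * ‖y - y'‖) →
      (∀ y ∈ Metric.ball (L.φ (qs 0)) δ, ∀ s t, a ≤ s → s ≤ t → t ≤ b →
        ‖Θ t y - Θ s y‖ ≤ (C + 1) * ∫ r in s..t, h r) →
      ContinuousOn (fun t => Θ t (x t)) (Icc a e) := by
    intro G _ Θ hΘ1 hΘ2 t₀ ht₀
    have ht₀b : t₀ ∈ Icc a b := ⟨ht₀.1, ht₀.2.trans he⟩
    rw [ContinuousWithinAt, tendsto_iff_norm_sub_tendsto_zero]
    have hlim : Tendsto (fun t => C * ‖x t - x t₀‖ +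
        (C + 1) * |(∫ r in a..t, h r) - ∫ r in a..t₀, h r|) (𝓝[Icc a e] t₀) (𝓝 0) := by
      have h1 := tendsto_iff_norm_sub_tendsto_zero.1 (hxc t₀ ht₀)
      have h2 := tendsto_iff_norm_sub_tendsto_zero.1
        ((hH.mono (Icc_subset_Icc le_rfl he)) t₀ ht₀)
      simpa [Real.norm_eq_abs] using (h1.const_mul C).add (h2.const_mul (C + 1))
    refine squeeze_zero' (Eventually.of_forall fun _ => norm_nonneg _) ?_ hlim
    filter_upwards [self_mem_nhdsWithin] with t ht
    have htb : t ∈ Icc a b := ⟨ht.1, ht.2.trans he⟩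
    have h1 := hΘ1 t htb _ (hx t ht) _ (hx t₀ ht₀)
    have h2 : ‖Θ t (x t₀) - Θ t₀ (x t₀)‖ ≤
        (C + 1) * |(∫ r in a..t, h r) - ∫ r in a..t₀, h r| := by
      rcases le_total t t₀ with hle | hle
      · have := hΘ2 _ (hx t₀ ht₀) t t₀ ht.1 hle ht₀b.2
        rw [norm_sub_rev, abs_sub_comm, ← hIc t t₀ ht.1 hle ht₀b.2]
        exact this.trans (mul_le_mul_of_nonneg_left (le_abs_self _) (by linarith [F.C_pos]))
      · have := hΘ2 _ (hx t₀ ht₀) t₀ t ht₀.1 hle htb.2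
        rw [← hIc t₀ t ht₀.1 hle htb.2]
        exact this.trans (mul_le_mul_of_nonneg_left (le_abs_self _) (by linarith [F.C_pos]))
    calc ‖Θ t (x t) - Θ t₀ (x t₀)‖
        = ‖(Θ t (x t) - Θ t (x t₀)) + (Θ t (x t₀) - Θ t₀ (x t₀))‖ := by congr 1; abel
      _ ≤ _ := (norm_add_le _ _).trans (add_le_add h1 h2)
  refine ⟨key (fun t x => χ (L.ψinv t x)) (fun t ht => (F.reg t ht).one.lip)
    fun y hy s t hs hst ht => ?_,
    key (fun t x => fderiv ℝ (fun x => χ (L.ψinv t x)) x) (fun t ht => (F.reg t ht).two.lip)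
    fun y hy s t hs hst ht => (F.fderiv_sub y hy s t hs hst ht).trans ?_⟩
  · have h1 := (F.prim y hy).norm_sub_le D.int hs hst ht (by
      filter_upwards [D.V_reg, ae_restrict_mem measurableSet_Icc] with r hr hr'
      exact hr.1.bound _ (F.mem_ball r hr' y hy))
    have : 0 ≤ ∫ r in s..t, h r := intervalIntegral.integral_nonneg hst fun r _ => D.nonneg r
    nlinarith [F.C_pos]
  · have : 0 ≤ ∫ r in s..t, h r := intervalIntegral.integral_nonneg hst fun r _ => D.nonneg r
    nlinarith [F.C_pos]

/-- The chain rule along the flow. -/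
theorem FlowOn.isPrim_comp [CompleteSpace E] [T2Space M] (D : LocalData f L.V T qs a b χ z₀ R h)
    (F : FlowOn L a b χ z₀ R h δ C) {e : ℝ} (hae : a ≤ e) (he : e ≤ b) {x γ : ℝ → E}
    (hxγ : IsPrim x γ a e) (hx : ∀ t ∈ Icc a e, x t ∈ Metric.ball (L.φ (qs 0)) δ) :
    IsPrim (fun t => χ (L.ψinv t (x t))) (fun t => localExpr χ (L.V t) (χ (L.ψinv t (x t)))
      + fderiv ℝ (fun x => χ (L.ψinv t x)) (x t) (γ t)) a e := by
  have hsub : Icc a e ⊆ Icc a b := Icc_subset_Icc le_rfl he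
  obtain ⟨hyc, hAc⟩ := F.continuousOn_fderiv D he hxγ.continuousOn hx
  have hC := F.C_pos
  have hh := D.int.mono_set hsub
  have hVreg := ae_restrict_of_ae_restrict_of_subset hsub D.V_reg
  have hVint : ∀ {y : ℝ → E}, ContinuousOn y (Icc a e) → (∀ t ∈ Icc a e, y t ∈ Metric.ball z₀ R) →
      IntegrableOn (fun t => localExpr χ (L.V t) (y t)) (Icc a e) := by
    intro y hy hyb
    refine Integrable.mono' hh ?_ ?_
    · refine aestronglyMeasurable_comp_continuousOn (D := Metric.ball z₀ R)
        (h := fun t z => localExpr χ (L.V t) z) hae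
        (fun z hz => (D.V_meas z hz).mono_measure (Measure.restrict_mono hsub le_rfl)) ?_ hy hyb
      exact hVreg.mono fun t ht => ht.1.continuousOn
    · filter_upwards [hVreg, ae_restrict_mem measurableSet_Icc] with t ht ht'
      exact ht.1.bound _ (hyb t ht')
  have hV1 := hVint hyc fun t ht => F.mem_ball t (hsub ht) _ (hx t ht)
  have hA1 := integrableOn_clm_apply hAc hxγ.integrable
  -- The constant 4C collects C from Taylor's formula in x, C from following V along the flow of
  -- x(s) instead of x(r), and 2C from the variation of Dξ in time and in the point.
  refine IsPrim.of_quadratic (m := fun t => h t + ‖γ t‖) (C := 4 * C) (hV1.add hA1)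
    (hh.add hxγ.integrable.norm) (fun t => add_nonneg (D.nonneg t) (norm_nonneg _))
    fun s t hs hst ht => ?_
  have hm0 : ∀ t, 0 ≤ h t + ‖γ t‖ := fun t => add_nonneg (D.nonneg t) (norm_nonneg _)
  have hmi : IntegrableOn (fun t => h t + ‖γ t‖) (Icc a e) := hh.add hxγ.integrable.norm
  set H := ∫ r in s..t, (h r + ‖γ r‖) with hH
  have hH0 : 0 ≤ H := intervalIntegral.integral_nonneg hst fun r _ => hm0 r
  have hsI : s ∈ Icc a e := ⟨hs, hst.trans ht⟩
  have htI : t ∈ Icc a e := ⟨hs.trans hst, ht⟩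
  have hst' : Icc s t ⊆ Icc a e := Icc_subset_Icc hs ht
  have hxH : ∀ r ∈ Icc s t, ‖x r - x s‖ ≤ H := fun r hr =>
    (hxγ.norm_sub_le hmi hs hr.1 (hr.2.trans ht)
      (ae_of_all _ fun τ => by linarith [D.nonneg τ])).trans
      (integral_mono_interval (hmi.mono_set hst') hm0 le_rfl hr.1 hr.2)
  have hhH : ∀ r ∈ Icc s t, ∫ τ in r..t, h τ ≤ H := fun r hr => by
    have h1 : ∫ τ in r..t, h τ ≤ ∫ τ in r..t, (h τ + ‖γ τ‖) :=
      intervalIntegral.integral_mono_on hr.2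
        (intervalIntegrable_of_integrableOn hh (hs.trans hr.1) hr.2 ht)
        (intervalIntegrable_of_integrableOn hmi (hs.trans hr.1) hr.2 ht)
        fun τ _ => by linarith [norm_nonneg (γ τ)]
    exact h1.trans (integral_mono_interval (hmi.mono_set hst') hm0 hr.1 hr.2 le_rfl)
  set A : ℝ → E → E →L[ℝ] E := fun t => fderiv ℝ (fun x => χ (L.ψinv t x)) with hA
  have hsb := hx s hsI
  have e1 : ‖χ (L.ψinv t (x t)) - χ (L.ψinv t (x s)) - A t (x s) (x t - x s)‖ ≤ C * H ^ 2 :=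
    ((F.reg t (hsub htI)).one.norm_taylor_le (convex_ball _ _) hsb (hx t htI)).trans (by
      gcongr
      exact hxH t ⟨hst, le_rfl⟩)
  have hprim := F.prim (x s) hsb
  have hyc' : ContinuousOn (fun r => χ (L.ψinv r (x s))) (Icc a e) := hprim.continuousOn.mono hsub
  have hV2 := hVint hyc' fun t ht => F.mem_ball t (hsub ht) _ hsb
  have e2 : ‖∫ r in s..t, (localExpr χ (L.V r) (χ (L.ψinv r (x s)))
      - localExpr χ (L.V r) (χ (L.ψinv r (x r))))‖ ≤ ∫ r in s..t, (h r + ‖γ r‖) * (C * H) := by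
    refine norm_integral_le_of_ae_le ((hmi.mono_set hst').mul_const _) le_rfl hst le_rfl ?_
    filter_upwards [ae_restrict_of_ae_restrict_of_subset hst' hVreg,
      ae_restrict_mem measurableSet_Icc] with r hr hr'
    have hrb := hsub (hst' hr')
    have h1 := hr.1.lip _ (F.mem_ball r hrb _ hsb) _ (F.mem_ball r hrb _ (hx r (hst' hr')))
    have h2 := (F.reg r hrb).one.lip _ hsb _ (hx r (hst' hr'))
    rw [norm_sub_rev (x s)] at h2
    have h3 := h2.trans (mul_le_mul_of_nonneg_left (hxH r hr') hC)
    have h4 := h1.trans (mul_le_mul_of_nonneg_left h3 (D.nonneg r))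
    refine h4.trans (mul_le_mul_of_nonneg_right ?_ (by positivity))
    linarith [norm_nonneg (γ r)]
  have hg := hxγ.integrable.mono_set hst'
  have e3 : ‖∫ r in s..t, (A t (x s) (γ r) - A r (x r) (γ r))‖
      ≤ ∫ r in s..t, (h r + ‖γ r‖) * (2 * C * H) := by
    refine norm_integral_le_of_ae_le ((hmi.mono_set hst').mul_const _) le_rfl hst le_rfl ?_
    filter_upwards [ae_restrict_mem measurableSet_Icc] with r hr'
    have hrb := hsub (hst' hr')
    have h1 := (F.fderiv_sub _ hsb r t (hs.trans hr'.1) hr'.2 (ht.trans he)).trans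
      (mul_le_mul_of_nonneg_left (hhH r hr') hC)
    have h2 := (F.reg r hrb).two.lip _ hsb _ (hx r (hst' hr'))
    rw [norm_sub_rev (x s)] at h2
    have h3 := h2.trans (mul_le_mul_of_nonneg_left (hxH r hr') hC)
    have h4 : ‖A t (x s) - A r (x r)‖ ≤ 2 * C * H := by
      calc ‖A t (x s) - A r (x r)‖ = ‖(A t (x s) - A r (x s)) + (A r (x s) - A r (x r))‖ := by
            congr 1; abel
        _ ≤ C * H + C * H := (norm_add_le _ _).trans (add_le_add h1 h3)
        _ = 2 * C * H := by ring
    rw [← _root_.sub_apply]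
    refine (ContinuousLinearMap.le_of_opNorm_le _ h4 _).trans ?_
    rw [mul_comm]
    refine mul_le_mul_of_nonneg_right ?_ (by positivity)
    linarith [D.nonneg r]
  have i1 := intervalIntegrable_of_integrableOn hV1 hs hst ht
  have i2 := intervalIntegrable_of_integrableOn hV2 hs hst ht
  have i3 := intervalIntegrable_of_integrableOn hA1 hs hst ht
  have i4 := intervalIntegrable_of_integrableOn hxγ.integrable hs hst ht
  have i5 : IntervalIntegrable (fun r => A t (x s) (γ r)) volume s t :=
    ⟨(A t (x s)).integrable_comp i4.1, (A t (x s)).integrable_comp i4.2⟩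
  rw [intervalIntegral.integral_mul_const, ← hH] at e2 e3
  rw [intervalIntegral.integral_sub i2 i1, ← hprim.sub s t hs hst (ht.trans he)] at e2
  rw [intervalIntegral.integral_sub i5 i3, ContinuousLinearMap.intervalIntegral_comp_comm _ i4,
    ← hxγ.sub s t hs hst ht] at e3
  rw [intervalIntegral.integral_add i1 i3]
  set I₁ := ∫ r in s..t, localExpr χ (L.V r) (χ (L.ψinv r (x r)))
  set I₂ := ∫ r in s..t, A r (x r) (γ r)
  calc _ = ‖(χ (L.ψinv t (x t)) - χ (L.ψinv t (x s)) - A t (x s) (x t - x s))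
          + (χ (L.ψinv t (x s)) - χ (L.ψinv s (x s)) - I₁) + (A t (x s) (x t - x s) - I₂)‖ := by
        congr 1; abel
    _ ≤ C * H ^ 2 + H * (C * H) + H * (2 * C * H) :=
        (norm_add_le _ _).trans (add_le_add ((norm_add_le _ _).trans (add_le_add e1 e2)) e3)
    _ = 4 * C * H ^ 2 := by ring

end Tube

/-! ### Existence of a tube over the whole interval [0, T]. -/

section TubeExists

variable {E : Type*} [NormedAddCommGroup E] [NormedSpace ℝ E] [CompleteSpace E]
  {M : Type*} [TopologicalSpace M] [T2Space M] [ChartedSpace E M] {U : Type*} [MeasurableSpace U]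
  {T : ℝ} {qs : ℝ → M} {L : LagrangianChart E T qs}
  {f : ControlSystem E M U} {a b : ℝ} {χ : OpenPartialHomeomorph M E} {z₀ : E} {R : ℝ} {h : ℝ → ℝ}
  {δ C : ℝ}

/-- The calculus rules applied to the formula for g. The inverse is bounded by 1 + C because the
estimate for operator inversion asks for a bound at least 1. -/
theorem FlowOn.reg_g (D : LocalData f L.V T qs a b χ z₀ R h) (ha : 0 ≤ a) (hb : b ≤ T)
    (F : FlowOn L a b χ z₀ R h δ C) :
    ∃ K, 0 ≤ K ∧ ∀ᵐ t ∂volume.restrict (Icc a b), ∀ u : U,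
      C11On (K * h t) (fun x => L.g f t x u) (Metric.ball (L.φ (qs 0)) δ) := by
  have hC := F.C_pos
  refine ⟨4 * (2 * (1 + C) ^ 3 * (1 + C) ^ 2) * ((1 + C) ^ 2 + (1 + C) ^ 2), by positivity, ?_⟩
  filter_upwards [D.V_reg, D.f_reg, ae_restrict_mem measurableSet_Icc] with t hV hf ht u
  have hξ := F.reg t ht
  have hmaps : MapsTo (fun x => χ (L.ψinv t x)) (Metric.ball (L.φ (qs 0)) δ) (Metric.ball z₀ R) :=
    fun x hx => F.mem_ball t ht x hx
  have h1 := ((hf u).comp hξ.one hmaps).sub (hV.1.comp hξ.one hmaps)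
  have h2 := (C11On.ringInverse (E := E) (C := 1 + C) (by linarith)).comp hξ.two
    fun x hx => ⟨(hξ.unit x hx).1, (hξ.unit x hx).2.trans (by linarith)⟩
  refine ((h2.clm_apply h1).congr Metric.isOpen_ball fun x hx =>
    F.g_eq D ha hb ht hx u).mono_const (le_of_eq ?_)
  ring

theorem FlowOn.meas_g (D : LocalData f L.V T qs a b χ z₀ R h) (ha : 0 ≤ a) (hab : a ≤ b)
    (hb : b ≤ T) (F : FlowOn L a b χ z₀ R h δ C) {w : ℝ → U} (hw : IsControl T w) {x : E}
    (hx : x ∈ Metric.ball (L.φ (qs 0)) δ) :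
    AEStronglyMeasurable (fun t => L.g f t x (w t)) (volume.restrict (Icc a b)) := by
  obtain ⟨h1, h2⟩ := F.continuousOn_fderiv D le_rfl (x := fun _ => x) continuousOn_const
    fun _ _ => hx
  have hZ : ContinuousOn (fun t => Ring.inverse (fderiv ℝ (fun x => χ (L.ψinv t x)) x))
      (Icc a b) := by
    intro t ht
    obtain ⟨u, hu⟩ := ((F.reg t ht).unit x hx).1
    have := NormedRing.inverse_continuousAt u
    rw [hu] at this
    exact ContinuousAt.comp_continuousWithinAt
      (f := fun t => fderiv ℝ (fun x => χ (L.ψinv t x)) x) this (h2 t ht)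
  have m1 : AEStronglyMeasurable (fun t => localExpr χ (controlField f w t) (χ (L.ψinv t x)))
      (volume.restrict (Icc a b)) :=
    aestronglyMeasurable_comp_continuousOn (D := Metric.ball z₀ R)
      (h := fun t z => localExpr χ (controlField f w t) z) hab (fun z hz => D.f_meas w hw z hz)
      (D.f_reg.mono fun t ht => (ht (w t)).continuousOn) h1 fun t ht => F.mem_ball t ht x hx
  have m2 : AEStronglyMeasurable (fun t => localExpr χ (L.V t) (χ (L.ψinv t x)))
      (volume.restrict (Icc a b)) :=
    aestronglyMeasurable_comp_continuousOn (D := Metric.ball z₀ R)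
      (h := fun t z => localExpr χ (L.V t) z) hab (fun z hz => D.V_meas z hz)
      (D.V_reg.mono fun t ht => ht.1.continuousOn) h1 fun t ht => F.mem_ball t ht x hx
  have m3 :=
    (isBoundedBilinearMap_apply (𝕜 := ℝ) (E := E) (F := E)).continuous.comp_aestronglyMeasurable
    ((hZ.aestronglyMeasurable (μ := volume) measurableSet_Icc).prodMk (m1.sub m2))
  refine m3.congr ?_
  filter_upwards [ae_restrict_mem measurableSet_Icc] with t ht
  exact (F.g_eq D ha hb ht hx (w t)).symm

/-- The curve ξ_t(x(t)) has velocity V + Dξ_t·∑ pᵢ gᵢ. Since Dξ_t·gᵢ = fᵢ − V and the weights sum to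
1, the V-terms cancel and ∑ pᵢ fᵢ remains. Uniqueness holds because mixtures inherit the Lipschitz
bound of f. -/
theorem FlowOn.sol_g (D : LocalData f L.V T qs a b χ z₀ R h) (ha : 0 ≤ a) (hb : b ≤ T)
    (F : FlowOn L a b χ z₀ R h δ C) {n : ℕ} {p : Fin n → ℝ} {w : Fin n → ℝ → U}
    (hp : ∀ i, 0 ≤ p i) (hp1 : ∑ i, p i = 1) {e : ℝ} (he : e ∈ Icc a b) {x : ℝ → E}
    (hx : ∀ t ∈ Icc a e, x t ∈ Metric.ball (L.φ (qs 0)) δ)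
    (hprim : IsPrim x (fun t => ∑ i, p i • L.g f t (x t) (w i t)) a e) :
    IsACOn (mix f p w) a e (fun t => L.ψinv t (x t)) ∧
    ∀ c, IsACOn (mix f p w) a e c → c a = L.ψinv a (x a) →
      ∀ t ∈ Icc a e, c t = L.ψinv t (x t) := by
  have hsub : Icc a e ⊆ Icc a b := Icc_subset_Icc le_rfl he.2
  have hsrc : ∀ t ∈ Icc a e, L.ψinv t (x t) ∈ χ.source := fun t ht =>
    F.mem_source t (hsub ht) _ (hx t ht)
  obtain ⟨hyc, -⟩ := F.continuousOn_fderiv D he.2 hprim.continuousOn hx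
  have hcont : ContinuousOn (fun t => L.ψinv t (x t)) (Icc a e) := by
    have : ContinuousOn (fun t => χ.symm (χ (L.ψinv t (x t)))) (Icc a e) :=
      χ.continuousOn_symm.comp hyc fun t ht => χ.map_source (hsrc t ht)
    exact this.congr fun t ht => (χ.left_inv (hsrc t ht)).symm
  have hAC : IsACOn (mix f p w) a e (fun t => L.ψinv t (x t)) := by
    refine IsACOn.of_chart hcont D.chart hsrc ((F.isPrim_comp D he.1 he.2 hprim hx).congr
      (fun _ _ => rfl) ?_)
    filter_upwards [ae_restrict_mem measurableSet_Icc] with t ht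
    have htb := hsub ht
    set A := fderiv ℝ (fun x => χ (L.ψinv t x)) (x t) with hA
    have hAu : IsUnit A := ((F.reg t htb).unit _ (hx t ht)).1
    have hAA : ∀ v, A (Ring.inverse A v) = v := fun v =>
      DFunLike.congr_fun (Ring.mul_inverse_cancel A hAu) v
    have hsum : A (∑ i, p i • L.g f t (x t) (w i t))
        = ∑ i, p i • (localExpr χ (fun q => f t q (w i t)) (χ (L.ψinv t (x t)))
          - localExpr χ (L.V t) (χ (L.ψinv t (x t)))) := by
      rw [map_sum]
      refine Finset.sum_congr rfl fun i _ => ?_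
      rw [map_smul, F.g_eq D ha hb htb (hx t ht), hAA]
    rw [hsum, ← localExpr_apply (hsrc t ht), localExpr_mix]
    simp only [smul_sub, Finset.sum_sub_distrib, ← Finset.sum_smul, hp1, one_smul]
    abel
  refine ⟨hAC, fun c hc hca t ht => ?_⟩
  refine ((hAC.eqOn hc (left_mem_Icc.2 he.1) hca.symm fun t₀ ht₀ => ?_) t ht).symm
  have hin := F.mem_ball t₀ (hsub ht₀) _ (hx t₀ ht₀)
  obtain ⟨ρ, hρ, hball⟩ := Metric.isOpen_iff.1 Metric.isOpen_ball _ hin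
  refine ⟨χ, D.chart, hsrc t₀ ht₀, ρ, hρ, h, D.int.mono_set hsub, D.nonneg, ?_⟩
  filter_upwards [ae_restrict_of_ae_restrict_of_subset hsub D.f_reg] with s hs y hy y' hy'
  rw [localExpr_mix, localExpr_mix, ← Finset.sum_sub_distrib]
  simp only [← smul_sub]
  exact norm_sum_smul_le hp hp1 fun i => (hs (w i s)).lip _ (hball hy) _ (hball hy')

/-- The bound is cut off outside [a, b], hence integrable on the line, so that bounds of
neighbouring intervals can be added. -/
theorem FlowOn.exists_tubeOn (D : LocalData f L.V T qs a b χ z₀ R h) (ha : 0 ≤ a) (hab : a ≤ b)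
    (hb : b ≤ T) (F : FlowOn L a b χ z₀ R h δ C) :
    ∃ k : ℝ → ℝ, Integrable k ∧ (∀ t, 0 ≤ k t) ∧ TubeOn L f a b δ k := by
  obtain ⟨K, hK, hreg⟩ := F.reg_g D ha hb
  refine ⟨(Icc a b).indicator fun t => K * h t, IntegrableOn.integrable_indicator
    (D.int.const_mul K) measurableSet_Icc,
    fun t => indicator_nonneg (fun t _ => mul_nonneg hK (D.nonneg t)) t, ?_,
    fun w hw x hx => F.meas_g D ha hab hb hw hx,
    fun p w hp hp1 _ e he x hx hprim => F.sol_g D ha hb hp hp1 he hx hprim⟩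
  filter_upwards [hreg, ae_restrict_mem measurableSet_Icc] with t ht ht' u
  rw [indicator_of_mem ht']
  exact ht u

/-- The glued property is an implication: regularity of the flow at the left end yields regularity
at the right end together with a tube in between. When pieces are joined, radii shrink to the
smaller one and bounds add. It starts at time 0, where the flow is the identity. -/
theorem exists_tubeOn (hT : 0 ≤ T) (hD : AssumptionD f T qs) :
    ∃ δ > 0, ∃ h : ℝ → ℝ, Integrable h ∧ (∀ t, 0 ≤ h t) ∧
      Metric.ball (L.φ (qs 0)) δ ⊆ L.φ.target ∧ TubeOn L f 0 T δ h := by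
  have key := interval_glue (P := fun r s => RegularAt L r → RegularAt L s ∧ ∃ δ > 0,
    ∃ h : ℝ → ℝ, Integrable h ∧ (∀ t, 0 ≤ h t) ∧
      Metric.ball (L.φ (qs 0)) δ ⊆ L.φ.target ∧ TubeOn L f r s δ h) hT ?_ ?_
  · exact (key RegularAt.zero).2
  · intro r s t _ hrs hst _ h1 h2 hr
    obtain ⟨hs, δ₁, hδ₁, k₁, hk₁, hk₁0, hb₁, H₁⟩ := h1 hr
    obtain ⟨ht, δ₂, hδ₂, k₂, hk₂, hk₂0, hb₂, H₂⟩ := h2 hs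
    refine ⟨ht, min δ₁ δ₂, lt_min hδ₁ hδ₂, fun t => k₁ t + k₂ t, hk₁.add hk₂,
      fun t => add_nonneg (hk₁0 t) (hk₂0 t),
      (Metric.ball_subset_ball (min_le_left _ _)).trans hb₁, ?_⟩
    exact (H₁.mono (min_le_left _ _) fun t => by linarith [hk₂0 t]).trans hrs hst
      (H₂.mono (min_le_right _ _) fun t => by linarith [hk₁0 t])
  · intro t₀ ht₀
    obtain ⟨χ, z₀, R, h, ε, hε, H⟩ :=
      exists_localData hD L.regular L.V_extends.continuousOn ht₀
    refine ⟨ε, hε, fun r s hr hrs hs hr' hs' hreg => ?_⟩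
    have D := H r s hr hrs hs hr' hs'
    obtain ⟨δ, C, F⟩ := hreg.exists_flowOn hr hrs hs D
    obtain ⟨k, hk, hk0, hk'⟩ := F.exists_tubeOn D hr hrs hs
    exact ⟨F.regularAt D ⟨hrs, le_rfl⟩, δ, F.δ_pos, k, hk, hk0, F.ball_sub, hk'⟩

end TubeExists

/-! ### Trajectories of cut-off fields: stability and first-order expansion. -/

section Trajectories

variable {E : Type*} [NormedAddCommGroup E] [NormedSpace ℝ E]
  {T : ℝ} {x₀ : E} {δ : ℝ} {h : ℝ → ℝ} {W W' : ℝ → E → E}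

/-- Time-dependent vector fields of class `C^{1,1}` on a ball. -/
structure IsC11Field (T : ℝ) (x₀ : E) (δ : ℝ) (h : ℝ → ℝ) (W : ℝ → E → E) : Prop where
  reg : ∀ᵐ t ∂volume.restrict (Icc 0 T), C11On (h t) (W t) (Metric.ball x₀ δ)
  meas : ∀ x ∈ Metric.ball x₀ δ,
    AEStronglyMeasurable (fun t => W t x) (volume.restrict (Icc 0 T))

/-- `x` is a trajectory on `[0, T]` of the field `W`, cut off outside of the ball of radius
`δ / 2`. -/
structure IsTraj (T : ℝ) (x₀ : E) (δ : ℝ) (W : ℝ → E → E) (z : E) (x : ℝ → E) : Prop where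
  initial : x 0 = z
  prim : IsPrim x (fun t => W t (ballRetract x₀ (δ / 2) (x t))) 0 T

theorem ballRetract_mem_ball (hδ : 0 < δ) (z : E) :
    ballRetract x₀ (δ / 2) z ∈ Metric.ball x₀ δ := by
  rw [Metric.mem_ball, dist_eq_norm]
  exact (norm_ballRetract_sub_le x₀ (by positivity) z).trans_lt (by linarith)

theorem IsC11Field.lip (hW : IsC11Field T x₀ δ h W) (hδ : 0 < δ) (hh0 : ∀ t, 0 ≤ h t) :
    ∀ᵐ t ∂volume.restrict (Icc 0 T), ∀ z z', ‖W t (ballRetract x₀ (δ / 2) z)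
      - W t (ballRetract x₀ (δ / 2) z')‖ ≤ 2 * h t * ‖z - z'‖ := by
  filter_upwards [hW.reg] with t ht z z'
  refine (ht.lip _ (ballRetract_mem_ball hδ z) _ (ballRetract_mem_ball hδ z')).trans ?_
  have := mul_le_mul_of_nonneg_left
    (norm_ballRetract_sub_ballRetract_le x₀ (r := δ / 2) (by positivity) z z') (hh0 t)
  linarith

theorem IsC11Field.integrableOn (hT : 0 ≤ T) (hδ : 0 < δ) (hh : IntegrableOn h (Icc 0 T))
    (hh0 : ∀ t, 0 ≤ h t) (hW : IsC11Field T x₀ δ h W) {x : ℝ → E}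
    (hx : ContinuousOn x (Icc 0 T)) :
    IntegrableOn (fun t => W t (ballRetract x₀ (δ / 2) (x t))) (Icc 0 T) := by
  refine integrableOn_field (W := fun t x => W t (ballRetract x₀ (δ / 2) x)) (k := fun t => 2 * h t)
    hT (hh.const_mul 2) (fun z => hW.meas _ (ballRetract_mem_ball hδ z)) (hW.lip hδ hh0) ?_ hx
  filter_upwards [hW.reg] with t ht
  exact (ht.bound _ (ballRetract_mem_ball hδ 0)).trans (by linarith [hh0 t])

theorem IsC11Field.exists_isTraj [CompleteSpace E] (hT : 0 ≤ T) (hδ : 0 < δ)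
    (hh : IntegrableOn h (Icc 0 T)) (hh0 : ∀ t, 0 ≤ h t) (hW : IsC11Field T x₀ δ h W) (z : E) :
    ∃ x, IsTraj T x₀ δ W z x := by
  have hex := exists_isPrim (W := fun t x => W t (ballRetract x₀ (δ / 2) x))
    (k := fun t => 2 * h t) hT (hh.const_mul 2) (fun t => by linarith [hh0 t])
    (fun z => hW.meas _ (ballRetract_mem_ball hδ z)) (hW.lip hδ hh0) ?_ z
  · obtain ⟨x, hx0, hx⟩ := hex
    exact ⟨x, hx0, hx⟩
  · filter_upwards [hW.reg] with t ht
    exact (ht.bound _ (ballRetract_mem_ball hδ 0)).trans (by linarith [hh0 t])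

/-- Trajectories depend on the initial point and on the primitive of the field in a Lipschitz
way. -/
theorem exists_traj_stability (E : Type*) [NormedAddCommGroup E] [NormedSpace ℝ E]
    (hT : 0 ≤ T) (hh : IntegrableOn h (Icc 0 T)) (hh0 : ∀ t, 0 ≤ h t) :
    ∃ C, 1 ≤ C ∧ ∀ (x₀ : E) (δ : ℝ) (W W' : ℝ → E → E) (z z' : E) (x x' : ℝ → E) (β : ℝ), 0 < δ →
      IsC11Field T x₀ δ h W' → IsTraj T x₀ δ W z x →
      IsTraj T x₀ δ W' z' x' →
      (∀ t ∈ Icc 0 T, ‖∫ s in 0..t, (W s (ballRetract x₀ (δ / 2) (x s))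
        - W' s (ballRetract x₀ (δ / 2) (x s)))‖ ≤ β) →
      ∀ t ∈ Icc 0 T, ‖x t - x' t‖ ≤ C * (‖z - z'‖ + β) := by
  obtain ⟨C, hC, hg⟩ := gronwall_isPrim E hT (hh.const_mul 2) (fun t => by linarith [hh0 t])
  refine ⟨C + 1, by linarith, fun x₀ δ W W' z z' x x' β hδ hW' hx hx' hβ t ht => ?_⟩
  have hβ0 : 0 ≤ β := (norm_nonneg _).trans (hβ 0 ⟨le_rfl, hT⟩)
  set π := ballRetract x₀ (δ / 2) with hπ
  -- Subtracting J leaves a curve with velocity W'(πx) − W'(πx'). Hence only the primitive of W − W'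
  -- has to be small, and not the integral of its norm; fast switching makes small exactly the
  -- primitive.
  set J : ℝ → E := fun t => ∫ s in 0..t, (W s (π (x s)) - W' s (π (x s))) with hJ
  have hint : IntegrableOn (fun s => W s (π (x s)) - W' s (π (x s))) (Icc 0 T) :=
    hx.prim.integrable.sub (hW'.integrableOn hT hδ hh hh0 hx.prim.continuousOn)
  have hJp : IsPrim J (fun s => W s (π (x s)) - W' s (π (x s))) 0 T := by
    refine ⟨hint, fun s t hs hst ht => ?_⟩
    exact intervalIntegral.integral_interval_sub_left
      (intervalIntegrable_of_integrableOn hint le_rfl (hs.trans hst) ht)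
      (intervalIntegrable_of_integrableOn hint le_rfl hs (hst.trans ht))
  have hep := (hx.prim.subFun hx'.prim).subFun hJp
  have hb := hg _ _ ‖z - z'‖ β hep ?_ ?_ hβ0 t ht
  · have e1 : x t - x' t = (x t - x' t - J t) + J t := by abel
    calc ‖x t - x' t‖ ≤ ‖x t - x' t - J t‖ + ‖J t‖ := by
          conv_lhs => rw [e1]
          exact norm_add_le _ _
      _ ≤ C * (‖z - z'‖ + β) + β := add_le_add hb (hβ t ht)
      _ ≤ (C + 1) * (‖z - z'‖ + β) := by nlinarith [norm_nonneg (z - z')]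
  · filter_upwards [hW'.lip hδ hh0, ae_restrict_mem measurableSet_Icc] with s hs hs'
    have e1 : W s (π (x s)) - W' s (π (x' s)) - (W s (π (x s)) - W' s (π (x s)))
        = W' s (π (x s)) - W' s (π (x' s)) := by abel
    rw [e1]
    refine (hs _ _).trans (mul_le_mul_of_nonneg_left ?_ (by linarith [hh0 s]))
    have e2 : x s - x' s = (x s - x' s - J s) + J s := by abel
    conv_lhs => rw [e2]
    exact (norm_add_le _ _).trans (add_le_add le_rfl (hβ s hs'))
  · simp only [hJ, intervalIntegral.integral_same, sub_zero, hx.initial, hx'.initial, le_refl]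

theorem IsC11Field.convex {N : ℝ → E → E} (hW : IsC11Field T x₀ δ h W)
    (hN : IsC11Field T x₀ δ h N) {r : ℝ} (hr : r ∈ Icc (0 : ℝ) 1) :
    IsC11Field T x₀ δ h (fun t x => (1 - r) • W t x + r • N t x) := by
  refine ⟨?_, fun x hx => ((hW.meas x hx).const_smul _).add ((hN.meas x hx).const_smul _)⟩
  filter_upwards [hW.reg, hN.reg] with t h1 h2
  have := C11On.convexSum (p := ![1 - r, r]) (f := ![W t, N t]) (C := h t)
    (s := Metric.ball x₀ δ) (by
      intro i; fin_cases i
      · simpa using hr.2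
      · simpa using hr.1) (by simp [Fin.sum_univ_two]) (by
      intro i; fin_cases i
      · simpa using h1
      · simpa using h2)
  simpa [Fin.sum_univ_two] using this

/-- First order expansion of the trajectories of `(1 - r) W + r N` in `r`, uniform in `N`. -/
theorem exists_traj_expansion (E : Type*) [NormedAddCommGroup E] [NormedSpace ℝ E]
    (hT : 0 ≤ T) (hδ : 0 < δ) (hh : IntegrableOn h (Icc 0 T)) (hh0 : ∀ t, 0 ≤ h t) :
    ∃ r₀ > 0, r₀ ≤ 1 ∧ ∃ C, 0 ≤ C ∧ ∀ (x₀ : E) (W N : ℝ → E → E) (z v : E) (x : ℝ → E)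
      (X : ℝ → ℝ → E), IsC11Field T x₀ δ h W → IsC11Field T x₀ δ h N → ‖v‖ ≤ 1 →
      IsTraj T x₀ δ W z x → (∀ t ∈ Icc 0 T, ‖x t - x₀‖ ≤ δ / 4) →
      (∀ r ∈ Icc 0 r₀, IsTraj T x₀ δ (fun t x => (1 - r) • W t x + r • N t x) (z + r • v) (X r)) →
      (∀ r ∈ Icc 0 r₀, ∀ t ∈ Icc 0 T, ‖X r t - x t‖ ≤ C * r ∧ ‖X r t - x₀‖ ≤ δ / 2) ∧
      ∀ w₂, HasDerivWithinAt (fun r => X r T) w₂ (Ici 0) 0 →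
        ∀ r ∈ Icc 0 r₀, ‖X r T - x T - r • w₂‖ ≤ C * r ^ 2 := by
  obtain ⟨C₁, hC₁, hst⟩ := exists_traj_stability E hT hh hh0
  obtain ⟨C₂, hC₂, hg⟩ := gronwall_isPrim E hT hh hh0
  set H := ∫ t in (0 : ℝ)..T, h t with hH
  have hH0 : 0 ≤ H := intervalIntegral.integral_nonneg hT fun t _ => hh0 t
  set K := C₁ * (1 + 2 * H) with hK
  have hK0 : 0 ≤ K := by positivity
  -- X r is within K r ≤ δ/4 of x, hence within δ/2 of x₀, where the cut-off is inactive.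
  set r₀ := min 1 (δ / (4 * (K + 1))) with hr₀
  have hr₀K : r₀ * K ≤ δ / 4 := by
    have h1 : r₀ * (K + 1) ≤ δ / (4 * (K + 1)) * (K + 1) := by
      gcongr; exact min_le_right _ _
    have h2 : δ / (4 * (K + 1)) * (K + 1) = δ / 4 := by field_simp
    have : 0 ≤ r₀ := by positivity
    nlinarith
  refine ⟨r₀, by positivity, min_le_left _ _, K + C₂ * (K ^ 2 + 2 * K) , by positivity,
    fun x₀ W N z v x X hW hN hv hx hxb hX => ?_⟩
  have hr1 : ∀ r ∈ Icc 0 r₀, r ∈ Icc (0 : ℝ) 1 := fun r hr => ⟨hr.1, hr.2.trans (min_le_left _ _)⟩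
  have hclose : ∀ r ∈ Icc 0 r₀, ∀ t ∈ Icc 0 T, ‖X r t - x t‖ ≤ K * r := by
    intro r hr t ht
    have h1 := hst x₀ δ W _ z (z + r • v) x (X r) (2 * r * H) hδ (hW.convex hN (hr1 r hr)) hx
      (hX r hr) (fun t ht => ?_) t ht
    · rw [norm_sub_rev]
      refine h1.trans ?_
      have : ‖z - (z + r • v)‖ ≤ r := by
        rw [sub_add_cancel_left, norm_neg, norm_smul, Real.norm_of_nonneg hr.1]
        nlinarith [hr.1]
      calc C₁ * (‖z - (z + r • v)‖ + 2 * r * H) ≤ C₁ * (r + 2 * r * H) := by gcongr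
        _ = K * r := by rw [hK]; ring
    · have h2 := norm_integral_le_of_ae_le (f := fun s => W s (ballRetract x₀ (δ / 2) (x s)) -
          ((1 - r) • W s (ballRetract x₀ (δ / 2) (x s)) + r • N s (ballRetract x₀ (δ / 2) (x s))))
        (hh.const_mul (2 * r)) le_rfl ht.1 ht.2 ?_
      · rw [intervalIntegral.integral_const_mul] at h2
        refine h2.trans (mul_le_mul_of_nonneg_left ?_ (by linarith [hr.1]))
        exact integral_mono_interval hh hh0 le_rfl ht.1 ht.2
      · filter_upwards [hW.reg, hN.reg] with s h1 h2
        set y := ballRetract x₀ (δ / 2) (x s)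
        have hy : y ∈ Metric.ball x₀ δ := ballRetract_mem_ball hδ _
        have e1 : W s y - ((1 - r) • W s y + r • N s y) = r • (W s y - N s y) := by module
        rw [e1, norm_smul, Real.norm_of_nonneg hr.1]
        have := (norm_sub_le (W s y) (N s y)).trans (add_le_add (h1.bound y hy) (h2.bound y hy))
        nlinarith [hr.1]
  have hXb : ∀ r ∈ Icc 0 r₀, ∀ t ∈ Icc 0 T, ‖X r t - x₀‖ ≤ δ / 2 := by
    intro r hr t ht
    have e1 : X r t - x₀ = (X r t - x t) + (x t - x₀) := by abel
    rw [e1]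
    refine (norm_add_le _ _).trans ((add_le_add (hclose r hr t ht) (hxb t ht)).trans ?_)
    have : K * r ≤ K * r₀ := mul_le_mul_of_nonneg_left hr.2 hK0
    linarith
  have hball : ∀ y : E, ‖y - x₀‖ ≤ δ / 2 → y ∈ Metric.ball x₀ δ := fun y hy => by
    rw [Metric.mem_ball, dist_eq_norm]; linarith
  have hCnn : 0 ≤ C₂ * (K ^ 2 + 2 * K) := by positivity
  refine ⟨fun r hr t ht => ⟨(hclose r hr t ht).trans (by nlinarith [hr.1]), hXb r hr t ht⟩,
    fun w₂ hw₂ => ?_⟩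
  let y : ℝ → ℝ → E := fun r t => r⁻¹ • (X r t - x t)
  -- Each difference quotient y r solves the same linearised equation up to an error O(r), with the
  -- same initial value v. Comparing two of them by Gronwall and letting s → 0 gives a remainder
  -- uniform in N, without solving the linearised equation.
  have hdiff : ∀ r ∈ Ioc 0 r₀, ∀ s ∈ Ioc 0 r₀, ‖y r T - y s T‖ ≤
      C₂ * (0 + (K ^ 2 + 2 * K) * (r + s)) := by
    intro r hr s hs
    have hrI := Ioc_subset_Icc_self hr
    have hsI := Ioc_subset_Icc_self hs
    have hpr : ∀ r ∈ Ioc 0 r₀, IsPrim (y r) (fun t => r⁻¹ • (((1 - r) • W t (X r t)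
        + r • N t (X r t)) - W t (x t))) 0 T := by
      intro r hr
      have hrI := Ioc_subset_Icc_self hr
      refine (((hX r hrI).prim.subFun hx.prim).smulFun r⁻¹).congr (fun _ _ => rfl) ?_
      filter_upwards [ae_restrict_mem measurableSet_Icc] with t ht
      simp only [ballRetract_of_le (hXb r hrI t ht),
        ballRetract_of_le ((hxb t ht).trans (by linarith : δ / 4 ≤ δ / 2))]
    have happ : ∀ r ∈ Ioc 0 r₀, ∀ᵐ t ∂volume.restrict (Icc 0 T),
        ‖r⁻¹ • (((1 - r) • W t (X r t) + r • N t (X r t)) - W t (x t))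
          - (fderiv ℝ (W t) (x t) (y r t) + (N t (x t) - W t (x t)))‖
          ≤ h t * ((K ^ 2 + 2 * K) * r) := by
      intro r hr
      have hrI := Ioc_subset_Icc_self hr
      filter_upwards [hW.reg, hN.reg, ae_restrict_mem measurableSet_Icc] with t h1 h2 ht
      have hxB := hball _ ((hxb t ht).trans (by linarith : δ / 4 ≤ δ / 2))
      have hXB := hball _ (hXb r hrI t ht)
      have hcl := hclose r hrI t ht
      have t1 := h1.norm_taylor_le (convex_ball _ _) hxB hXB
      have t2 := h2.lip _ hXB _ hxB
      have t3 := h1.lip _ hXB _ hxB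
      have hr0 : r ≠ 0 := hr.1.ne'
      have e1 : r⁻¹ • (((1 - r) • W t (X r t) + r • N t (X r t)) - W t (x t))
          - (fderiv ℝ (W t) (x t) (y r t) + (N t (x t) - W t (x t)))
          = r⁻¹ • (W t (X r t) - W t (x t) - fderiv ℝ (W t) (x t) (X r t - x t))
            + ((N t (X r t) - N t (x t)) - (W t (X r t) - W t (x t))) := by
        have e2 : (1 - r) • W t (X r t) + r • N t (X r t)
            = W t (X r t) + r • (N t (X r t) - W t (X r t)) := by module
        simp only [y, map_smul]
        rw [e2, add_sub_right_comm, smul_add, smul_smul, inv_mul_cancel₀ hr0, one_smul, smul_sub]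
        rw [smul_sub]
        simp only [smul_sub]
        abel
      rw [e1]
      have n1 : ‖r⁻¹ • (W t (X r t) - W t (x t) - fderiv ℝ (W t) (x t) (X r t - x t))‖
          ≤ h t * (K ^ 2 * r) := by
        rw [norm_smul, norm_inv, Real.norm_of_nonneg hr.1.le]
        calc r⁻¹ * ‖W t (X r t) - W t (x t) - fderiv ℝ (W t) (x t) (X r t - x t)‖
            ≤ r⁻¹ * (h t * (K * r) ^ 2) := by
              have := hr.1
              have := hh0 t
              gcongr
              refine t1.trans ?_
              gcongr
          _ = h t * (K ^ 2 * r) := by field_simp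
      have n2 : ‖(N t (X r t) - N t (x t)) - (W t (X r t) - W t (x t))‖ ≤ h t * (2 * K * r) := by
        refine (norm_sub_le _ _).trans ((add_le_add t2 t3).trans ?_)
        have := mul_le_mul_of_nonneg_left hcl (hh0 t)
        linarith
      refine (norm_add_le _ _).trans ((add_le_add n1 n2).trans (le_of_eq ?_))
      ring
    refine hg _ _ 0 ((K ^ 2 + 2 * K) * (r + s)) ((hpr r hr).subFun (hpr s hs)) ?_ ?_ ?_ T
      ⟨hT, le_rfl⟩
    · filter_upwards [happ r hr, happ s hs, hW.reg, ae_restrict_mem measurableSet_Icc]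
        with t h1 h2 h3 ht
      set a := r⁻¹ • (((1 - r) • W t (X r t) + r • N t (X r t)) - W t (x t))
      set b := s⁻¹ • (((1 - s) • W t (X s t) + s • N t (X s t)) - W t (x t))
      set A := fderiv ℝ (W t) (x t)
      have hA : ‖A (y r t - y s t)‖ ≤ h t * ‖y r t - y s t‖ := A.le_of_opNorm_le
        (h3.fderiv_bound _ (hball _ ((hxb t ht).trans (by linarith : δ / 4 ≤ δ / 2)))) _
      have e1 : a - b = (a - (A (y r t) + (N t (x t) - W t (x t))))
          - (b - (A (y s t) + (N t (x t) - W t (x t)))) + A (y r t - y s t) := by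
        rw [map_sub]; abel
      rw [e1]
      refine (norm_add_le _ _).trans ((add_le_add ((norm_sub_le _ _).trans (add_le_add h1 h2))
        hA).trans (le_of_eq ?_))
      ring
    · have : ∀ r ∈ Ioc 0 r₀, y r 0 = v := by
        intro r hr
        simp only [y]
        rw [(hX r (Ioc_subset_Icc_self hr)).initial, hx.initial, add_sub_cancel_left, smul_smul,
          inv_mul_cancel₀ hr.1.ne', one_smul]
      rw [this r hr, this s hs, sub_self, norm_zero]
    · have := hr.1; have := hs.1; positivity
  have hr₀0 : 0 < r₀ := by positivity
  have hlim : Tendsto (fun s => y s T) (𝓝[>] 0) (𝓝 w₂) := by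
    have h1 := hw₂.mono (Ioi_subset_Ici_self)
    rw [hasDerivWithinAt_iff_tendsto_slope' (by simp)] at h1
    refine h1.congr' ?_
    filter_upwards with s
    have hX0 : X 0 T = x T := by
      have := hclose 0 ⟨le_rfl, hr₀0.le⟩ T ⟨hT, le_rfl⟩
      rw [mul_zero] at this
      exact sub_eq_zero.1 (norm_le_zero_iff.1 this)
    simp only [slope_def_module, sub_zero, y, hX0]
  intro r hr
  rcases hr.1.eq_or_lt with rfl | hr0
  · have := hclose 0 hr T ⟨hT, le_rfl⟩
    simpa using this
  have hle : ‖y r T - w₂‖ ≤ C₂ * (0 + (K ^ 2 + 2 * K) * (r + 0)) := by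
    have l1 : Tendsto (fun s => ‖y r T - y s T‖) (𝓝[>] 0) (𝓝 ‖y r T - w₂‖) :=
      (tendsto_const_nhds.sub hlim).norm
    have l2 : Tendsto (fun s : ℝ => C₂ * (0 + (K ^ 2 + 2 * K) * (r + s))) (𝓝[>] 0)
        (𝓝 (C₂ * (0 + (K ^ 2 + 2 * K) * (r + 0)))) := by
      have : Continuous fun s : ℝ => C₂ * (0 + (K ^ 2 + 2 * K) * (r + s)) := by fun_prop
      exact this.continuousAt.tendsto.mono_left nhdsWithin_le_nhds
    refine le_of_tendsto_of_tendsto l1 l2 ?_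
    filter_upwards [Ioc_mem_nhdsGT hr₀0] with s hs
    exact hdiff r ⟨hr0, hr.2⟩ s hs
  have e1 : X r T - x T - r • w₂ = r • (y r T - w₂) := by
    simp only [y]
    rw [smul_sub, smul_smul, mul_inv_cancel₀ hr0.ne', one_smul]
  rw [e1, norm_smul, Real.norm_of_nonneg hr.1]
  calc r * ‖y r T - w₂‖ ≤ r * (C₂ * (0 + (K ^ 2 + 2 * K) * (r + 0))) := by gcongr
    _ = C₂ * (K ^ 2 + 2 * K) * r ^ 2 := by ring
    _ ≤ _ := by gcongr; linarith

end Trajectories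

/-! ### Approximation of convex combinations by fast switching. -/

section Chattering

variable {F : Type*} [NormedAddCommGroup F] [NormedSpace ℝ F] [CompleteSpace F]

/-- The probability measure with weights qᵢ is the image of Lebesgue measure on [0, 1] under a
measurable map, which is extended to the line through the fractional part. -/
theorem exists_periodic_selector {n : ℕ} {q : Fin n → ℝ} (hq : ∀ i, 0 ≤ q i)
    (hq1 : ∑ i, q i = 1) :
    ∃ j : ℝ → Fin n, Measurable j ∧ Function.Periodic j 1 ∧
      ∀ i, ∫ s in (0 : ℝ)..1, (j ⁻¹' {i}).indicator (fun _ => (1 : ℝ)) s = q i := by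
  let μ : Measure (Fin n) := Measure.sum fun i => ENNReal.ofReal (q i) • Measure.dirac i
  have hμi : ∀ i, μ {i} = ENNReal.ofReal (q i) := by
    intro i
    simp only [μ]
    rw [Measure.sum_apply _ (measurableSet_singleton i), tsum_fintype,
      Finset.sum_eq_single i]
    · simp
    · intro b _ hb
      simp [hb]
    · simp
  have : IsProbabilityMeasure μ := by
    refine ⟨?_⟩
    simp only [μ]
    rw [Measure.sum_apply _ MeasurableSet.univ, tsum_fintype]
    simp only [Measure.smul_apply, measure_univ, smul_eq_mul, mul_one]
    rw [← ENNReal.ofReal_sum_of_nonneg fun i _ => hq i, hq1, ENNReal.ofReal_one]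
  have : Nonempty (Fin n) := by
    rcases Nat.eq_zero_or_pos n with rfl | h
    · simp at hq1
    · exact ⟨⟨0, h⟩⟩
  obtain ⟨g, hg, hgμ⟩ := μ.exists_measurable_map_eq
  let j : ℝ → Fin n := fun s => g ⟨Int.fract s, Int.fract_nonneg s, (Int.fract_lt_one s).le⟩
  have hj : Measurable j := hg.comp (measurable_fract.subtype_mk)
  refine ⟨j, hj, fun s => by simp only [j, Int.fract_add_one], fun i => ?_⟩
  have hm : MeasurableSet (j ⁻¹' {i}) := hj (measurableSet_singleton i)
  rw [intervalIntegral.integral_of_le zero_le_one, setIntegral_indicator hm, setIntegral_const]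
  have hae : (Ioc (0 : ℝ) 1 ∩ j ⁻¹' {i} : Set ℝ) =ᵐ[volume] Subtype.val '' (g ⁻¹' {i}) := by
    have h01 : ∀ᵐ s : ℝ, s ≠ 0 ∧ s ≠ 1 :=
      (Measure.ae_ne volume (0 : ℝ)).and (Measure.ae_ne volume (1 : ℝ))
    filter_upwards [h01] with s hs
    refine propext ⟨fun h => ?_, fun h => ?_⟩
    · have hf : Int.fract s = s :=
        Int.fract_eq_self.2 ⟨h.1.1.le, lt_of_le_of_ne h.1.2 hs.2⟩
      exact ⟨_, h.2, hf⟩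
    · obtain ⟨y, hy, rfl⟩ := h
      have hf : Int.fract (y : ℝ) = y := Int.fract_eq_self.2 ⟨y.2.1, lt_of_le_of_ne y.2.2 hs.2⟩
      refine ⟨⟨lt_of_le_of_ne y.2.1 hs.1.symm, y.2.2⟩, ?_⟩
      have : (⟨Int.fract (y : ℝ), Int.fract_nonneg _, (Int.fract_lt_one _).le⟩ : unitInterval)
          = y :=
        Subtype.ext hf
      show g _ = i
      rw [this]; exact hy
  have hvol : volume (Subtype.val '' (g ⁻¹' {i}) : Set ℝ) = ENNReal.ofReal (q i) := by
    rw [← hμi i, ← hgμ, Measure.map_apply hg (measurableSet_singleton i)]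
    exact (comap_subtype_coe_apply measurableSet_Icc volume _).symm
  rw [measureReal_def, measure_congr hae, hvol, ENNReal.toReal_ofReal (hq i), smul_eq_mul, mul_one]

/-- Full periods contribute nothing, and each endpoint leaves an incomplete period contributing at
most 1. -/
theorem abs_integral_periodic_le {θ : ℝ → ℝ} (hm : Measurable θ) (hb : ∀ s, |θ s| ≤ 1)
    (hp : Function.Periodic θ 1) (h0 : ∫ s in (0 : ℝ)..1, θ s = 0) (a b : ℝ) :
    |∫ s in a..b, θ s| ≤ 2 := by
  have hint : ∀ t₁ t₂, IntervalIntegrable θ volume t₁ t₂ := fun t₁ t₂ =>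
    (intervalIntegrable_const (c := (1 : ℝ))).mono_fun hm.aestronglyMeasurable
      (ae_of_all _ fun s => by simpa using hb s)
  have key : ∀ t, |∫ s in (0 : ℝ)..t, θ s| ≤ 1 := by
    intro t
    have h1 := hp.intervalIntegral_add_zsmul_eq ⌊t⌋ 0 hint
    rw [zero_add, zero_add, h0, smul_zero, zsmul_eq_mul, mul_one] at h1
    rw [← intervalIntegral.integral_add_adjacent_intervals (hint 0 ⌊t⌋) (hint ⌊t⌋ t), h1, zero_add]
    have h2 := intervalIntegral.norm_integral_le_of_norm_le_const (a := (⌊t⌋ : ℝ)) (b := t)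
      (C := 1) (f := θ) fun s _ => hb s
    rw [one_mul, Real.norm_eq_abs] at h2
    refine h2.trans ?_
    rw [abs_of_nonneg (by linarith [Int.floor_le t])]
    linarith [Int.lt_floor_add_one t]
  rw [← intervalIntegral.integral_interval_sub_left (hint 0 b) (hint 0 a)]
  exact (abs_sub _ _).trans (by linarith [key a, key b])

theorem abs_integral_periodic_comp_mul_le {θ : ℝ → ℝ} (hm : Measurable θ) (hb : ∀ s, |θ s| ≤ 1)
    (hp : Function.Periodic θ 1) (h0 : ∫ s in (0 : ℝ)..1, θ s = 0) {N : ℝ} (hN : 0 < N) (a b : ℝ) :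
    |∫ s in a..b, θ (N * s)| ≤ 2 / N := by
  rw [intervalIntegral.integral_comp_mul_left _ hN.ne', smul_eq_mul, abs_mul,
    abs_of_pos (inv_pos.2 hN), div_eq_inv_mul]
  exact mul_le_mul_of_nonneg_left (abs_integral_periodic_le hm hb hp h0 _ _) (inv_pos.2 hN).le

/-- On a short interval g is within η of a constant vector: the deviation costs η(b − a), the
constant 2‖g(t₀)‖/N. Since the bound is stated for all subintervals, the local constants add under
gluing, independently of N. -/
theorem norm_integral_periodic_smul_continuous {θ : ℝ → ℝ} (hm : Measurable θ)
    (hb : ∀ s, |θ s| ≤ 1) (hp : Function.Periodic θ 1) (h0 : ∫ s in (0 : ℝ)..1, θ s = 0)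
    {T : ℝ} (hT : 0 ≤ T) {g : ℝ → F} (hg : Continuous g) {η : ℝ} (hη : 0 < η) :
    ∃ C, ∀ N : ℝ, 0 < N → ∀ a b, 0 ≤ a → a ≤ b → b ≤ T →
      ‖∫ s in a..b, θ (N * s) • g s‖ ≤ η * (b - a) + C / N := by
  have hθ : ∀ N a b, IntervalIntegrable (fun s => θ (N * s)) volume a b := fun N a b =>
    (intervalIntegrable_const (c := (1 : ℝ))).mono_fun
      (hm.comp (measurable_const_mul N)).aestronglyMeasurable
      (ae_of_all _ fun s => by simpa using hb (N * s))
  have hθg : ∀ N a b, IntervalIntegrable (fun s => θ (N * s) • g s) volume a b := fun N a b =>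
    (hθ N a b).smul_continuousOn hg.continuousOn
  suffices h : ∃ C, 0 ≤ C ∧ ∀ N : ℝ, 0 < N → ∀ a b, 0 ≤ a → a ≤ b → b ≤ T →
      ‖∫ s in a..b, θ (N * s) • g s‖ ≤ η * (b - a) + C / N by
    obtain ⟨C, _, h⟩ := h; exact ⟨C, h⟩
  refine interval_glue (P := fun r t => ∃ C, 0 ≤ C ∧ ∀ N : ℝ, 0 < N → ∀ a b, r ≤ a → a ≤ b → b ≤ t →
      ‖∫ s in a..b, θ (N * s) • g s‖ ≤ η * (b - a) + C / N) hT ?_ ?_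
  · rintro r s t _ hrs hst _ ⟨C₁, hC₁, h₁⟩ ⟨C₂, hC₂, h₂⟩
    refine ⟨C₁ + C₂, by positivity, fun N hN a b ha hab hb' => ?_⟩
    have q1 : 0 ≤ C₁ / N := by positivity
    have q2 : 0 ≤ C₂ / N := by positivity
    rw [add_div]
    rcases le_total b s with h | h
    · linarith [h₁ N hN a b ha hab h]
    rcases le_total s a with h' | h'
    · linarith [h₂ N hN a b h' hab hb']
    · rw [← intervalIntegral.integral_add_adjacent_intervals (hθg N a s) (hθg N s b)]
      refine (norm_add_le _ _).trans ?_
      linarith [h₁ N hN a s ha h' le_rfl, h₂ N hN s b le_rfl h hb']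
  · intro t₀ _
    obtain ⟨ε, hε, hclose⟩ := Metric.continuous_iff.1 hg t₀ η hη
    refine ⟨ε, hε, fun r t _ _ _ hr ht => ⟨2 * ‖g t₀‖, by positivity,
      fun N hN a b ha hab hbt => ?_⟩⟩
    have e1 : ∫ s in a..b, θ (N * s) • g s
        = (∫ s in a..b, θ (N * s) • (g s - g t₀)) + (∫ s in a..b, θ (N * s)) • g t₀ := by
      have i1 : IntervalIntegrable (fun s => θ (N * s) • (g s - g t₀)) volume a b :=
        (hθ N a b).smul_continuousOn (hg.sub continuous_const).continuousOn
      have i2 : IntervalIntegrable (fun s => θ (N * s) • g t₀) volume a b :=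
        (hθ N a b).smul_continuousOn continuousOn_const
      rw [← intervalIntegral.integral_smul_const, ← intervalIntegral.integral_add i1 i2]
      refine intervalIntegral.integral_congr fun s _ => ?_
      simp only [smul_sub, sub_add_cancel]
    rw [e1]
    refine (norm_add_le _ _).trans (add_le_add ?_ ?_)
    · have := intervalIntegral.norm_integral_le_of_norm_le_const (a := a) (b := b)
        (C := η) (f := fun s => θ (N * s) • (g s - g t₀)) fun s hs => ?_
      · rwa [abs_of_nonneg (by linarith)] at this
      · rw [uIoc_of_le hab] at hs
        have hd : ‖g s - g t₀‖ < η := by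
          rw [← dist_eq_norm]
          refine hclose s ?_
          rw [Real.dist_eq]
          rw [abs_lt] at hr ht ⊢
          exact ⟨by linarith [hs.1], by linarith [hs.2]⟩
        rw [norm_smul, Real.norm_eq_abs]
        nlinarith [hb (N * s), norm_nonneg (g s - g t₀)]
    · rw [norm_smul, Real.norm_eq_abs]
      calc _ ≤ 2 / N * ‖g t₀‖ := by
            gcongr
            exact abs_integral_periodic_comp_mul_le hm hb hp h0 hN a b
        _ = _ := by ring

/-- A Riemann–Lebesgue lemma uniform in the upper limit, by density of continuous functions in L¹.
One third of ε each goes to the approximation, to the η-term and to C/N. -/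
theorem eventually_norm_integral_periodic_smul_le {θ : ℝ → ℝ} (hm : Measurable θ)
    (hb : ∀ s, |θ s| ≤ 1) (hp : Function.Periodic θ 1) (h0 : ∫ s in (0 : ℝ)..1, θ s = 0)
    {T : ℝ} (hT : 0 ≤ T) {H : ℝ → F} (hH : IntegrableOn H (Icc 0 T)) {ε : ℝ} (hε : 0 < ε) :
    ∀ᶠ N : ℕ in atTop, ∀ t ∈ Icc 0 T, ‖∫ s in (0 : ℝ)..t, θ (N * s) • H s‖ ≤ ε := by
  have hH' : Integrable ((Icc 0 T).indicator H) := hH.integrable_indicator measurableSet_Icc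
  obtain ⟨g, -, hgε, hgc, hgi⟩ := hH'.exists_hasCompactSupport_integral_sub_le
    (show 0 < ε / 3 by positivity)
  obtain ⟨C, hC⟩ := norm_integral_periodic_smul_continuous hm hb hp h0 hT hgc
    (η := ε / (3 * (T + 1))) (by positivity)
  have hlim : ∀ᶠ N : ℕ in atTop, C / N < ε / 3 :=
    (tendsto_const_div_atTop_nhds_zero_nat C).eventually_lt_const (by positivity)
  filter_upwards [hlim, eventually_gt_atTop 0] with N hN hN0 t ht
  have hθm : AEStronglyMeasurable (fun s => θ (N * s)) volume :=
    (hm.comp (measurable_const_mul (N : ℝ))).aestronglyMeasurable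
  have hdi : Integrable (fun s => θ (N * s) • ((Icc 0 T).indicator H s - g s)) := by
    refine (hH'.sub hgi).norm.mono' (hθm.smul (hH'.sub hgi).aestronglyMeasurable)
      (ae_of_all _ fun s => ?_)
    rw [norm_smul, Real.norm_eq_abs]
    exact mul_le_of_le_one_left (norm_nonneg _) (hb _)
  have hgi' : Integrable (fun s => θ (N * s) • g s) := by
    refine hgi.norm.mono' (hθm.smul hgi.aestronglyMeasurable) (ae_of_all _ fun s => ?_)
    rw [norm_smul, Real.norm_eq_abs]
    exact mul_le_of_le_one_left (norm_nonneg _) (hb _)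
  have e1 : ∫ s in (0 : ℝ)..t, θ (N * s) • H s
      = (∫ s in (0 : ℝ)..t, θ (N * s) • ((Icc 0 T).indicator H s - g s))
        + ∫ s in (0 : ℝ)..t, θ (N * s) • g s := by
    rw [← intervalIntegral.integral_add hdi.intervalIntegrable hgi'.intervalIntegrable]
    refine intervalIntegral.integral_congr fun s hs => ?_
    rw [uIcc_of_le ht.1] at hs
    simp only [indicator_of_mem (show s ∈ Icc 0 T from ⟨hs.1, hs.2.trans ht.2⟩), smul_sub,
      sub_add_cancel]
  have e2 : ‖∫ s in (0 : ℝ)..t, θ (N * s) • ((Icc 0 T).indicator H s - g s)‖ ≤ ε / 3 := by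
    rw [intervalIntegral.integral_of_le ht.1]
    refine (norm_integral_le_integral_norm _).trans (le_trans ?_ hgε)
    refine (setIntegral_le_integral hdi.norm (ae_of_all _ fun s => norm_nonneg _)).trans ?_
    refine integral_mono hdi.norm (hH'.sub hgi).norm fun s => ?_
    simp only [norm_smul, Real.norm_eq_abs]
    exact mul_le_of_le_one_left (norm_nonneg _) (hb _)
  have e3 := hC N (by exact_mod_cast hN0) 0 t le_rfl ht.1 ht.2
  have e4 : ε / (3 * (T + 1)) * (t - 0) ≤ ε / 3 := by
    rw [sub_zero, div_mul_eq_mul_div, div_le_div_iff₀ (by positivity) (by norm_num)]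
    nlinarith [ht.2, ht.1]
  rw [e1]
  refine (norm_add_le _ _).trans ?_
  linarith

/-- Fast switching approximates a convex combination in the norm of primitives. -/
theorem exists_chattering {n : ℕ} {q : Fin n → ℝ} (hq : ∀ i, 0 ≤ q i) (hq1 : ∑ i, q i = 1)
    {T : ℝ} (hT : 0 ≤ T) {H : Fin n → ℝ → F} (hH : ∀ i, IntegrableOn (H i) (Icc 0 T)) {ε : ℝ}
    (hε : 0 < ε) :
    ∃ ι : ℝ → Fin n, Measurable ι ∧ IntegrableOn (fun s => H (ι s) s) (Icc 0 T) ∧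
      ∀ t ∈ Icc 0 T, ‖∫ s in (0 : ℝ)..t, (H (ι s) s - ∑ i, q i • H i s)‖ ≤ ε := by
  obtain ⟨j, hj, hjp, hji⟩ := exists_periodic_selector hq hq1
  have hn : 0 < n := by
    rcases Nat.eq_zero_or_pos n with rfl | h
    · simp at hq1
    · exact h
  have hq_le : ∀ i, q i ≤ 1 := fun i =>
    hq1 ▸ Finset.single_le_sum (fun j _ => hq j) (Finset.mem_univ i)
  -- The switching error is ∑ θᵢ(N s) Hᵢ(s), with θᵢ periodic of mean zero.
  let θ : Fin n → ℝ → ℝ := fun i s => (j ⁻¹' {i}).indicator (fun _ => (1 : ℝ)) s - q i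
  have hjm : ∀ i, MeasurableSet (j ⁻¹' {i}) := fun i => hj (measurableSet_singleton i)
  have hθm : ∀ i, Measurable (θ i) := fun i =>
    (measurable_const.indicator (hjm i)).sub measurable_const
  have hθb : ∀ i s, |θ i s| ≤ 1 := by
    intro i s
    have h1 := hq i
    have h2 := hq_le i
    simp only [θ, indicator]
    split_ifs
    · rw [abs_le]; constructor <;> linarith
    · rw [abs_le]; constructor <;> linarith
  have hθp : ∀ i, Function.Periodic (θ i) 1 := by
    intro i s
    simp only [θ, indicator, mem_preimage, hjp s]
  have hθ0 : ∀ i, ∫ s in (0 : ℝ)..1, θ i s = 0 := by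
    intro i
    have h1 : IntervalIntegrable ((j ⁻¹' {i}).indicator (fun _ => (1 : ℝ))) volume 0 1 := by
      refine (intervalIntegrable_const (c := (1 : ℝ))).mono_fun
        (measurable_const.indicator (hjm i)).aestronglyMeasurable (ae_of_all _ fun s => ?_)
      simp only [indicator]
      split_ifs <;> simp
    simp only [θ]
    rw [intervalIntegral.integral_sub h1 intervalIntegrable_const, hji i]
    simp
  have hev := eventually_all.2 fun i => eventually_norm_integral_periodic_smul_le (hθm i) (hθb i)
    (hθp i) (hθ0 i) hT (hH i) (show 0 < ε / n by positivity)
  obtain ⟨N, hN⟩ := hev.exists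
  have hιm : Measurable fun s : ℝ => j (N * s) := hj.comp (measurable_const_mul _)
  have hsum : ∀ s, H (j (N * s)) s
      = ∑ i, ((fun s : ℝ => j (N * s)) ⁻¹' {i}).indicator (H i) s := by
    intro s
    rw [Finset.sum_eq_single (j (N * s))]
    · rw [indicator_of_mem (by simp)]
    · intro i _ hi
      rw [indicator_of_notMem (by simpa using hi.symm)]
    · simp
  have hint : ∀ i, IntegrableOn (((fun s : ℝ => j (N * s)) ⁻¹' {i}).indicator (H i)) (Icc 0 T) :=
    fun i => (hH i).indicator (hιm (measurableSet_singleton i))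
  refine ⟨fun s => j (N * s), hιm, ?_, fun t ht => ?_⟩
  · simp only [hsum]
    exact integrable_finsetSum _ fun i _ => hint i
  have hpt : ∀ s, H (j (N * s)) s - ∑ i, q i • H i s = ∑ i, θ i (N * s) • H i s := by
    intro s
    rw [hsum, ← Finset.sum_sub_distrib]
    refine Finset.sum_congr rfl fun i _ => ?_
    simp only [θ, sub_smul, indicator, mem_preimage]
    split_ifs <;> simp
  simp only [hpt]
  rw [intervalIntegral.integral_finsetSum]
  · calc _ ≤ ∑ i : Fin n, ε / n := norm_sum_le_of_le _ fun i _ => hN i t ht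
      _ = ε := by
        rw [Finset.sum_const, Finset.card_univ, Fintype.card_fin, nsmul_eq_mul]
        field_simp
  · intro i _
    have h1 : IntegrableOn (fun s => θ i (N * s) • H i s) (Icc 0 T) := by
      refine (hH i).norm.mono' (((hθm i).comp
        (measurable_const_mul (N : ℝ))).aestronglyMeasurable.smul (hH i).aestronglyMeasurable)
        (ae_of_all _ fun s => ?_)
      rw [norm_smul, Real.norm_eq_abs]
      exact mul_le_of_le_one_left (norm_nonneg _) (hθb i _)
    exact intervalIntegrable_of_integrableOn h1 le_rfl ht.1 ht.2

end Chattering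

/-! ### Ekeland's variational principle. -/

section Ekeland

/-- Ekeland's variational principle for a Lipschitz function. -/
theorem exists_ekeland {Y : Type*} {d : Y → Y → ℝ} (hd0 : ∀ y y', 0 ≤ d y y')
    (hdy : ∀ y, d y y = 0) (hd3 : ∀ x y z, d x z ≤ d x y + d y z)
    (hc : ∀ y : ℕ → Y, Summable (fun n => d (y n) (y (n + 1))) →
      ∃ y', Tendsto (fun n => d (y n) y') atTop (𝓝 0))
    {F : Y → ℝ} (hF0 : ∀ y, 0 ≤ F y) {K : ℝ} (hFK : ∀ y y', |F y - F y'| ≤ K * d y y') {κ : ℝ}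
    (hκ : 0 < κ) (y₀ : Y) :
    ∃ y, κ * d y₀ y ≤ F y₀ - F y ∧ ∀ y', F y - κ * d y y' ≤ F y' := by
  -- The points reached from y by a descent of slope at least κ; the triangle inequality makes these
  -- sets nested along the construction.
  let S : Y → Set Y := fun y => {y' | κ * d y y' ≤ F y - F y'}
  have hself : ∀ y, y ∈ S y := fun y => by simp [S, hdy]
  have htrans : ∀ {x y z}, y ∈ S x → z ∈ S y → z ∈ S x := by
    intro x y z h1 h2
    simp only [S, mem_ofPred_eq] at *
    nlinarith [hd3 x y z]
  have hbdd : ∀ y, BddBelow (F '' S y) := fun y => ⟨0, by rintro _ ⟨y', _, rfl⟩; exact hF0 y'⟩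
  -- Every step realises at least half of the decrease still possible within S y.
  have hstep : ∀ y, ∃ y' ∈ S y, 2 * F y' ≤ F y + sInf (F '' S y) := by
    intro y
    have hle : sInf (F '' S y) ≤ F y := csInf_le (hbdd y) ⟨y, hself y, rfl⟩
    rcases hle.eq_or_lt with h | h
    · exact ⟨y, hself y, by rw [h]; linarith⟩
    · obtain ⟨_, ⟨y', hy', rfl⟩, hlt⟩ :=
        exists_lt_of_csInf_lt (s := F '' S y) ⟨F y, y, hself y, rfl⟩
        (show sInf (F '' S y) < (F y + sInf (F '' S y)) / 2 by linarith)
      exact ⟨y', hy', by linarith⟩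
  choose next hnext hnext' using hstep
  let y : ℕ → Y := fun n => next^[n] y₀
  have hy : ∀ n, y (n + 1) = next (y n) := fun n => Function.iterate_succ_apply' next n y₀
  have hyS : ∀ n, y (n + 1) ∈ S (y n) := fun n => by rw [hy]; exact hnext _
  have hmem : ∀ n m, n ≤ m → y m ∈ S (y n) := by
    intro n m h
    induction m, h using Nat.le_induction with
    | base => exact hself _
    | succ m _ ih => exact htrans ih (hyS m)
  have hanti : Antitone fun n => F (y n) := antitone_nat_of_succ_le fun n => by
    have h1 : κ * d (y n) (y (n + 1)) ≤ F (y n) - F (y (n + 1)) := hyS n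
    have := mul_nonneg hκ.le (hd0 (y n) (y (n + 1)))
    linarith
  have hsum : Summable fun n => d (y n) (y (n + 1)) := by
    refine summable_of_sum_range_le (c := F y₀ / κ) (fun n => hd0 _ _) fun n => ?_
    rw [le_div_iff₀ hκ, Finset.sum_mul]
    have h1 : ∑ i ∈ Finset.range n, d (y i) (y (i + 1)) * κ
        ≤ ∑ i ∈ Finset.range n, (F (y i) - F (y (i + 1))) :=
      Finset.sum_le_sum fun i _ => by rw [mul_comm]; exact hyS i
    rw [Finset.sum_range_sub'] at h1
    have h2 : y 0 = y₀ := rfl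
    rw [h2] at h1
    linarith [hF0 (y n)]
  obtain ⟨y', hy'⟩ := hc y hsum
  have hFlim : Tendsto (fun n => F (y n)) atTop (𝓝 (F y')) := by
    rw [tendsto_iff_norm_sub_tendsto_zero]
    refine squeeze_zero (fun _ => norm_nonneg _) (fun n => hFK (y n) y') ?_
    simpa using hy'.const_mul K
  have hyS' : ∀ n, y' ∈ S (y n) := by
    intro n
    have l1 : Tendsto (fun m => F (y n) - F (y m) + κ * d (y m) y') atTop
        (𝓝 (F (y n) - F y' + κ * 0)) := (tendsto_const_nhds.sub hFlim).add (hy'.const_mul κ)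
    rw [mul_zero, add_zero] at l1
    refine ge_of_tendsto l1 ?_
    filter_upwards [eventually_ge_atTop n] with m hm
    have h1 : κ * d (y n) (y m) ≤ F (y n) - F (y m) := hmem n m hm
    nlinarith [hd3 (y n) (y m) y']
  refine ⟨y', hyS' 0, fun y'' => ?_⟩
  by_contra! hlt
  have hin : y'' ∈ S y' := by simp only [S, mem_ofPred_eq]; linarith
  -- A violating y'' lies in every S (y n), so the half-decrease rule bounds F y'' from below; in
  -- the limit F y' ≤ F y'', contradicting the violation.
  have hge : ∀ n, 2 * F (y (n + 1)) - F (y n) ≤ F y'' := by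
    intro n
    have h1 : sInf (F '' S (y n)) ≤ F y'' := csInf_le (hbdd _) ⟨y'', htrans (hyS' n) hin, rfl⟩
    have h2 := hnext' (y n)
    rw [← hy] at h2
    linarith
  have l2 : Tendsto (fun n => 2 * F (y (n + 1)) - F (y n)) atTop (𝓝 (2 * F y' - F y')) :=
    ((hFlim.comp (tendsto_add_atTop_nat 1)).const_mul 2).sub hFlim
  have h3 := le_of_tendsto' l2 hge
  have := mul_nonneg hκ.le (hd0 y' y'')
  linarith

end Ekeland

/-! ### The complete space of controls, with the h-measure of the set of disagreement. -/

section ControlDistance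

variable {U : Type*} {T : ℝ} {h : ℝ → ℝ}

/-- The measure on `[0, T]` with density `h`. -/
noncomputable def timeMeasure (T : ℝ) (h : ℝ → ℝ) : Measure ℝ :=
  (volume.restrict (Icc 0 T)).withDensity fun t => ENNReal.ofReal (h t)

/-- The size of the set of times where two controls differ. -/
noncomputable def controlDist (T : ℝ) (h : ℝ → ℝ) (w w' : ℝ → U) : ℝ :=
  (timeMeasure T h).real {t | w t ≠ w' t}

theorem isFiniteMeasure_timeMeasure (hh : IntegrableOn h (Icc 0 T)) :
    IsFiniteMeasure (timeMeasure T h) :=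
  isFiniteMeasure_withDensity_ofReal hh.2

theorem controlDist_nonneg (w w' : ℝ → U) : 0 ≤ controlDist T h w w' := measureReal_nonneg

theorem controlDist_self (w : ℝ → U) : controlDist T h w w = 0 := by
  simp [controlDist]

theorem controlDist_triangle (hh : IntegrableOn h (Icc 0 T)) (w₁ w₂ w₃ : ℝ → U) :
    controlDist T h w₁ w₃ ≤ controlDist T h w₁ w₂ + controlDist T h w₂ w₃ := by
  have := isFiniteMeasure_timeMeasure hh
  refine (measureReal_mono ?_).trans (measureReal_union_le _ _)
  intro t ht
  by_contra hcon
  simp only [mem_union, mem_ofPred_eq, not_or, not_not] at hcon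
  exact ht (hcon.1.trans hcon.2)

/-- With h ≥ 1 the null sets of the weighted measure are Lebesgue null on [0, T], so a limit of
controls in the distance is again measurable. -/
theorem restrict_le_timeMeasure (hh1 : ∀ t, 1 ≤ h t) :
    volume.restrict (Icc 0 T) ≤ timeMeasure T h := by
  conv_lhs => rw [← withDensity_one (μ := volume.restrict (Icc (0 : ℝ) T))]
  refine withDensity_mono (ae_of_all _ fun t => ?_)
  simpa using ENNReal.one_le_ofReal.2 (hh1 t)

theorem timeMeasure_apply {s : Set ℝ}
    (hs : NullMeasurableSet s (volume.restrict (Icc 0 T))) :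
    timeMeasure T h s = ∫⁻ t in Icc 0 T, s.indicator (fun t => ENNReal.ofReal (h t)) t := by
  rw [timeMeasure, withDensity_apply₀ _ hs, lintegral_indicator₀ hs]

theorem IsControl.switch [MeasurableSpace U] {n : ℕ} {w : Fin n → ℝ → U}
    (hw : ∀ i, IsControl T (w i)) {ι : ℝ → Fin n} (hι : Measurable ι) : IsControl T fun s => w (ι s) s := by
  refine ⟨fun s => (hw (ι s)).mk _ s, ?_, ?_⟩
  · have : Measurable fun p : Fin n × ℝ => (hw p.1).mk _ p.2 :=
      measurable_from_prod_countable_right fun i => (hw i).measurable_mk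
    exact this.comp (hι.prodMk measurable_id)
  · filter_upwards [ae_all_iff.2 fun i => (hw i).ae_eq_mk] with s hs
    exact hs (ι s)

variable [MetricSpace U] [MeasurableSpace U] [BorelSpace U]

/-- The space of controls is complete. -/
theorem exists_tendsto_controlDist (hh : IntegrableOn h (Icc 0 T)) (hh1 : ∀ t, 1 ≤ h t)
    {w : ℕ → ℝ → U} (hw : ∀ n, IsControl T (w n))
    (hs : Summable fun n => controlDist T h (w n) (w (n + 1))) :
    ∃ w', IsControl T w' ∧ Tendsto (fun n => controlDist T h (w n) w') atTop (𝓝 0) := by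
  have := isFiniteMeasure_timeMeasure hh
  set μ := timeMeasure T h with hμ
  set D : ℕ → Set ℝ := fun n => {t | w n t ≠ w (n + 1) t} with hD
  have hsum : ∑' n, μ (D n) ≠ ⊤ := by
    have h1 : ∀ n, μ (D n) = ENNReal.ofReal (controlDist T h (w n) (w (n + 1))) := fun n => by
      rw [controlDist, ofReal_measureReal]
    simp only [h1]
    rw [← ENNReal.ofReal_tsum_of_nonneg (fun n => controlDist_nonneg _ _) hs]
    exact ENNReal.ofReal_ne_top
  -- Borel–Cantelli: at almost every time the sequence of controls is eventually constant.
  have hae : ∀ᵐ t ∂μ, ∃ N, ∀ n ≥ N, w n t = w (n + 1) t := by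
    have := ae_eventually_notMem hsum
    filter_upwards [this] with t ht
    obtain ⟨N, hN⟩ := eventually_atTop.1 ht
    exact ⟨N, fun n hn => not_not.1 (hN n hn)⟩
  have hconst : ∀ t N, (∀ n ≥ N, w n t = w (n + 1) t) → ∀ n ≥ N, w n t = w N t := by
    intro t N hN n hn
    induction n, hn using Nat.le_induction with
    | base => rfl
    | succ n hn ih => rw [← hN n hn, ih]
  classical
  -- The eventual value; the default `w 0 t` is taken only on a null set.
  let w' : ℝ → U := fun t => if ht : ∃ N, ∀ n ≥ N, w n t = w (n + 1) t then w ht.choose t else w 0 t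
  have hw'eq : ∀ t N, (∀ n ≥ N, w n t = w (n + 1) t) → w' t = w N t := by
    intro t N hN
    have hex : ∃ N, ∀ n ≥ N, w n t = w (n + 1) t := ⟨N, hN⟩
    simp only [w', dif_pos hex]
    have h1 := hconst t _ hex.choose_spec (max N hex.choose) (le_max_right _ _)
    have h2 := hconst t N hN (max N hex.choose) (le_max_left _ _)
    rw [← h1, h2]
  refine ⟨w', ?_, ?_⟩
  · refine aemeasurable_of_tendsto_metrizable_ae atTop hw ?_
    have hac : volume.restrict (Icc 0 T) ≪ μ := (restrict_le_timeMeasure hh1).absolutelyContinuous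
    filter_upwards [hac.ae_le hae] with t ⟨N, hN⟩
    refine tendsto_const_nhds.congr' ?_
    filter_upwards [eventually_ge_atTop N] with n hn
    rw [hw'eq t N hN, hconst t N hN n hn]
  · have hle : ∀ n, μ {t | w n t ≠ w' t} ≤ ∑' k, μ (D (k + n)) := by
      intro n
      refine le_trans (measure_mono_ae ?_) (measure_iUnion_le _)
      filter_upwards [hae] with t ⟨N, hN⟩ ht
      by_contra hcon
      refine ht ?_
      have hn : ∀ m ≥ n, w m t = w (m + 1) t := by
        intro m hm
        by_contra hne
        refine hcon (mem_iUnion.2 ⟨m - n, ?_⟩)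
        simp only [hD, mem_ofPred_eq, Nat.sub_add_cancel hm]
        exact hne
      exact (hw'eq t n hn).symm
    have h0 := ENNReal.tendsto_sum_nat_add (fun n => μ (D n)) hsum
    have h1 : Tendsto (fun n => μ {t | w n t ≠ w' t}) atTop (𝓝 0) :=
      tendsto_of_tendsto_of_tendsto_of_le_of_le tendsto_const_nhds h0 (fun _ => zero_le) hle
    exact (ENNReal.tendsto_toReal ENNReal.zero_ne_top).comp h1

variable [TopologicalSpace.SeparableSpace U]

theorem IsControl.nullMeasurableSet_ne {w w' : ℝ → U} (hw : IsControl T w) (hw' : IsControl T w') :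
    NullMeasurableSet {t | w t ≠ w' t} (volume.restrict (Icc 0 T)) := by
  have : SecondCountableTopology U := UniformSpace.secondCountable_of_separable U
  exact (AEStronglyMeasurable.nullMeasurableSet_eq_fun hw.aestronglyMeasurable
    hw'.aestronglyMeasurable).compl

theorem lintegral_le_controlDist (hh : IntegrableOn h (Icc 0 T)) {w w' : ℝ → U}
    (hw : IsControl T w) (hw' : IsControl T w') :
    ∫⁻ t in Icc 0 T, {t | w t ≠ w' t}.indicator (fun t => ENNReal.ofReal (h t)) t
      = ENNReal.ofReal (controlDist T h w w') := by
  have := isFiniteMeasure_timeMeasure hh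
  rw [← timeMeasure_apply (hw.nullMeasurableSet_ne hw'), controlDist, ofReal_measureReal]

/-- This is why the distance is weighted by h: a difference of fields bounded by a multiple of h on
the set of disagreement integrates to a multiple of the distance. -/
theorem norm_integral_le_controlDist {E : Type*} [NormedAddCommGroup E] [NormedSpace ℝ E]
    (hh : IntegrableOn h (Icc 0 T)) {w w' : ℝ → U}
    (hw : IsControl T w) (hw' : IsControl T w') {F : ℝ → E} {c : ℝ} (hc : 0 ≤ c)
    (hF : ∀ᵐ t ∂volume.restrict (Icc 0 T), ‖F t‖ ≤ c * {t | w t ≠ w' t}.indicator h t) {t : ℝ}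
    (ht : t ∈ Icc 0 T) : ‖∫ s in (0 : ℝ)..t, F s‖ ≤ c * controlDist T h w w' := by
  rw [intervalIntegral.integral_of_le ht.1]
  have h1 : ∫⁻ s in Ioc 0 t, ‖F s‖ₑ ≤ ENNReal.ofReal (c * controlDist T h w w') := by
    rw [ENNReal.ofReal_mul hc, ← lintegral_le_controlDist hh hw hw',
      ← lintegral_const_mul' _ _ ENNReal.ofReal_ne_top]
    refine (lintegral_mono_set (Ioc_subset_Icc_self.trans (Icc_subset_Icc le_rfl ht.2))).trans ?_
    refine lintegral_mono_ae (hF.mono fun s hs => ?_)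
    rw [← ofReal_norm]
    refine (ENNReal.ofReal_le_ofReal hs).trans (le_of_eq ?_)
    rw [ENNReal.ofReal_mul hc]
    congr 1
    by_cases hs' : s ∈ {t | w t ≠ w' t}
    · rw [indicator_of_mem hs', indicator_of_mem hs']
    · rw [indicator_of_notMem hs', indicator_of_notMem hs', ENNReal.ofReal_zero]
  refine (norm_integral_le_lintegral_norm _).trans ?_
  refine ENNReal.toReal_le_of_le_ofReal (mul_nonneg hc (controlDist_nonneg w w')) ?_
  simpa only [ofReal_norm] using h1

end ControlDistance

/-! ### Approximation of relaxed trajectories by ordinary ones. -/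

section ControlledTrajectories

variable {E : Type*} [NormedAddCommGroup E] [NormedSpace ℝ E]
  {U : Type*} [MeasurableSpace U]
  {T : ℝ} {x₀ : E} {δ : ℝ} {h : ℝ → ℝ} {G : ℝ → E → U → E}

/-- Control systems of class `C^{1,1}` on a ball, uniformly in the control. -/
structure IsC11Control (T : ℝ) (x₀ : E) (δ : ℝ) (h : ℝ → ℝ) (G : ℝ → E → U → E) : Prop where
  reg : ∀ᵐ t ∂volume.restrict (Icc 0 T), ∀ u : U,
    C11On (h t) (fun x => G t x u) (Metric.ball x₀ δ)
  meas : ∀ w : ℝ → U, IsControl T w → ∀ x ∈ Metric.ball x₀ δ,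
    AEStronglyMeasurable (fun t => G t x (w t)) (volume.restrict (Icc 0 T))

theorem IsC11Control.field (hG : IsC11Control T x₀ δ h G) {w : ℝ → U} (hw : IsControl T w) :
    IsC11Field T x₀ δ h fun t x => G t x (w t) :=
  ⟨hG.reg.mono fun t ht => ht (w t), fun x hx => hG.meas w hw x hx⟩

theorem IsC11Control.mixField (hG : IsC11Control T x₀ δ h G) {n : ℕ} {p : Fin n → ℝ}
    (hp : ∀ i, 0 ≤ p i) (hp1 : ∑ i, p i = 1) {w : Fin n → ℝ → U} (hw : ∀ i, IsControl T (w i)) :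
    IsC11Field T x₀ δ h fun t x => ∑ i, p i • G t x (w i t) := by
  refine ⟨hG.reg.mono fun t ht => C11On.convexSum hp hp1 fun i => ht (w i t), fun x hx => ?_⟩
  exact Finset.aestronglyMeasurable_fun_sum _ fun i _ => (hG.meas (w i) (hw i) x hx).const_smul _

/-- Trajectories of relaxed controls are uniform limits of trajectories of controls. -/
theorem IsC11Control.exists_approx [CompleteSpace E] (hT : 0 ≤ T) (hδ : 0 < δ)
    (hh : IntegrableOn h (Icc 0 T)) (hh0 : ∀ t, 0 ≤ h t) (hG : IsC11Control T x₀ δ h G) {n : ℕ}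
    {p : Fin n → ℝ} (hp : ∀ i, 0 ≤ p i) (hp1 : ∑ i, p i = 1) {v : Fin n → ℝ → U}
    (hv : ∀ i, IsControl T (v i)) {w : ℝ → U} (hw : IsControl T w) {r : ℝ}
    (hr : r ∈ Icc (0 : ℝ) 1) {z : E} {X : ℝ → E}
    (hX : IsTraj T x₀ δ (fun t x => (1 - r) • G t x (w t) + r • ∑ i, p i • G t x (v i t)) z X)
    {ε : ℝ} (hε : 0 < ε) :
    ∃ w', IsControl T w' ∧ controlDist T h w w' ≤ r * (∫ t in (0 : ℝ)..T, h t) + ε ∧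
      ∀ x', IsTraj T x₀ δ (fun t x => G t x (w' t)) z x' → ∀ t ∈ Icc 0 T, ‖X t - x' t‖ ≤ ε := by
  obtain ⟨C, hC, hst⟩ := exists_traj_stability E hT hh hh0
  let q : Fin (n + 1) → ℝ := Fin.cons (1 - r) fun i => r * p i
  let v' : Fin (n + 1) → ℝ → U := Fin.cons w v
  have hv' : ∀ i, IsControl T (v' i) := Fin.cases hw hv
  have hq : ∀ i, 0 ≤ q i := Fin.cases (by simpa [q] using hr.2)
    fun i => by simpa [q] using mul_nonneg hr.1 (hp i)
  have hq1 : ∑ i, q i = 1 := by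
    simp [q, Fin.sum_univ_succ, ← Finset.mul_sum, hp1]
  set π := ballRetract x₀ (δ / 2)
  -- The second component of H records the h-mass of the times when the original control w is
  -- abandoned; its average is r h. One switching law thus controls both the trajectory and the
  -- distance between the controls.
  let c : Fin (n + 1) → ℝ := Fin.cons 0 fun _ => 1
  let H : Fin (n + 1) → ℝ → E × ℝ := fun i s => (G s (π (X s)) (v' i s), c i * h s)
  have hXc := hX.prim.continuousOn
  have hHi : ∀ i, IntegrableOn (H i) (Icc 0 T) := fun i =>
    ((hG.field (hv' i)).integrableOn hT hδ hh hh0 hXc).prodMk (hh.const_mul (c i))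
  obtain ⟨ι, hι, hιi, hιε⟩ := exists_chattering hq hq1 hT hHi (ε := ε / C) (by positivity)
  have hsumi : IntegrableOn (fun s => ∑ i, q i • H i s) (Icc 0 T) :=
    integrable_finsetSum _ fun i _ => (hHi i).smul (q i)
  have hdi : IntegrableOn (fun s => H (ι s) s - ∑ i, q i • H i s) (Icc 0 T) := hιi.sub hsumi
  have hdI : ∀ t ∈ Icc 0 T, IntervalIntegrable (fun s => H (ι s) s - ∑ i, q i • H i s)
      volume 0 t := fun t ht => intervalIntegrable_of_integrableOn hdi le_rfl ht.1 ht.2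
  have hC0 : 0 < C := by linarith
  refine ⟨fun s => v' (ι s) s, IsControl.switch hv' hι, ?_, fun x' hx' t ht => ?_⟩
  · have h1 := (ContinuousLinearMap.snd ℝ E ℝ).intervalIntegral_comp_comm (hdI T ⟨hT, le_rfl⟩)
    have h2 : |∫ s in (0 : ℝ)..T, (c (ι s) * h s - r * h s)| ≤ ε / C := by
      have h3 : ∀ s, (ContinuousLinearMap.snd ℝ E ℝ) (H (ι s) s - ∑ i, q i • H i s)
          = c (ι s) * h s - r * h s := by
        intro s
        simp only [map_sub, map_sum, map_smul, ContinuousLinearMap.coe_snd', H, smul_eq_mul]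
        simp [Fin.sum_univ_succ, q, c, ← Finset.sum_mul, ← Finset.mul_sum, hp1]
      simp only [h3] at h1
      rw [h1]
      exact (norm_snd_le _).trans (hιε T ⟨hT, le_rfl⟩)
    have hci : IntegrableOn (fun s => c (ι s) * h s) (Icc 0 T) := hιi.snd
    have ici := intervalIntegrable_of_integrableOn hci le_rfl hT le_rfl
    have ihi := intervalIntegrable_of_integrableOn hh le_rfl hT le_rfl
    rw [intervalIntegral.integral_sub ici (ihi.const_mul r), intervalIntegral.integral_const_mul,
      abs_le] at h2
    have hεC : ε / C ≤ ε := div_le_self hε.le hC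
    have hms : MeasurableSet {s | ι s ≠ 0} := (hι (measurableSet_singleton 0)).compl
    have hfin := isFiniteMeasure_timeMeasure hh
    have hle : controlDist T h w (fun s => v' (ι s) s) ≤ ∫ s in (0 : ℝ)..T, c (ι s) * h s := by
      refine (measureReal_mono (s₂ := {s | ι s ≠ 0}) fun s hs => ?_).trans (le_of_eq ?_)
      · rintro hs0
        refine hs ?_
        simp only [hs0, v', Fin.cons_zero]
      · rw [measureReal_def, timeMeasure_apply hms.nullMeasurableSet,
          intervalIntegral.integral_of_le hT, ← integral_Icc_eq_integral_Ioc,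
          integral_eq_lintegral_of_nonneg_ae (ae_of_all _ fun s => ?_) hci.1]
        · congr 1
          refine lintegral_congr fun s => ?_
          by_cases hs : ι s = 0
          · rw [indicator_of_notMem (by simpa using hs)]
            simp [hs, c]
          · rw [indicator_of_mem (by simpa using hs)]
            obtain ⟨i, hi⟩ := Fin.exists_succ_eq.2 hs
            simp [← hi, c]
        · refine mul_nonneg ?_ (hh0 s)
          exact Fin.cases (motive := fun i => 0 ≤ c i) (by simp [c]) (fun i => by simp [c]) (ι s)
    linarith
  · have h1 := hst x₀ δ _ _ z z X x' (ε / C) hδ (hG.field (IsControl.switch hv' hι)) hX hx' ?_ t ht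
    · rw [sub_self, norm_zero, zero_add, mul_div_cancel₀ _ hC0.ne'] at h1
      exact h1
    · intro t ht
      have h2 := (ContinuousLinearMap.fst ℝ E ℝ).intervalIntegral_comp_comm (hdI t ht)
      have h3 : ∀ s, (ContinuousLinearMap.fst ℝ E ℝ) (H (ι s) s - ∑ i, q i • H i s)
          = -(((1 - r) • G s (π (X s)) (w s) + r • ∑ i, p i • G s (π (X s)) (v i s))
            - G s (π (X s)) (v' (ι s) s)) := by
        intro s
        simp only [map_sub, map_sum, map_smul, ContinuousLinearMap.coe_fst', H]
        simp [Fin.sum_univ_succ, q, v', mul_smul, ← Finset.smul_sum]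
      simp only [h3, intervalIntegral.integral_neg] at h2
      rw [← norm_neg, h2]
      exact (norm_fst_le _).trans (hιε t ht)

end ControlledTrajectories

/-! ### Lipschitz dependence on the initial point and the control. -/

section ControlledLipschitz

variable {U : Type*} [MetricSpace U] [TopologicalSpace.SeparableSpace U] [MeasurableSpace U]
  [BorelSpace U]

/-- The two fields differ only where the controls differ, and there by at most 2h; the primitive of
the difference is therefore bounded by twice the distance of the controls. -/
theorem exists_traj_lipschitz (E : Type*) [NormedAddCommGroup E] [NormedSpace ℝ E] {T : ℝ}
    {h : ℝ → ℝ} (hT : 0 ≤ T) (hh : IntegrableOn h (Icc 0 T)) (hh0 : ∀ t, 0 ≤ h t) :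
    ∃ C, 1 ≤ C ∧ ∀ (x₀ : E) (δ : ℝ) (G : ℝ → E → U → E), 0 < δ → IsC11Control T x₀ δ h G →
      ∀ (w w' : ℝ → U), IsControl T w → IsControl T w' → ∀ (z z' : E) (x x' : ℝ → E),
      IsTraj T x₀ δ (fun t x => G t x (w t)) z x → IsTraj T x₀ δ (fun t x => G t x (w' t)) z' x' →
      ∀ t ∈ Icc 0 T, ‖x t - x' t‖ ≤ C * (‖z - z'‖ + controlDist T h w w') := by
  obtain ⟨C, hC, hst⟩ := exists_traj_stability E hT hh hh0
  refine ⟨2 * C, by linarith, fun x₀ δ G hδ hG w w' hw hw' z z' x x' hx hx' t ht => ?_⟩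
  have h1 := hst x₀ δ _ _ z z' x x' (2 * controlDist T h w w') hδ (hG.field hw') hx hx' ?_ t ht
  · refine h1.trans ?_
    nlinarith [norm_nonneg (z - z'), controlDist_nonneg (T := T) (h := h) w w']
  · intro t ht
    refine norm_integral_le_controlDist hh hw hw' zero_le_two ?_ ht
    filter_upwards [hG.reg] with s hs
    by_cases hne : w s = w' s
    · rw [hne, sub_self, norm_zero, indicator_of_notMem (by simpa using hne), mul_zero]
    · rw [indicator_of_mem (by simpa using hne), two_mul]
      have hb := ballRetract_mem_ball (x₀ := x₀) hδ (x s)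
      exact (norm_sub_le _ _).trans (add_le_add ((hs (w s)).bound _ hb) ((hs (w' s)).bound _ hb))

end ControlledLipschitz

/-- Consider the first time the distance reaches r: up to it the distance is at most r, so the
hypothesis makes it smaller than r there, a contradiction. -/
theorem norm_lt_of_bootstrap {E : Type*} [NormedAddCommGroup E] {x : ℝ → E} {x₀ : E} {T r : ℝ}
    (hx : ContinuousOn x (Icc 0 T)) (h0 : ‖x 0 - x₀‖ < r)
    (h : ∀ e ∈ Icc 0 T, (∀ t ∈ Icc 0 e, ‖x t - x₀‖ ≤ r) → ‖x e - x₀‖ < r) :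
    ∀ t ∈ Icc 0 T, ‖x t - x₀‖ < r := by
  by_contra! hcon
  obtain ⟨t₁, ht₁, hr₁⟩ := hcon
  have hc : ContinuousOn (fun t => ‖x t - x₀‖) (Icc 0 T) := (hx.sub continuousOn_const).norm
  have hA : IsCompact (Icc 0 T ∩ (fun t => ‖x t - x₀‖) ⁻¹' Ici r) :=
    isCompact_Icc.of_isClosed_subset (hc.preimage_isClosed_of_isClosed isClosed_Icc isClosed_Ici)
      inter_subset_left
  obtain ⟨e, ⟨he, her⟩, hmin⟩ := hA.exists_isLeast ⟨t₁, ht₁, hr₁⟩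
  have hlt : ∀ t ∈ Ico 0 e, ‖x t - x₀‖ < r := by
    intro t ht
    by_contra! hge
    exact absurd (hmin ⟨⟨ht.1, ht.2.le.trans he.2⟩, hge⟩) (not_le.2 ht.2)
  have he0 : 0 < e := by
    rcases he.1.eq_or_lt with h' | h'
    · rw [← h'] at her
      exact absurd h0 (not_lt.2 her)
    · exact h'
  have hle : ‖x e - x₀‖ ≤ r := by
    have hcw : Tendsto (fun t => ‖x t - x₀‖) (𝓝[Ico 0 e] e) (𝓝 ‖x e - x₀‖) :=
      (hc e he).mono fun t ht => ⟨ht.1, ht.2.le.trans he.2⟩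
    have : (𝓝[Ico 0 e] e).NeBot := by
      rw [nhdsWithin_Ico_eq_nhdsLT he0]; infer_instance
    refine le_of_tendsto hcw ?_
    filter_upwards [self_mem_nhdsWithin] with t ht
    exact (hlt t ht).le
  refine absurd (h e he fun t ht => ?_) (not_lt.2 her)
  rcases ht.2.eq_or_lt with h' | h'
  · rw [h']; exact hle
  · exact (hlt t ⟨ht.1, h'⟩).le

/-! ### Correspondence between trajectories in the tube and trajectories on M. -/

section Link

variable {E : Type*} [NormedAddCommGroup E] [NormedSpace ℝ E]
  {M : Type*} [TopologicalSpace M] [ChartedSpace E M] {U : Type*}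
  {T : ℝ} {qs : ℝ → M} {L : LagrangianChart E T qs} {f : ControlSystem E M U} {δ : ℝ} {h : ℝ → ℝ}

theorem TubeOn.isC11Control [MeasurableSpace U] (H : TubeOn L f 0 T δ h) :
    IsC11Control T (L.φ (qs 0)) δ h (L.g f) := ⟨H.reg, H.meas⟩

theorem LagrangianChart.ψinv_zero (L : LagrangianChart E T qs) {x : E} (hx : x ∈ L.φ.target) :
    L.ψinv 0 x = L.φ.symm x :=
  L.P_zero (L.φ.map_target hx)

theorem LagrangianChart.ψ_base [T2Space M] (L : LagrangianChart E T qs) {t : ℝ} (ht : t ∈ Icc 0 T) :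
    L.ψ t (qs t) = L.φ (qs 0) := by
  rw [← L.P_base ht, L.ψ_P ht L.base_mem]

theorem controlField_eq_mix (f : ControlSystem E M U) (w : ℝ → U) :
    controlField f w = mix f (fun _ : Fin 1 => 1) fun _ => w := by
  funext t q
  simp [controlField, mix]

theorem IsTraj.isPrim {x₀ : E} {W : ℝ → E → E} {z : E} {x : ℝ → E} (hx : IsTraj T x₀ δ W z x)
    {e : ℝ} (he : e ≤ T) (hb : ∀ t ∈ Icc 0 e, ‖x t - x₀‖ ≤ δ / 2) :
    IsPrim x (fun t => W t (x t)) 0 e := by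
  refine (hx.prim.mono le_rfl he).congr (fun _ _ => rfl) ?_
  filter_upwards [ae_restrict_mem measurableSet_Icc] with t ht
  rw [ballRetract_of_le (hb t ht)]

theorem rho_self (L : LagrangianChart E T qs) (f : ControlSystem E M U) (p : M × (ℝ → U)) :
    L.rho f p p = 0 := by
  simp only [LagrangianChart.rho, sub_self, ← ofReal_norm, norm_zero, ENNReal.ofReal_zero,
    lintegral_zero, add_zero]

variable [MeasurableSpace U]

/-- The uniqueness part of the tube property makes the choice of a solution in `solution`
immaterial. -/
theorem TubeOn.solution_mix (hT : 0 ≤ T) (H : TubeOn L f 0 T δ h)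
    (hball : Metric.ball (L.φ (qs 0)) δ ⊆ L.φ.target) {n : ℕ} {p : Fin n → ℝ} {w : Fin n → ℝ → U}
    (hp : ∀ i, 0 ≤ p i) (hp1 : ∑ i, p i = 1) (hw : ∀ i, IsControl T (w i)) {x : ℝ → E}
    (hx : ∀ t ∈ Icc 0 T, x t ∈ Metric.ball (L.φ (qs 0)) δ)
    (hprim : IsPrim x (fun t => ∑ i, p i • L.g f t (x t) (w i t)) 0 T) :
    (∃ c, IsACSolution (mix f p w) T (L.φ.symm (x 0)) c) ∧
      ∀ t ∈ Icc 0 T, solution (mix f p w) T (L.φ.symm (x 0)) t = L.ψinv t (x t) := by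
  obtain ⟨h1, h2⟩ := H.sol p w hp hp1 hw T ⟨hT, le_rfl⟩ x hx hprim
  have h0 : L.ψinv 0 (x 0) = L.φ.symm (x 0) := L.ψinv_zero (hball (hx 0 ⟨le_rfl, hT⟩))
  have hex : ∃ c, IsACSolution (mix f p w) T (L.φ.symm (x 0)) c := by
    have := h1.isACSolution
    rw [h0] at this
    exact ⟨_, this⟩
  have hs := isACSolution_solution hex
  exact ⟨hex, h2 _ hs.isACOn (by rw [hs.initial, h0])⟩

/-- Trajectories in Lagrangian coordinates are trajectories on the manifold. -/
theorem TubeOn.traj_eq [T2Space M] (hT : 0 ≤ T) (hδ : 0 < δ) (H : TubeOn L f 0 T δ h)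
    (hball : Metric.ball (L.φ (qs 0)) δ ⊆ L.φ.target) {w : ℝ → U} (hw : IsControl T w) {z : E}
    {x : ℝ → E} (hx : IsTraj T (L.φ (qs 0)) δ (fun t x => L.g f t x (w t)) z x)
    (hb : ∀ t ∈ Icc 0 T, ‖x t - L.φ (qs 0)‖ ≤ δ / 2) :
    (∃ c, IsACSolution (controlField f w) T (L.φ.symm z) c) ∧
      ∀ t ∈ Icc 0 T, traj f T (L.φ.symm z) w t = L.ψinv t (x t) ∧ L.x f (L.φ.symm z) w t = x t := by
  have hin : ∀ t ∈ Icc 0 T, x t ∈ Metric.ball (L.φ (qs 0)) δ := fun t ht => by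
    rw [Metric.mem_ball, dist_eq_norm]; linarith [hb t ht]
  have h1 := H.solution_mix hT hball (p := fun _ : Fin 1 => 1) (w := fun _ => w)
    (fun _ => zero_le_one) (by simp) (fun _ => hw) hin
    ((hx.isPrim le_rfl hb).congr (fun _ _ => rfl) (ae_of_all _ fun t => by simp))
  rw [← controlField_eq_mix, hx.initial] at h1
  refine ⟨h1.1, fun t ht => ⟨h1.2 t ht, ?_⟩⟩
  unfold LagrangianChart.x traj
  rw [h1.2 t ht, L.ψ_ψinv ht (hball (hin t ht))]

/-- The control (1 − r)δ_w + rν is itself a mixture, of w with weight 1 − r and the controls of ν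
with weights rνᵢ. -/
theorem TubeOn.relaxedTraj_eq [T2Space M] (hT : 0 ≤ T) (hδ : 0 < δ) (H : TubeOn L f 0 T δ h)
    (hball : Metric.ball (L.φ (qs 0)) δ ⊆ L.φ.target) {w : ℝ → U} (hw : IsControl T w)
    (ν : RelaxedControl U T) {r : ℝ} (hr : r ∈ Icc (0 : ℝ) 1) {z : E} {x : ℝ → E}
    (hx : IsTraj T (L.φ (qs 0)) δ (fun t x => (1 - r) • L.g f t x (w t)
      + r • ∑ i, ν.weight i • L.g f t x (ν.control i t)) z x)
    (hb : ∀ t ∈ Icc 0 T, ‖x t - L.φ (qs 0)‖ ≤ δ / 2) :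
    L.ψ T (relaxedTraj f (L.φ.symm z) w ν r T) = x T := by
  have hin : ∀ t ∈ Icc 0 T, x t ∈ Metric.ball (L.φ (qs 0)) δ := fun t ht => by
    rw [Metric.mem_ball, dist_eq_norm]; linarith [hb t ht]
  let q : Fin (ν.n + 1) → ℝ := Fin.cons (1 - r) fun i => r * ν.weight i
  let v : Fin (ν.n + 1) → ℝ → U := Fin.cons w ν.control
  have hq : ∀ i, 0 ≤ q i := Fin.cases (by simpa [q] using hr.2)
    fun i => by simpa [q] using mul_nonneg hr.1 (ν.weight_nonneg i)
  have hq1 : ∑ i, q i = 1 := by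
    simp [q, Fin.sum_univ_succ, ← Finset.mul_sum, ν.weight_sum]
  have hfield : (fun t p => (1 - r) • controlField f w t p + r • relaxedField f ν t p)
      = mix f q v := by
    funext t p
    simp [mix, controlField, relaxedField, q, v, Fin.sum_univ_succ, Finset.smul_sum, mul_smul]
  have h1 := H.solution_mix hT hball (p := q) (w := v) hq hq1 (Fin.cases hw ν.isControl) hin
    ((hx.isPrim le_rfl hb).congr (fun _ _ => rfl) (ae_of_all _ fun t => by
      simp [q, v, Fin.sum_univ_succ, Finset.smul_sum, mul_smul]))
  rw [hx.initial] at h1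
  have hTT : T ∈ Icc 0 T := ⟨hT, le_rfl⟩
  unfold relaxedTraj
  rw [hfield, h1.2 T hTT, L.ψ_ψinv hTT (hball (hin T hTT))]

/-- Goes from M to the tube on initial intervals [0, e] where the cut-off is inactive, which is what
the bootstrap needs. -/
theorem TubeOn.eq_of_isACSolution [T2Space M] (hδ : 0 < δ) (H : TubeOn L f 0 T δ h)
    (hball : Metric.ball (L.φ (qs 0)) δ ⊆ L.φ.target) {w : ℝ → U} (hw : IsControl T w) {q : M}
    (hq : q ∈ L.φ.source) {c : ℝ → M} (hc : IsACSolution (controlField f w) T q c) {x : ℝ → E}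
    (hx : IsTraj T (L.φ (qs 0)) δ (fun t x => L.g f t x (w t)) (L.φ q) x) {e : ℝ}
    (he : e ∈ Icc 0 T) (hb : ∀ t ∈ Icc 0 e, ‖x t - L.φ (qs 0)‖ ≤ δ / 2) :
    ∀ t ∈ Icc 0 e, L.ψ t (c t) = x t := by
  have hin : ∀ t ∈ Icc 0 e, x t ∈ Metric.ball (L.φ (qs 0)) δ := fun t ht => by
    rw [Metric.mem_ball, dist_eq_norm]; linarith [hb t ht]
  have hsol := (H.sol (fun _ : Fin 1 => 1) (fun _ => w) (fun _ => zero_le_one) (by simp)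
    (fun _ => hw) e he x hin
    ((hx.isPrim he.2 hb).congr (fun _ _ => rfl) (ae_of_all _ fun t => by simp))).2
  rw [← controlField_eq_mix] at hsol
  intro t ht
  rw [hsol c (hc.isACOn.mono le_rfl he.2) ?_ t ht,
    L.ψ_ψinv ⟨ht.1, ht.2.trans he.2⟩ (hball (hin t ht))]
  rw [hc.initial, hx.initial, L.ψinv_zero (L.φ.map_source hq), L.φ.left_inv hq]

/-- In Lagrangian coordinates the reference trajectory is constant. -/
theorem TubeOn.isTraj_base [CompleteSpace E] [T2Space M] (hT : 0 ≤ T) (hδ : 0 < δ)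
    (hh : IntegrableOn h (Icc 0 T))
    (hh0 : ∀ t, 0 ≤ h t) (H : TubeOn L f 0 T δ h)
    (hball : Metric.ball (L.φ (qs 0)) δ ⊆ L.φ.target) {u : ℝ → U} (hu : IsControl T u)
    (hqs : IsACSolution (controlField f u) T (qs 0) qs) :
    IsTraj T (L.φ (qs 0)) δ (fun t x => L.g f t x (u t)) (L.φ (qs 0)) fun _ => L.φ (qs 0) := by
  obtain ⟨x, hx⟩ := (H.isC11Control.field hu).exists_isTraj hT hδ hh hh0 (L.φ (qs 0))
  have heq : ∀ e ∈ Icc 0 T, (∀ t ∈ Icc 0 e, ‖x t - L.φ (qs 0)‖ ≤ δ / 2) →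
      x e = L.φ (qs 0) := by
    intro e he hb
    rw [← H.eq_of_isACSolution hδ hball hu L.base_mem hqs hx he hb e ⟨he.1, le_rfl⟩, L.ψ_base he]
  have hb := norm_lt_of_bootstrap (r := δ / 2) hx.prim.continuousOn
    (by rw [hx.initial, sub_self, norm_zero]; positivity) fun e he hb => by
      rw [heq e he hb, sub_self, norm_zero]; positivity
  have hconst : ∀ t ∈ Icc 0 T, x t = L.φ (qs 0) := fun t ht =>
    heq t ht fun s hs => (hb s ⟨hs.1, hs.2.trans ht.2⟩).le
  refine ⟨rfl, hx.prim.congr (fun t ht => (hconst t ht).symm) ?_⟩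
  filter_upwards [ae_restrict_mem measurableSet_Icc] with t ht
  rw [hconst t ht]

/-- Pairs which are close to the reference pair have trajectories in the tube. -/
theorem TubeOn.norm_lt_of_rho_lt [CompleteSpace E] [T2Space M] (hT : 0 ≤ T) (hδ : 0 < δ)
    (hh : IntegrableOn h (Icc 0 T))
    (hh0 : ∀ t, 0 ≤ h t) (H : TubeOn L f 0 T δ h)
    (hball : Metric.ball (L.φ (qs 0)) δ ⊆ L.φ.target) {u : ℝ → U} (hu : IsControl T u)
    (hqs : IsACSolution (controlField f u) T (qs 0) qs) (htraj : traj f T (qs 0) u = qs) {q : M}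
    {w : ℝ → U} (hq : q ∈ L.φ.source) (hw : IsControl T w)
    (hex : ∃ c, IsACSolution (controlField f w) T q c) {ε : ℝ} (hεδ : ε ≤ δ / 2)
    (hρ : L.rho f (qs 0, u) (q, w) < ENNReal.ofReal ε) {x : ℝ → E}
    (hx : IsTraj T (L.φ (qs 0)) δ (fun t x => L.g f t x (w t)) (L.φ q) x) :
    ∀ t ∈ Icc 0 T, ‖x t - L.φ (qs 0)‖ < ε := by
  have hlt : ∀ v : E, ‖v‖ₑ ≤ L.rho f (qs 0, u) (q, w) → ‖v‖ < ε := by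
    intro v hv
    have h1 := hv.trans_lt hρ
    rw [← ofReal_norm] at h1
    exact (ENNReal.ofReal_lt_ofReal_iff_of_nonneg (norm_nonneg v)).1 h1
  have hbase := H.isTraj_base hT hδ hh hh0 hball hu hqs
  have hbp : IsPrim (fun _ => L.φ (qs 0)) (fun t => L.g f t (L.φ (qs 0)) (u t)) 0 T :=
    hbase.isPrim le_rfl fun t _ => by rw [sub_self, norm_zero]; positivity
  refine norm_lt_of_bootstrap hx.prim.continuousOn ?_ fun e he hb => ?_
  · rw [hx.initial]
    refine hlt _ ?_
    unfold LagrangianChart.rho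
    rw [enorm_sub_rev]
    exact le_add_right (le_add_right le_rfl)
  have hb' : ∀ t ∈ Icc 0 e, ‖x t - L.φ (qs 0)‖ ≤ δ / 2 := fun t ht => (hb t ht).trans hεδ
  have heq := H.eq_of_isACSolution hδ hball hw hq (isACSolution_solution hex) hx he hb'
  have hp : x e - L.φ (qs 0) - (x 0 - L.φ (qs 0)) = ∫ t in (0 : ℝ)..e,
      (L.g f t (x t) (w t) - L.g f t (L.φ (qs 0)) (u t)) :=
    ((hx.isPrim he.2 hb').subFun (hbp.mono le_rfl he.2)).sub 0 e le_rfl he.1 le_rfl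
  rw [hx.initial] at hp
  refine hlt _ ?_
  -- As the reference trajectory is constant in these coordinates, the displacement is the initial
  -- difference plus an integrated difference of velocities; these are the first two terms of ρ.
  have e1 : x e - L.φ (qs 0) = -(L.φ (qs 0) - L.φ q)
      + ∫ t in (0 : ℝ)..e, (L.g f t (x t) (w t) - L.g f t (L.φ (qs 0)) (u t)) := by
    rw [← hp]; abel
  rw [e1]
  refine (enorm_add_le _ _).trans ?_
  rw [enorm_neg]
  unfold LagrangianChart.rho
  refine le_add_right (add_le_add le_rfl ?_)
  rw [intervalIntegral.integral_of_le he.1, ← integral_Icc_eq_integral_Ioc]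
  refine (enorm_integral_le_lintegral_enorm _).trans ?_
  have hsub : Icc 0 e ⊆ Icc 0 T := Icc_subset_Icc le_rfl he.2
  refine le_trans (le_of_eq ?_) (lintegral_mono_set hsub)
  refine setLIntegral_congr_fun measurableSet_Icc fun t ht => ?_
  have e2 : L.x f q w t = x t := heq t ht
  have e3 : L.x f (qs 0) u t = L.φ (qs 0) := by
    unfold LagrangianChart.x
    rw [htraj, L.ψ_base (hsub ht)]
  simp only [e2, e3]
  rw [enorm_sub_rev]

end Link

/-! ### Comparison of ρ with the distance of pairs. -/

section RhoBound

variable {E : Type*} [NormedAddCommGroup E] [NormedSpace ℝ E]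
  {M : Type*} [TopologicalSpace M] [ChartedSpace E M] {U : Type*}
  [MetricSpace U] [TopologicalSpace.SeparableSpace U] [MeasurableSpace U] [BorelSpace U]
  {T : ℝ} {qs : ℝ → M} {L : LagrangianChart E T qs} {f : ControlSystem E M U} {δ : ℝ} {h : ℝ → ℝ}

/-- Both g and g_x change by at most hD through the point and by at most 2h where the controls
differ, hence by (I + 2)D in the integral, with I = ∫h; the initial point adds D. A third pair p₀ is
carried along so that one statement serves both p₀ the reference and p₀ = p. -/
theorem TubeOn.rho_le (hT : 0 ≤ T) (hh : IntegrableOn h (Icc 0 T)) (hh0 : ∀ t, 0 ≤ h t)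
    (H : TubeOn L f 0 T δ h) {p p' : M × (ℝ → U)} (hw : IsControl T p.2) (hw' : IsControl T p'.2)
    {x x' : ℝ → E} (hx : ∀ t ∈ Icc 0 T, L.x f p.1 p.2 t = x t)
    (hx' : ∀ t ∈ Icc 0 T, L.x f p'.1 p'.2 t = x' t)
    (hb : ∀ t ∈ Icc 0 T, x t ∈ Metric.ball (L.φ (qs 0)) δ)
    (hb' : ∀ t ∈ Icc 0 T, x' t ∈ Metric.ball (L.φ (qs 0)) δ) {D : ℝ}
    (hφ : ‖L.φ p.1 - L.φ p'.1‖ ≤ D) (hxx : ∀ t ∈ Icc 0 T, ‖x t - x' t‖ ≤ D)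
    (hD : controlDist T h p.2 p'.2 ≤ D) (p₀ : M × (ℝ → U)) :
    L.rho f p₀ p' ≤ L.rho f p₀ p
      + ENNReal.ofReal ((1 + 2 * ((∫ t in (0 : ℝ)..T, h t) + 2)) * D) := by
  have hD0 : 0 ≤ D := (norm_nonneg _).trans hφ
  set I := ∫ t in (0 : ℝ)..T, h t with hI
  have hI0 : 0 ≤ I := intervalIntegral.integral_nonneg hT fun t _ => hh0 t
  set S : Set ℝ := {t | p.2 t ≠ p'.2 t} with hS
  -- Splitting the integral of a sum needs measurability of one summand only; this majorant provides
  -- it.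
  let m : ℝ → ℝ≥0∞ := fun t =>
    ENNReal.ofReal D * ENNReal.ofReal (h t) + 2 * S.indicator (fun t => ENNReal.ofReal (h t)) t
  have hhm : AEMeasurable (fun t => ENNReal.ofReal (h t)) (volume.restrict (Icc 0 T)) :=
    hh.1.aemeasurable.ennreal_ofReal
  have hSm := hw.nullMeasurableSet_ne hw'
  have hmm : AEMeasurable m (volume.restrict (Icc 0 T)) :=
    (hhm.const_mul _).add ((hhm.indicator₀ hSm).const_mul _)
  have hmint : ∫⁻ t in Icc 0 T, m t ≤ ENNReal.ofReal ((I + 2) * D) := by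
    simp only [m]
    rw [lintegral_add_left' (hhm.const_mul _), lintegral_const_mul' _ _ ENNReal.ofReal_ne_top,
      lintegral_const_mul' _ _ ENNReal.ofNat_ne_top, lintegral_le_controlDist hh hw hw',
      ← ofReal_integral_eq_lintegral_ofReal hh (ae_of_all _ hh0), integral_Icc_eq_integral_Ioc,
      ← intervalIntegral.integral_of_le hT, ← hI, ← ENNReal.ofReal_mul hD0,
      ← ENNReal.ofReal_ofNat, ← ENNReal.ofReal_mul zero_le_two, ← ENNReal.ofReal_add
        (by positivity) (mul_nonneg zero_le_two (controlDist_nonneg _ _))]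
    refine ENNReal.ofReal_le_ofReal ?_
    nlinarith
  have key : ∀ {F : Type _} [NormedAddCommGroup F] (a b c : ℝ → F),
      (∀ᵐ t ∂volume.restrict (Icc 0 T), ‖b t - c t‖ ≤ D * h t + 2 * S.indicator h t) →
      ∫⁻ t in Icc 0 T, ‖a t - c t‖ₑ ≤ (∫⁻ t in Icc 0 T, ‖a t - b t‖ₑ)
        + ENNReal.ofReal ((I + 2) * D) := by
    intro F _ a b c hbc
    refine le_trans ?_ (add_le_add le_rfl hmint)
    rw [← lintegral_add_right' _ hmm]
    refine lintegral_mono_ae (hbc.mono fun t ht => ?_)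
    have e1 : a t - c t = (a t - b t) + (b t - c t) := by abel
    rw [e1]
    refine (enorm_add_le _ _).trans (add_le_add le_rfl ?_)
    rw [← ofReal_norm]
    refine (ENNReal.ofReal_le_ofReal ht).trans (le_of_eq ?_)
    have hind : 0 ≤ S.indicator h t := indicator_nonneg (fun t _ => hh0 t) t
    rw [ENNReal.ofReal_add (mul_nonneg hD0 (hh0 t)) (by positivity), ENNReal.ofReal_mul hD0,
      ENNReal.ofReal_mul zero_le_two, ENNReal.ofReal_ofNat]
    simp only [m]
    congr 2
    by_cases hs : t ∈ S
    · rw [indicator_of_mem hs, indicator_of_mem hs]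
    · rw [indicator_of_notMem hs, indicator_of_notMem hs, ENNReal.ofReal_zero]
  have key2 : ∀ {F : Type _} [NormedAddCommGroup F] (t : ℝ) (Θ : E → U → F), t ∈ Icc 0 T →
      (∀ u, ∀ y ∈ Metric.ball (L.φ (qs 0)) δ, ‖Θ y u‖ ≤ h t) →
      (∀ u, ∀ y ∈ Metric.ball (L.φ (qs 0)) δ, ∀ y' ∈ Metric.ball (L.φ (qs 0)) δ,
        ‖Θ y u - Θ y' u‖ ≤ h t * ‖y - y'‖) →
      ‖Θ (L.x f p.1 p.2 t) (p.2 t) - Θ (L.x f p'.1 p'.2 t) (p'.2 t)‖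
        ≤ D * h t + 2 * S.indicator h t := by
    intro F _ t Θ ht h1 h2
    rw [hx t ht, hx' t ht]
    have e1 : Θ (x t) (p.2 t) - Θ (x' t) (p'.2 t) = (Θ (x t) (p.2 t) - Θ (x' t) (p.2 t))
        + (Θ (x' t) (p.2 t) - Θ (x' t) (p'.2 t)) := by abel
    rw [e1]
    refine (norm_add_le _ _).trans (add_le_add ?_ ?_)
    · refine (h2 _ _ (hb t ht) _ (hb' t ht)).trans ?_
      rw [mul_comm]
      exact mul_le_mul_of_nonneg_right (hxx t ht) (hh0 t)
    · by_cases hs : t ∈ S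
      · rw [indicator_of_mem hs, two_mul]
        exact (norm_sub_le _ _).trans (add_le_add (h1 _ _ (hb' t ht)) (h1 _ _ (hb' t ht)))
      · rw [indicator_of_notMem hs, not_not.1 hs, sub_self, norm_zero, mul_zero]
  have k1 := key (fun t => L.g f t (L.x f p₀.1 p₀.2 t) (p₀.2 t))
    (fun t => L.g f t (L.x f p.1 p.2 t) (p.2 t)) (fun t => L.g f t (L.x f p'.1 p'.2 t) (p'.2 t)) (by
      filter_upwards [H.reg, ae_restrict_mem measurableSet_Icc] with t h1 ht
      exact key2 t (fun y u => L.g f t y u) ht (fun u => (h1 u).bound) fun u => (h1 u).lip)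
  have k2 := key (fun t => L.gx f t (L.x f p₀.1 p₀.2 t) (p₀.2 t))
    (fun t => L.gx f t (L.x f p.1 p.2 t) (p.2 t))
    (fun t => L.gx f t (L.x f p'.1 p'.2 t) (p'.2 t)) (by
      filter_upwards [H.reg, ae_restrict_mem measurableSet_Icc] with t h1 ht
      exact key2 t (fun y u => L.gx f t y u) ht (fun u => (h1 u).fderiv_bound)
        fun u => (h1 u).fderiv_lip)
  have k0 : ‖L.φ p₀.1 - L.φ p'.1‖ₑ ≤ ‖L.φ p₀.1 - L.φ p.1‖ₑ + ENNReal.ofReal D := by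
    have e1 : L.φ p₀.1 - L.φ p'.1 = (L.φ p₀.1 - L.φ p.1) + (L.φ p.1 - L.φ p'.1) := by abel
    rw [e1]
    refine (enorm_add_le _ _).trans (add_le_add le_rfl ?_)
    rw [← ofReal_norm]
    exact ENNReal.ofReal_le_ofReal hφ
  have hK : ENNReal.ofReal ((1 + 2 * (I + 2)) * D) = ENNReal.ofReal D
      + ENNReal.ofReal ((I + 2) * D) + ENNReal.ofReal ((I + 2) * D) := by
    rw [← ENNReal.ofReal_add hD0 (by positivity), ← ENNReal.ofReal_add (by positivity)
      (by positivity)]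
    congr 1; ring
  unfold LagrangianChart.rho
  rw [hK]
  refine (add_le_add (add_le_add k0 k1) k2).trans (le_of_eq ?_)
  ring

end RhoBound

/-! ### From infinitesimal variations to controls that decrease Φ. -/

section Main

variable {E : Type*} [NormedAddCommGroup E] [NormedSpace ℝ E]
  {M : Type*} [TopologicalSpace M] [T2Space M] [ChartedSpace E M] {U : Type*}
  [MeasurableSpace U]
  {T : ℝ} {qs : ℝ → M} {L : LagrangianChart E T qs} {f : ControlSystem E M U} {δ : ℝ} {h : ℝ → ℝ}

theorem LagrangianChart.ψ_zero (hT : 0 ≤ T) {q : M} (hq : q ∈ L.φ.source) : L.ψ 0 q = L.φ q := by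
  conv_lhs => rw [← L.P_zero hq]
  exact L.ψ_P ⟨le_rfl, hT⟩ hq

/-- Infinitesimal variations are realized, to first order, by controls. -/
theorem TubeOn.exists_control_of_variation [CompleteSpace E] (hT : 0 ≤ T) (hδ : 0 < δ)
    (hh : IntegrableOn h (Icc 0 T)) (hh0 : ∀ t, 0 ≤ h t) (H : TubeOn L f 0 T δ h)
    (hball : Metric.ball (L.φ (qs 0)) δ ⊆ L.φ.target) :
    ∃ r₀ > 0, ∃ C, 0 ≤ C ∧ ∀ (z : E) (w : ℝ → U) (x : ℝ → E), IsControl T w →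
      IsTraj T (L.φ (qs 0)) δ (fun t x => L.g f t x (w t)) z x →
      (∀ t ∈ Icc 0 T, ‖x t - L.φ (qs 0)‖ ≤ δ / 4) →
      ∀ ζ ∈ L.variations f (L.φ.symm z, w), ∀ r ∈ Icc 0 r₀, ∀ ε > 0, ∃ w' x', IsControl T w' ∧
        IsTraj T (L.φ (qs 0)) δ (fun t x => L.g f t x (w' t)) (z + r • ζ.1) x' ∧
        controlDist T h w w' ≤ r * (∫ t in (0 : ℝ)..T, h t) + ε ∧
        ‖x' T - x T - r • ζ.2‖ ≤ C * r ^ 2 + ε := by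
  obtain ⟨r₀, hr₀, hr₀1, C, hC, hexp⟩ := exists_traj_expansion (δ := δ) E hT hδ hh hh0
  refine ⟨r₀, hr₀, C, hC, fun z w x hw hx hxb ζ hζ r hr ε hε => ?_⟩
  obtain ⟨hζ1, ν, hν⟩ := hζ
  have hTT : T ∈ Icc 0 T := ⟨hT, le_rfl⟩
  have hz : z ∈ L.φ.target := by
    refine hball ?_
    have := hxb 0 ⟨le_rfl, hT⟩
    rw [hx.initial] at this
    rw [Metric.mem_ball, dist_eq_norm]
    linarith
  have hW := H.isC11Control.field hw
  have hN := H.isC11Control.mixField ν.weight_nonneg ν.weight_sum ν.isControl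
  have hr1 : ∀ r ∈ Icc 0 r₀, r ∈ Icc (0 : ℝ) 1 := fun r hr => ⟨hr.1, hr.2.trans hr₀1⟩
  have hXex : ∀ r, ∃ X, r ∈ Icc 0 r₀ → IsTraj T (L.φ (qs 0)) δ (fun t x => (1 - r) • L.g f t x (w t)
      + r • ∑ i, ν.weight i • L.g f t x (ν.control i t)) (z + r • ζ.1) X := by
    intro r
    by_cases hr : r ∈ Icc 0 r₀
    · obtain ⟨X, hX⟩ := (hW.convex hN (hr1 r hr)).exists_isTraj hT hδ hh hh0 (z + r • ζ.1)
      exact ⟨X, fun _ => hX⟩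
    · exact ⟨x, fun h => absurd h hr⟩
  choose X hX using hXex
  obtain ⟨hXb, hXd⟩ := hexp (L.φ (qs 0)) _ _ z ζ.1 x X hW hN hζ1 hx hxb hX
  have heq : ∀ r ∈ Icc 0 r₀,
      L.ψ T (relaxedTraj f (L.φ.symm (L.φ (L.φ.symm z) + r • ζ.1)) w ν r T) = X r T := by
    intro r hr
    rw [L.φ.right_inv hz]
    exact H.relaxedTraj_eq hT hδ hball hw ν (hr1 r hr) (hX r hr) fun t ht => (hXb r hr t ht).2
  -- For r in [0, r₀] the relaxed trajectories on M and in the tube have the same endpoint in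
  -- coordinates, so the derivative defining the variation is that of X.
  have hder : HasDerivWithinAt (fun r => X r T) ζ.2 (Ici 0) 0 := by
    refine hν.congr_of_eventuallyEq ?_ (heq 0 ⟨le_rfl, hr₀.le⟩).symm
    filter_upwards [Icc_mem_nhdsGE hr₀] with r hr
    exact (heq r hr).symm
  obtain ⟨w', hw', hd, hcl⟩ := H.isC11Control.exists_approx hT hδ hh hh0 ν.weight_nonneg
    ν.weight_sum ν.isControl hw (hr1 r hr) (hX r hr) hε
  obtain ⟨x', hx'⟩ := (H.isC11Control.field hw').exists_isTraj hT hδ hh hh0 (z + r • ζ.1)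
  refine ⟨w', x', hw', hx', hd, ?_⟩
  have h1 := hcl x' hx' T hTT
  have h2 := hXd ζ.2 hder r hr
  have e1 : x' T - x T - r • ζ.2 = (X r T - x T - r • ζ.2) - (X r T - x' T) := by abel
  rw [e1]
  exact (norm_sub_le _ _).trans (add_le_add h2 h1)

/-- A variation along which `Φ` decreases yields a control along which `Φ` decreases. -/
theorem TubeOn.exists_decrease [CompleteSpace E] (hT : 0 ≤ T) (hδ : 0 < δ)
    (hh : IntegrableOn h (Icc 0 T))
    (hh0 : ∀ t, 0 ≤ h t) (H : TubeOn L f 0 T δ h)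
    (hball : Metric.ball (L.φ (qs 0)) δ ⊆ L.φ.target) {S : Set (M × M)} {z : E} {w : ℝ → U}
    {x : ℝ → E} (hw : IsControl T w)
    (hx : IsTraj T (L.φ (qs 0)) δ (fun t x => L.g f t x (w t)) z x)
    (hxb : ∀ t ∈ Icc 0 T, ‖x t - L.φ (qs 0)‖ ≤ δ / 4) {v : E × E} {Δ κ : ℝ} (hκ : 0 ≤ κ)
    (hκΔ : κ * (1 + ∫ t in (0 : ℝ)..T, h t) < Δ)
    (hv : weakLowerDini (closure (L.variations f (L.φ.symm z, w))) (L.PhiCoord S)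
      (z, x T) v < ((-Δ : ℝ) : EReal)) :
    ∃ z' w' x', IsControl T w' ∧ IsTraj T (L.φ (qs 0)) δ (fun t x => L.g f t x (w' t)) z' x' ∧
      L.PhiCoord S (z', x' T) <
        L.PhiCoord S (z, x T) - κ * (‖z - z'‖ + controlDist T h w w') := by
  obtain ⟨r₀, hr₀, C, hC, hreal⟩ := H.exists_control_of_variation hT hδ hh hh0 hball
  set I := ∫ t in (0 : ℝ)..T, h t with hI
  -- The gap is split into four: γr for leaving the closure, γr for the second-order term Cr², γr =
  -- (1 + κ)ε for the switching error in Φ and in the distance; the last γr makes the inequality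
  -- strict.
  set γ := (Δ - κ * (1 + I)) / 4 with hγ
  have hγ0 : 0 < γ := by rw [hγ]; linarith
  obtain ⟨d, ⟨ζs, rs, hζs, -, hrs, hrs0, hlim⟩, hdΔ⟩ := sInf_lt_iff.1 hv
  have ev1 : ∀ᶠ n in atTop, (L.PhiCoord S ((z, x T) + rs n • ζs n) - L.PhiCoord S (z, x T)) / rs n
      < -Δ := by
    filter_upwards [hlim.eventually_lt_const hdΔ] with n hn
    exact_mod_cast hn
  have ev2 : ∀ᶠ n in atTop, rs n < min r₀ (γ / (C + 1)) :=
    (hrs.mono_right nhdsWithin_le_nhds).eventually_lt_const (by positivity)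
  obtain ⟨n, hn1, hn2⟩ := (ev1.and ev2).exists
  set r := rs n with hr
  have hr0 : 0 < r := hrs0 n
  -- A single term of the sequence suffices, once its difference quotient is below −Δ and its
  -- parameter r is small.
  obtain ⟨ζ, hζ, hζζ⟩ := Metric.mem_closure_iff.1 (hζs n) γ hγ0
  obtain ⟨w', x', hw', hx', hd, hx'T⟩ := hreal z w x hw hx hxb ζ hζ r
    ⟨hr0.le, hn2.le.trans (min_le_left _ _)⟩ (γ * r / (1 + κ)) (by positivity)
  have hε : γ * r / (1 + κ) * (1 + κ) = γ * r := by field_simp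
  set ε := γ * r / (1 + κ) with hεdef
  refine ⟨z + r • ζ.1, w', x', hw', hx', ?_⟩
  have hCr : C * r ≤ γ := by
    have h1 : r * (C + 1) ≤ γ / (C + 1) * (C + 1) := by
      gcongr; exact hn2.le.trans (min_le_right _ _)
    have h2 : γ / (C + 1) * (C + 1) = γ := by field_simp
    nlinarith
  have hz' : ‖z - (z + r • ζ.1)‖ ≤ r := by
    rw [sub_add_cancel_left, norm_neg, norm_smul, Real.norm_of_nonneg hr0.le]
    nlinarith [hζ.1]
  have hζn : ‖ζs n - ζ‖ < γ := by rwa [← dist_eq_norm]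
  have hdist : dist ((z + r • ζ.1, x' T) : E × E) ((z, x T) + r • ζs n)
      ≤ r * γ + (C * r ^ 2 + ε) := by
    have hε0 : 0 ≤ ε := by positivity
    have hCr2 : 0 ≤ C * r ^ 2 := by positivity
    rw [dist_eq_norm]
    have e1 : ((z + r • ζ.1, x' T) : E × E) - ((z, x T) + r • ζs n)
        = -(r • (ζs n - ζ)) + (0, x' T - x T - r • ζ.2) := by
      refine Prod.ext ?_ ?_
      · simp only [Prod.fst_sub, Prod.fst_add, Prod.fst_neg, Prod.smul_fst, smul_sub]; abel
      · simp only [Prod.snd_sub, Prod.snd_add, Prod.snd_neg, Prod.smul_snd, smul_sub]; abel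
    rw [e1]
    refine (norm_add_le _ _).trans (add_le_add ?_ ?_)
    · rw [norm_neg, norm_smul, Real.norm_of_nonneg hr0.le]
      gcongr
    · rw [Prod.norm_def]
      simp only [norm_zero]
      exact max_le (by positivity) hx'T
  have hLip : L.PhiCoord S (z + r • ζ.1, x' T)
      ≤ L.PhiCoord S ((z, x T) + r • ζs n) + (r * γ + (C * r ^ 2 + ε)) :=
    Metric.infDist_le_infDist_add_dist.trans (add_le_add le_rfl hdist)
  rw [div_lt_iff₀ hr0] at hn1
  have hκd : κ * (‖z - (z + r • ζ.1)‖ + controlDist T h w w') ≤ κ * (r + (r * I + ε)) := by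
    gcongr
  have h4 : Δ = 4 * γ + κ * (1 + I) := by rw [hγ]; ring
  have hγr : 0 < γ * r := by positivity
  have hCr2 : C * r ^ 2 ≤ γ * r := by nlinarith
  rw [h4] at hn1
  nlinarith

end Main

/-! ### Ekeland's principle for pairs, and the conclusion. -/

section MetricRegularity

variable {E : Type*} [NormedAddCommGroup E] [NormedSpace ℝ E] [CompleteSpace E]
  {M : Type*} [TopologicalSpace M] [ChartedSpace E M] {U : Type*}
  [MetricSpace U] [TopologicalSpace.SeparableSpace U] [MeasurableSpace U] [BorelSpace U]
  {T : ℝ} {qs : ℝ → M} {L : LagrangianChart E T qs} {f : ControlSystem E M U} {δ : ℝ} {h : ℝ → ℝ}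

/-- Ekeland's principle in the space of pairs of an initial point and a control. -/
theorem TubeOn.exists_ekeland_pair (hT : 0 ≤ T) (hδ : 0 < δ) (hh : IntegrableOn h (Icc 0 T))
    (hh1 : ∀ t, 1 ≤ h t) (H : TubeOn L f 0 T δ h) {S : Set (M × M)} {κ : ℝ} (hκ : 0 < κ)
    {z₀ : E} {w₀ : ℝ → U} (hw₀ : IsControl T w₀) {x₀ : ℝ → E}
    (hx₀ : IsTraj T (L.φ (qs 0)) δ (fun t x => L.g f t x (w₀ t)) z₀ x₀) :
    ∃ z w x, IsControl T w ∧ IsTraj T (L.φ (qs 0)) δ (fun t x => L.g f t x (w t)) z x ∧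
      κ * (‖z₀ - z‖ + controlDist T h w₀ w) ≤ L.PhiCoord S (z₀, x₀ T) - L.PhiCoord S (z, x T) ∧
      ∀ z' w' x', IsControl T w' →
        IsTraj T (L.φ (qs 0)) δ (fun t x => L.g f t x (w' t)) z' x' →
        L.PhiCoord S (z, x T) - κ * (‖z - z'‖ + controlDist T h w w')
          ≤ L.PhiCoord S (z', x' T) := by
  have hh0 : ∀ t, 0 ≤ h t := fun t => zero_le_one.trans (hh1 t)
  obtain ⟨C, hC, hlip⟩ := exists_traj_lipschitz (U := U) E hT hh hh0
  have hTT : T ∈ Icc 0 T := ⟨hT, le_rfl⟩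
  let Y := E × {w : ℝ → U // IsControl T w}
  have hex : ∀ y : Y, ∃ x, IsTraj T (L.φ (qs 0)) δ (fun t x => L.g f t x (y.2.1 t)) y.1 x :=
    fun y => (H.isC11Control.field y.2.2).exists_isTraj hT hδ hh hh0 y.1
  choose X hX using hex
  let d : Y → Y → ℝ := fun y y' => ‖y.1 - y'.1‖ + controlDist T h y.2.1 y'.2.1
  -- The endpoint does not depend on the chosen trajectory, so Φ is a function of the pair.
  have huniq : ∀ (y : Y) (x : ℝ → E),
      IsTraj T (L.φ (qs 0)) δ (fun t x => L.g f t x (y.2.1 t)) y.1 x → x T = X y T := by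
    intro y x hx
    have := hlip _ δ (L.g f) hδ H.isC11Control y.2.1 y.2.1 y.2.2 y.2.2 y.1 y.1 x (X y) hx (hX y)
      T hTT
    rw [sub_self, norm_zero, controlDist_self, add_zero, mul_zero] at this
    exact sub_eq_zero.1 (norm_le_zero_iff.1 this)
  have hekl := exists_ekeland (d := d) (F := fun y => L.PhiCoord S (y.1, X y T)) (K := C) (κ := κ)
    (fun y y' => add_nonneg (norm_nonneg _) (controlDist_nonneg _ _))
    (fun y => by simp only [d, sub_self, norm_zero, controlDist_self, add_zero])
    (fun y₁ y₂ y₃ => ?_) (fun y hy => ?_) (fun y => Metric.infDist_nonneg) (fun y y' => ?_) hκ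
    (z₀, ⟨w₀, hw₀⟩)
  rotate_left
  · have h1 := norm_sub_le_norm_sub_add_norm_sub y₁.1 y₂.1 y₃.1
    have h2 := controlDist_triangle hh y₁.2.1 y₂.2.1 y₃.2.1
    simp only [d]
    linarith
  · have s1 : Summable fun n => ‖(y n).1 - (y (n + 1)).1‖ := hy.of_nonneg_of_le
      (fun n => norm_nonneg _) fun n => le_add_of_nonneg_right (controlDist_nonneg _ _)
    have s2 : Summable fun n => controlDist T h (y n).2.1 (y (n + 1)).2.1 := hy.of_nonneg_of_le
      (fun n => controlDist_nonneg _ _) fun n => le_add_of_nonneg_left (norm_nonneg _)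
    have hcau : CauchySeq fun n => (y n).1 :=
      cauchySeq_of_summable_dist (by simpa only [dist_eq_norm] using s1)
    obtain ⟨z, hz⟩ := cauchySeq_tendsto_of_complete hcau
    obtain ⟨w, hw, hwlim⟩ := exists_tendsto_controlDist hh hh1 (fun n => (y n).2.2) s2
    refine ⟨(z, ⟨w, hw⟩), ?_⟩
    simpa using (tendsto_iff_norm_sub_tendsto_zero.1 hz).add hwlim
  · have h1 := hlip _ δ (L.g f) hδ H.isC11Control y.2.1 y'.2.1 y.2.2 y'.2.2 y.1 y'.1 (X y) (X y')
      (hX y) (hX y') T hTT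
    have hd0 : 0 ≤ d y y' := add_nonneg (norm_nonneg _) (controlDist_nonneg _ _)
    have h2 : ‖y.1 - y'.1‖ ≤ C * d y y' := by
      have : ‖y.1 - y'.1‖ ≤ d y y' := le_add_of_nonneg_right (controlDist_nonneg _ _)
      nlinarith
    have h3 := (Metric.lipschitz_infDist_pt (L.imageS S)).dist_le_mul (y.1, X y T) (y'.1, X y' T)
    rw [Real.dist_eq, NNReal.coe_one, one_mul, Prod.dist_eq, dist_eq_norm, dist_eq_norm] at h3
    exact h3.trans (max_le h2 h1)
  · obtain ⟨y, hy1, hy2⟩ := hekl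
    refine ⟨y.1, y.2.1, X y, y.2.2, hX y, ?_, fun z' w' x' hw' hx' => ?_⟩
    · rw [huniq (z₀, ⟨w₀, hw₀⟩) x₀ hx₀]
      exact hy1
    · rw [huniq (z', ⟨w', hw'⟩) x' hx']
      exact hy2 (z', ⟨w', hw'⟩)

/-- Starting from a pair close to the reference, Ekeland's principle yields a pair that stays in the
tube and within the range of controllability. Controllability forces it to be admissible, and its
distance to the start is controlled by Φ. -/
theorem metric_regularity [T2Space M] (hT : 0 ≤ T) {S : Set (M × M)} {u : ℝ → U}
    (hD : AssumptionD f T qs) (htraj : traj f T (qs 0) u = qs) {O₀ : Set M} (hO₀ : O₀ ∈ 𝓝 (qs 0))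
    (hO₀L : closure O₀ ⊆ L.φ.source) (hadm : (qs 0, u) ∈ L.admissible f O₀ S)
    (hctrl : WeaklyControllable L f O₀ S (qs 0, u)) :
    ∃ ε₁ κ : ℝ, 0 < ε₁ ∧ 0 < κ ∧
      ∀ p ∈ L.X f O₀, L.rho f (qs 0, u) p < ENNReal.ofReal ε₁ →
        L.rhoA f O₀ S p ≤ ENNReal.ofReal (κ * L.Phi S p.1 (traj f T p.1 p.2 T)) := by
  obtain ⟨⟨hu, hexu, -⟩, hS⟩ := hadm
  have hqs : IsACSolution (controlField f u) T (qs 0) qs := by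
    have := isACSolution_solution hexu
    rw [show solution (controlField f u) T (qs 0) = qs from htraj] at this
    exact this
  rw [htraj] at hS
  obtain ⟨ε₀, Δ, hε₀, hΔ, hctrl⟩ := hctrl
  obtain ⟨δ₁, hδ₁, h₁, hh₁, hh₁0, hball₁, H₁⟩ := exists_tubeOn (L := L) hT hD
  set x₀ := L.φ (qs 0) with hx₀
  have hx₀t : x₀ ∈ L.φ.target := L.φ.map_source L.base_mem
  obtain ⟨δ₂, hδ₂, hO⟩ := Metric.eventually_nhds_iff_ball.1
    (show ∀ᶠ y in 𝓝 x₀, L.φ.symm y ∈ O₀ from (L.φ.continuousAt_symm hx₀t)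
      (by rwa [hx₀, L.φ.left_inv L.base_mem]))
  -- Besides the tube, the ball must be mapped into O₀ by φ⁻¹, so that pairs whose trajectory
  -- remains in it belong to 𝒳.
  set δ := min δ₁ δ₂ with hδdef
  have hδ : 0 < δ := lt_min hδ₁ hδ₂
  -- The bound is raised by 1 for the completeness of the space of controls.
  let h : ℝ → ℝ := fun t => h₁ t + 1
  have hh : IntegrableOn h (Icc 0 T) := hh₁.integrableOn.add (integrableOn_const (by simp))
  have hh1 : ∀ t, 1 ≤ h t := fun t => by simp only [h]; linarith [hh₁0 t]
  have hh0 : ∀ t, 0 ≤ h t := fun t => zero_le_one.trans (hh1 t)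
  have H : TubeOn L f 0 T δ h := H₁.mono (min_le_left _ _) fun t => by simp only [h]; linarith
  have hball : Metric.ball x₀ δ ⊆ L.φ.target :=
    (Metric.ball_subset_ball (min_le_left _ _)).trans hball₁
  have hO : ∀ y ∈ Metric.ball x₀ δ, L.φ.symm y ∈ O₀ := fun y hy =>
    hO y (Metric.ball_subset_ball (min_le_right _ _) hy)
  obtain ⟨C, hC, hlip⟩ := exists_traj_lipschitz (U := U) E hT hh hh0
  set I := ∫ t in (0 : ℝ)..T, h t with hI
  have hI0 : 0 ≤ I := intervalIntegral.integral_nonneg hT fun t _ => hh0 t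
  -- A variation with parameter r costs about r(1 + I) in distance; with this slope the cost in Φ is
  -- Δr/2, less than the gain Δr.
  set κ := Δ / (2 * (1 + I)) with hκdef
  have hκ : 0 < κ := by positivity
  have hκΔ : κ * (1 + I) < Δ := by
    have : κ * (1 + I) = Δ / 2 := by rw [hκdef]; field_simp
    linarith
  set K := 1 + 2 * (I + 2) with hK
  have hK0 : 0 < K := by positivity
  have hC0 : 0 < C := by linarith
  -- The Ekeland pair is at distance at most ε₁/κ from the start. The first bound keeps its
  -- trajectory within δ/4 of x₀, the second keeps its ρ-distance to the reference below ε₀.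
  set ε₁ := min (δ / 4 / (1 + C / κ)) (ε₀ / (1 + K * C / κ)) with hε₁
  have hε₁0 : 0 < ε₁ := by positivity
  have hε₁δ : ε₁ * (1 + C / κ) ≤ δ / 4 := by
    rw [← le_div_iff₀ (by positivity)]; exact min_le_left _ _
  have hε₁ε₀ : ε₁ * (1 + K * C / κ) ≤ ε₀ := by
    rw [← le_div_iff₀ (by positivity)]; exact min_le_right _ _
  have hε₁' : ε₁ ≤ δ / 4 := by
    have : 0 ≤ ε₁ * (C / κ) := by positivity
    linarith
  have hTT : T ∈ Icc 0 T := ⟨hT, le_rfl⟩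
  refine ⟨ε₁, K * C / κ, hε₁0, by positivity, ?_⟩
  rintro ⟨q, w⟩ ⟨hw, hex, hin⟩ hρ
  have hw : IsControl T w := hw
  have hsol := isACSolution_solution hex
  have hq : q ∈ L.φ.source := by
    obtain ⟨q', hq', hq'q⟩ := hin 0 ⟨le_rfl, hT⟩
    have h0 : traj f T q w 0 = q := hsol.initial
    rw [h0, L.P_zero (hO₀L hq')] at hq'q
    exact hq'q ▸ hO₀L hq'
  obtain ⟨x, hx⟩ := (H.isC11Control.field hw).exists_isTraj hT hδ hh hh0 (L.φ q)
  have hxε := H.norm_lt_of_rho_lt hT hδ hh hh0 hball hu hqs htraj hq hw hex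
    (by linarith : ε₁ ≤ δ / 2) hρ hx
  have hxx : ∀ t ∈ Icc 0 T, L.x f q w t = x t :=
    H.eq_of_isACSolution hδ hball hw hq hsol hx hTT fun t ht => (hxε t ht).le.trans (by linarith)
  have hΦ : L.Phi S q (traj f T q w T) = L.PhiCoord S (L.φ q, x T) := by
    unfold LagrangianChart.Phi
    rw [LagrangianChart.ψ_zero hT hq]
    congr 2
    exact hxx T hTT
  have hΦε : L.PhiCoord S (L.φ q, x T) ≤ ε₁ := by
    -- The reference pair is admissible and is (x₀, x₀) in coordinates; so Φ is at most the distance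
    -- of the endpoints from x₀.
    have hmem : (x₀, x₀) ∈ L.imageS S := by
      refine ⟨(qs 0, qs T), ⟨hS, L.base_mem, qs 0, L.base_mem, L.P_base hTT⟩, ?_⟩
      simp only [LagrangianChart.ψ_zero hT L.base_mem, L.ψ_base hTT, hx₀]
    refine (Metric.infDist_le_dist_of_mem hmem).trans ?_
    rw [Prod.dist_eq, dist_eq_norm, dist_eq_norm]
    have h0 := hxε 0 ⟨le_rfl, hT⟩
    rw [hx.initial] at h0
    exact max_le h0.le (hxε T hTT).le
  obtain ⟨z, w', x', hw', hx', hek, hmin⟩ := H.exists_ekeland_pair (S := S) hT hδ hh hh1 hκ hw hx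
  set D := ‖L.φ q - z‖ + controlDist T h w w' with hDdef
  have hD0 : 0 ≤ D := add_nonneg (norm_nonneg _) (controlDist_nonneg _ _)
  have hDΦ : D ≤ L.PhiCoord S (L.φ q, x T) / κ := by
    rw [le_div_iff₀ hκ]
    have : 0 ≤ L.PhiCoord S (z, x' T) := Metric.infDist_nonneg
    linarith
  have hDε : D ≤ ε₁ / κ := hDΦ.trans (by gcongr)
  have hclose : ∀ t ∈ Icc 0 T, ‖x t - x' t‖ ≤ C * D :=
    hlip _ δ (L.g f) hδ H.isC11Control w w' hw hw' _ _ x x' hx hx'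
  have hx'b : ∀ t ∈ Icc 0 T, ‖x' t - x₀‖ ≤ δ / 4 := by
    intro t ht
    have e1 : x' t - x₀ = (x t - x₀) - (x t - x' t) := by abel
    rw [e1]
    have h1 : C * D ≤ C * (ε₁ / κ) := by gcongr
    have h2 : ε₁ * (1 + C / κ) = ε₁ + C * (ε₁ / κ) := by ring
    linarith [norm_sub_le (x t - x₀) (x t - x' t), hclose t ht, hxε t ht]
  have hinb : ∀ t ∈ Icc 0 T, x' t ∈ Metric.ball x₀ δ := fun t ht => by
    rw [Metric.mem_ball, dist_eq_norm]; linarith [hx'b t ht]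
  have hzt : z ∈ L.φ.target := by
    have := hball (hinb 0 ⟨le_rfl, hT⟩)
    rwa [hx'.initial] at this
  obtain ⟨hex', htr⟩ := H.traj_eq hT hδ hball hw' hx' fun t ht => (hx'b t ht).trans (by linarith)
  set p' : M × (ℝ → U) := (L.φ.symm z, w') with hp'
  have hp'X : p' ∈ L.X f O₀ := by
    refine ⟨hw', hex', fun t ht => ?_⟩
    rw [(htr t ht).1]
    exact ⟨_, subset_closure (hO _ (hinb t ht)), rfl⟩
  have hφz : L.φ p'.1 = z := L.φ.right_inv hzt
  -- As C ≥ 1, the number CD bounds the initial points, the trajectories and the controls at once.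
  have hCD : D ≤ C * D := by nlinarith
  have hrho := H.rho_le hT hh hh0 (p := (q, w)) (p' := p') hw hw' hxx (fun t ht => (htr t ht).2)
    (fun t ht => by rw [Metric.mem_ball, dist_eq_norm]; linarith [hxε t ht]) hinb (D := C * D)
    (by rw [hφz]; exact (le_add_of_nonneg_right (controlDist_nonneg _ _)).trans hCD) hclose
    ((le_add_of_nonneg_left (norm_nonneg _)).trans hCD)
  have hadm' : p' ∈ L.admissible f O₀ S := by
    -- If it were not admissible, controllability would give a pair violating Ekeland's inequality.
    by_contra hna
    have hρ' : L.rho f (qs 0, u) p' < ENNReal.ofReal ε₀ := by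
      refine (hrho (qs 0, u)).trans_lt ?_
      have h1 : K * (C * D) ≤ ε₁ * (K * C / κ) := by
        calc K * (C * D) ≤ K * (C * (ε₁ / κ)) := by gcongr
          _ = ε₁ * (K * C / κ) := by ring
      calc L.rho f (qs 0, u) (q, w) + ENNReal.ofReal (K * (C * D))
          < ENNReal.ofReal ε₁ + ENNReal.ofReal (ε₁ * (K * C / κ)) :=
            ENNReal.add_lt_add_of_lt_of_le ENNReal.ofReal_ne_top hρ (ENNReal.ofReal_le_ofReal h1)
        _ = ENNReal.ofReal (ε₁ * (1 + K * C / κ)) := by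
            rw [← ENNReal.ofReal_add hε₁0.le (by positivity)]; congr 1; ring
        _ ≤ ENNReal.ofReal ε₀ := ENNReal.ofReal_le_ofReal hε₁ε₀
    obtain ⟨v, -, hv⟩ := hctrl p' hp'X hna hρ'
    have e1 : L.ψ 0 p'.1 = z := by rw [LagrangianChart.ψ_zero hT (L.φ.map_target hzt), hφz]
    have e2 : L.ψ T (traj f T p'.1 p'.2 T) = x' T := (htr T hTT).2
    rw [e1, e2] at hv
    obtain ⟨z'', w'', x'', hw'', hx'', hlt⟩ :=
      H.exists_decrease hT hδ hh hh0 hball hw' hx' hx'b hκ.le hκΔ hv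
    exact absurd (hmin z'' w'' x'' hw'' hx'') (not_le.2 hlt)
  refine (iInf₂_le p' hadm').trans ((hrho (q, w)).trans ?_)
  rw [rho_self, zero_add]
  refine ENNReal.ofReal_le_ofReal ?_
  simp only [hΦ]
  calc K * (C * D) ≤ K * (C * (L.PhiCoord S (L.φ q, x T) / κ)) := by gcongr
    _ = K * C / κ * L.PhiCoord S (L.φ q, x T) := by ring

end MetricRegularity

end ControlOnManifold

open ControlOnManifold in
theorem mainTheorem4
    {E : Type*} [NormedAddCommGroup E] [NormedSpace ℝ E] [CompleteSpace E]
    {M : Type*} [TopologicalSpace M] [T2Space M] [ChartedSpace E M] [IsManifold 𝓘(ℝ, E) ∞ M]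
    {U : Type*} [MetricSpace U] [CompleteSpace U] [TopologicalSpace.SeparableSpace U]
    [MeasurableSpace U] [BorelSpace U]
    (T : ℝ) (hT : 0 < T)
    (f : ControlSystem E M U) (S : Set (M × M)) (hS : IsClosed S)
    (q₀ : M) (u : ℝ → U)
    -- Assumption (D) holds along the trajectory of the reference pair `(q₀, u)`
    (hD : AssumptionD f T (traj f T q₀ u))
    -- a Lagrangian chart along this trajectory, and a neighbourhood `O₀` of `q₀`
    (L : LagrangianChart E T (traj f T q₀ u))
    (O₀ : Set M) (hO₀ : O₀ ∈ 𝓝 q₀) (hO₀L : closure O₀ ⊆ L.φ.source)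
    (hadm : (q₀, u) ∈ L.admissible f O₀ S)
    (hctrl : WeaklyControllable L f O₀ S (q₀, u)) :
    ∃ ε₁ κ : ℝ, 0 < ε₁ ∧ 0 < κ ∧
      ∀ p ∈ L.X f O₀, L.rho f (q₀, u) p < ENNReal.ofReal ε₁ →
        L.rhoA f O₀ S p ≤ ENNReal.ofReal (κ * L.Phi S p.1 (traj f T p.1 p.2 T)) := by
  obtain ⟨⟨-, hex, -⟩, -⟩ := id hadm
  -- The Lagrangian chart is based at the initial point of the chosen trajectory, which has to be
  -- identified with q₀.
  have hq₀ : traj f T q₀ u 0 = q₀ := (isACSolution_solution hex).initial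
  have key := metric_regularity (L := L) (S := S) (u := u) (O₀ := O₀) hT.le hD (by rw [hq₀])
    (by rwa [hq₀]) hO₀L (by rwa [hq₀]) (by rwa [hq₀])
  rwa [hq₀] at key
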